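/- Let $(\Omega,\mathcal F,P)$ be a probability space with a non-decreasing sequence of sub-$\sigma$-algebras $(\mathcal F_n)_{n\ge0}$ such that $\mathcal F=\sigma(\bigcup_n\mathcal F_n)$; write $E_n$ for the conditional expectation given $\mathcal F_n$. Assume that $(\mathcal F_n)$ is regular: there is $R>0$ such that for all $n\ge1$ and $A\in\mathcal F_n$ there is $B\in\mathcal F_{n-1}$ with $A\subset B$ and $P(B)\le R\,P(A)$. Let $\ell\in(0,1]$ and let $\Phi:[0,\infty)\to[0,\infty)$ be concave with $\Phi(0)=0$, $\lim_{r\to\infty}\Phi(r)=\infty$ and, for some $c_\Phi\ge1$, $\Phi(tr)\le c_\Phi\max\{t^\ell,t\}\Phi(r)$ for all $t,r\ge0$ (so $\Phi$ is a bijection of $[0,\infty)$). Assume that $q_{\Phi^{-1}}:=\sup_{t>0}\frac{t(\Phi^{-1})'(t)}{\Phi^{-1}(t)}<\infty$ (with the right derivative of the convex function $\Phi^{-1}$), and put $\phi(r)=\frac1{r\Phi^{-1}(1/r)}$ for $r>0$. For measurable $u:\Omega\to[0,\infty]$ let $\|u\|_{wL_\Phi}=\inf\{c>0:\sup_{t>0}\Phi(t/c)P(u>t)\le1\}$.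 Let $w\mathscr H_\Phi$ be the space of real martingales $f=(f_n)_{n\ge0}$ with $f_0=0$ whose maximal function $M(f)=\sup_n|f_n|$ satisfies $\|M(f)\|_{wL_\Phi}<\infty$ and $\lim_{P(A)\to0}\|M(f)\chi_A\|_{wL_\Phi}=0$, with the quasi-norm $\|f\|_{wH_\Phi}=\|M(f)\|_{wL_\Phi}$. Its dual $(w\mathscr H_\Phi)^*$ consists of the linear functionals $l$ on it with $|l(f)|\le K\|f\|_{wH_\Phi}$ for some $K<\infty$, and $\|l\|=\sup_{\|f\|_{wH_\Phi}\le1}|l(f)|$. For $q\in[1,\infty)$ let $w\mathcal L_{q,\phi}$ be the space of real $g\in L_q$ with $E_0g=0$ and $$\|g\|_{w\mathcal L_{q,\phi}}=\int_0^\infty\frac{t_\phi^q(x)}x\,dx<\infty,\qquad t_\phi^q(x)=\frac1{\phi(x)}x^{-1/q}\sup_{P(\nu<\infty)\le x}\|g-g^\nu\|_q,$$ where $\nu$ runs over the stopping times with values in $\{0,1,\dots\}\cup\{\infty\}$ and $g^\nu$ is $g$ stopped at $\nu$: $g^\nu=E_ng$ on $\{\nu=n\}$, $g^\nu=g$ on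 $\{\nu=\infty\}$. Then for every $q\in[1,\infty)$, $(w\mathscr H_\Phi)^*=w\mathcal L_{q,\phi}$ in the following sense. Let $1/q+1/q'=1$, and say that $g$ represents $l$ if every $f\in L_{q'}$ with $E_0f=0$ belongs to $w\mathscr H_\Phi$ (as the martingale $(E_nf)_{n\ge 0}$) and $l(f)=E(fg)$ for all such $f$. Every $g\in w\mathcal L_{q,\phi}$ represents exactly one $l\in(w\mathscr H_\Phi)^*$; every $l\in(w\mathscr H_\Phi)^*$ is represented by some $g\in w\mathcal L_{q,\phi}$, unique up to a.e. equality; and there is a constant $C>0$ such that, whenever $g\in w\mathcal L_{q,\phi}$ represents $l\in(w\mathscr H_\Phi)^*$, $$\|l\|\le C\|g\|_{w\mathcal L_{q,\phi}}\quad\text{and}\quad\|g\|_{w\mathcal L_{q,\phi}}\le C\|l\|.$$ The case $q=1$ is included. -/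

import Mathlib

open MeasureTheory ProbabilityTheory Filter Set
open scoped ENNReal NNReal

noncomputable section

namespace WeakOrliczHardy

/-! ### The functions `Φ` -/

/-- The class `𝒢_ℓ`: functions `Φ : [0,∞) → [0,∞)` (only the values of `Φ` on `[0,∞)` matter) with
`Φ 0 = 0`, `Φ r → ∞`, of lower type `ℓ ∈ (0,1]` and of upper type `1`. -/
structure MemG (ℓ : ℝ) (Φ : ℝ → ℝ) : Prop where
  ell_pos : 0 < ℓ
  ell_le_one : ℓ ≤ 1
  map_zero : Φ 0 = 0
  nonneg : ∀ r, 0 ≤ r → 0 ≤ Φ r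
  tendsto_atTop : Tendsto Φ atTop atTop
  type_le : ∃ c : ℝ, 1 ≤ c ∧ ∀ t r : ℝ, 0 ≤ t → 0 ≤ r → Φ (t * r) ≤ c * max (t ^ ℓ) t * Φ r

/-- The inverse function `Φ⁻¹ : [0,∞) → [0,∞)` of a bijection `Φ : [0,∞) → [0,∞)`. -/
def inv (Φ : ℝ → ℝ) : ℝ → ℝ := Function.invFunOn Φ (Ici 0)

/-- The upper index `q_Ψ = sup_{t > 0} t Ψ'(t) / Ψ(t)`, where `Ψ'` is the right derivative. It is
used for the convex function `Ψ = Φ⁻¹`, whose right derivative exists everywhere and is the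
derivative off a countable set. -/
def upperIndex (Ψ : ℝ → ℝ) : EReal :=
  ⨆ (t : ℝ) (_ : 0 < t), ((t * derivWithin Ψ (Ioi t) t / Ψ t : ℝ) : EReal)

variable {Ω : Type*} {m : MeasurableSpace Ω}

/-! ### Weak Orlicz quasi-norm -/

/-- `‖u‖_{wL_Φ} = inf {c > 0 : sup_{t > 0} Φ(t/c) P(u > t) ≤ 1}` for `u : Ω → [0,∞]`; it is `∞` if
there is no such `c`. -/
def wNorm (Φ : ℝ → ℝ) (P : Measure Ω) (u : Ω → ℝ≥0∞) : ℝ≥0∞ :=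
  ⨅ (c : ℝ) (_ : 0 < c ∧ ∀ t : ℝ, 0 < t → Φ (t / c) * P.real {ω | ENNReal.ofReal t < u ω} ≤ 1),
    ENNReal.ofReal c

/-- `u ∈ wℒ_Φ` (script `ℒ`): `‖u‖_{wL_Φ} < ∞` and `‖u χ_A‖_{wL_Φ} → 0` as `P(A) → 0`. -/
structure MemWScriptL (Φ : ℝ → ℝ) (P : Measure Ω) (u : Ω → ℝ≥0∞) : Prop where
  wNorm_lt_top : wNorm Φ P u < ∞
  absCont : ∀ ε : ℝ≥0∞, 0 < ε → ∃ δ : ℝ≥0∞, 0 < δ ∧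
    ∀ A : Set Ω, MeasurableSet A → P A < δ → wNorm Φ P (A.indicator u) < ε

section helpers

lemma wNorm_lt_iff {Φ : ℝ → ℝ} {P : Measure Ω} {u : Ω → ℝ≥0∞} {ε : ℝ≥0∞} : wNorm Φ P u < ε ↔
    ∃ c : ℝ, (0 < c ∧ ∀ t : ℝ, 0 < t → Φ (t / c) * P.real {ω | ENNReal.ofReal t < u ω} ≤ 1) ∧
      ENNReal.ofReal c < ε := by
  simp only [wNorm, iInf_lt_iff, exists_prop]

variable {Φ : ℝ → ℝ} {ℓ : ℝ} {P : Measure Ω} [IsProbabilityMeasure P]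

lemma wNorm_mono (hΦ : MemG ℓ Φ) {u v : Ω → ℝ≥0∞} (h : ∀ ω, u ω ≤ v ω) :
    wNorm Φ P u ≤ wNorm Φ P v := by
  refine le_of_forall_gt fun ε hε => ?_
  obtain ⟨c, ⟨hc, hct⟩, hcε⟩ := wNorm_lt_iff.1 hε
  refine wNorm_lt_iff.2 ⟨c, ⟨hc, fun t ht => (mul_le_mul_of_nonneg_left ?_
    (hΦ.nonneg _ (by positivity))).trans (hct t ht)⟩, hcε⟩
  exact measureReal_mono fun ω hω => lt_of_lt_of_le hω (h ω)

lemma wNorm_zero : wNorm Φ P (fun _ => 0) = 0 := by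
  by_contra h
  have h0 : 0 < wNorm Φ P (fun _ : Ω => 0) := pos_iff_ne_zero.2 h
  obtain ⟨r, hr0, hr⟩ := ENNReal.lt_iff_exists_nnreal_btwn.1 h0
  refine lt_irrefl (wNorm Φ P (fun _ : Ω => 0))
    (wNorm_lt_iff.2 ⟨r, ⟨by exact_mod_cast hr0, fun t _ => ?_⟩, ?_⟩)
  · simp
  · simpa using hr

lemma wNorm_mul (hΦ : MemG ℓ Φ) (k : ℝ) {u : Ω → ℝ≥0∞} {ε : ℝ≥0∞} (hu : wNorm Φ P u < ε) :
    wNorm Φ P (fun ω => ‖k‖ₑ * u ω) < ENNReal.ofReal (|k| + 1) * ε := by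
  obtain ⟨c, ⟨hc, hct⟩, hcε⟩ := wNorm_lt_iff.1 hu
  have hk : 0 < |k| + 1 := by positivity
  refine wNorm_lt_iff.2 ⟨(|k| + 1) * c, ⟨by positivity, fun t ht => ?_⟩, ?_⟩
  · have h1 := hct (t / (|k| + 1)) (by positivity)
    rw [div_div] at h1
    refine (mul_le_mul_of_nonneg_left ?_ (hΦ.nonneg _ (by positivity))).trans h1
    refine measureReal_mono fun ω hω => ?_
    simp only [mem_ofPred_eq] at hω ⊢
    by_contra hcon
    rw [not_lt] at hcon
    refine absurd hω (not_lt.2 ?_)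
    calc ‖k‖ₑ * u ω ≤ ENNReal.ofReal (|k| + 1) * ENNReal.ofReal (t / (|k| + 1)) := by
          refine mul_le_mul' ?_ hcon
          rw [Real.enorm_eq_ofReal_abs]
          exact ENNReal.ofReal_le_ofReal (by linarith)
      _ = ENNReal.ofReal t := by
          rw [← ENNReal.ofReal_mul hk.le]; congr 1; field_simp
  · rw [ENNReal.ofReal_mul hk.le]
    exact (ENNReal.mul_lt_mul_iff_right (by simpa using hk) ENNReal.ofReal_ne_top).2 hcε

lemma wNorm_add (hΦ : MemG ℓ Φ) : ∃ K : ℝ, 0 < K ∧ ∀ (P : Measure Ω) [IsProbabilityMeasure P]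
    (u v : Ω → ℝ≥0∞) (ε : ℝ≥0∞), wNorm Φ P u < ε → wNorm Φ P v < ε →
      wNorm Φ P (fun ω => u ω + v ω) < ENNReal.ofReal K * ε := by
  obtain ⟨c, hc1, hc⟩ := hΦ.type_le
  have hℓ := hΦ.ell_pos
  obtain ⟨δ, hδ0, hδ1, hδ⟩ : ∃ δ : ℝ, 0 < δ ∧ δ ≤ 1 ∧ c * δ ^ ℓ ≤ 1 / 2 := by
    refine ⟨(1 / (2 * c)) ^ (1 / ℓ), by positivity, ?_, ?_⟩
    · refine Real.rpow_le_one (by positivity) ?_ (by positivity)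
      rw [div_le_one (by positivity)]; linarith
    · rw [← Real.rpow_mul (by positivity), one_div_mul_cancel hℓ.ne', Real.rpow_one]
      apply le_of_eq; field_simp
  have key : ∀ s r : ℝ, 0 < s → s ≤ δ → 0 ≤ r → Φ (s * r) ≤ 1 / 2 * Φ r := by
    intro s r hs hsδ hr
    refine (hc s r hs.le hr).trans (mul_le_mul_of_nonneg_right ?_ (hΦ.nonneg r hr))
    have h1 : s ≤ s ^ ℓ := by
      simpa using Real.rpow_le_rpow_of_exponent_ge hs (hsδ.trans hδ1) hΦ.ell_le_one
    rw [max_eq_left h1]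
    exact (mul_le_mul_of_nonneg_left (Real.rpow_le_rpow hs.le hsδ hℓ.le) (by linarith)).trans hδ
  refine ⟨2 / δ, by positivity, fun P _ u v ε hu hv => ?_⟩
  obtain ⟨a, ⟨ha, hat⟩, haε⟩ := wNorm_lt_iff.1 hu
  obtain ⟨b, ⟨hb, hbt⟩, hbε⟩ := wNorm_lt_iff.1 hv
  have hM : 0 < max a b := lt_max_of_lt_left ha
  refine wNorm_lt_iff.2 ⟨2 / δ * max a b, ⟨by positivity, fun t ht => ?_⟩, ?_⟩
  · have hsub : P.real {ω | ENNReal.ofReal t < u ω + v ω} ≤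
        P.real {ω | ENNReal.ofReal (t / 2) < u ω} + P.real {ω | ENNReal.ofReal (t / 2) < v ω} := by
      refine (measureReal_mono fun ω hω => ?_).trans (measureReal_union_le _ _)
      simp only [mem_ofPred_eq, mem_union] at hω ⊢
      by_contra hcon
      rw [not_or, not_lt, not_lt] at hcon
      refine absurd hω (not_lt.2 ((add_le_add hcon.1 hcon.2).trans ?_))
      rw [← ENNReal.ofReal_add (by positivity) (by positivity), add_halves]
    have hpa : Φ (t / (2 / δ * max a b)) ≤ 1 / 2 * Φ (t / 2 / a) := by
      have h := key (δ * (a / max a b)) (t / 2 / a) (by positivity)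
        (mul_le_of_le_one_right hδ0.le ((div_le_one hM).2 (le_max_left a b))) (by positivity)
      have e : t / (2 / δ * max a b) = δ * (a / max a b) * (t / 2 / a) := by field_simp
      rwa [← e] at h
    have hpb : Φ (t / (2 / δ * max a b)) ≤ 1 / 2 * Φ (t / 2 / b) := by
      have h := key (δ * (b / max a b)) (t / 2 / b) (by positivity)
        (mul_le_of_le_one_right hδ0.le ((div_le_one hM).2 (le_max_right a b))) (by positivity)
      have e : t / (2 / δ * max a b) = δ * (b / max a b) * (t / 2 / b) := by field_simp
      rwa [← e] at h
    have h1 := hat (t / 2) (by positivity)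
    have h2 := hbt (t / 2) (by positivity)
    have h0 : 0 ≤ Φ (t / (2 / δ * max a b)) := hΦ.nonneg _ (by positivity)
    have h3 := mul_le_mul_of_nonneg_left hsub h0
    have h4 := mul_le_mul_of_nonneg_right hpa
      (measureReal_nonneg (μ := P) (s := {ω | ENNReal.ofReal (t / 2) < u ω}))
    have h5 := mul_le_mul_of_nonneg_right hpb
      (measureReal_nonneg (μ := P) (s := {ω | ENNReal.ofReal (t / 2) < v ω}))
    linarith
  · rw [ENNReal.ofReal_mul (by positivity)]
    refine (ENNReal.mul_lt_mul_iff_right (by simpa using hδ0) ENNReal.ofReal_ne_top).2 ?_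
    rcases max_choice a b with h | h <;> rwa [h]

lemma MemWScriptL.mono (hΦ : MemG ℓ Φ) {u v : Ω → ℝ≥0∞} (hv : MemWScriptL Φ P v)
    (h : ∀ ω, u ω ≤ v ω) : MemWScriptL Φ P u where
  wNorm_lt_top := (wNorm_mono hΦ h).trans_lt hv.wNorm_lt_top
  absCont ε hε := by
    obtain ⟨δ, hδ, H⟩ := hv.absCont ε hε
    exact ⟨δ, hδ, fun A hA hPA => (wNorm_mono hΦ fun ω =>
      indicator_le_indicator (h ω)).trans_lt (H A hA hPA)⟩

lemma MemWScriptL.zero : MemWScriptL Φ P (fun _ => 0) where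
  wNorm_lt_top := by simp [wNorm_zero]
  absCont ε hε := ⟨1, one_pos, fun A _ _ => by simpa [wNorm_zero] using hε⟩

lemma MemWScriptL.add (hΦ : MemG ℓ Φ) {u v : Ω → ℝ≥0∞} (hu : MemWScriptL Φ P u)
    (hv : MemWScriptL Φ P v) : MemWScriptL Φ P (fun ω => u ω + v ω) := by
  obtain ⟨K, hK0, hK⟩ := wNorm_add (Ω := Ω) (m := m) hΦ
  refine ⟨(hK P u v ∞ hu.wNorm_lt_top hv.wNorm_lt_top).trans_le le_top, fun ε hε => ?_⟩
  have hKne : ENNReal.ofReal K ≠ 0 := by simpa using hK0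
  have hε' : 0 < ε / ENNReal.ofReal K := ENNReal.div_pos hε.ne' ENNReal.ofReal_ne_top
  obtain ⟨δ, hδ, H⟩ := hu.absCont _ hε'
  obtain ⟨δ', hδ', H'⟩ := hv.absCont _ hε'
  refine ⟨min δ δ', lt_min hδ hδ', fun A hA hPA => ?_⟩
  have h := hK P _ _ _ (H A hA (hPA.trans_le (min_le_left _ _)))
    (H' A hA (hPA.trans_le (min_le_right _ _)))
  rw [ENNReal.mul_div_cancel hKne ENNReal.ofReal_ne_top] at h
  convert h using 2
  ext ω
  by_cases hω : ω ∈ A <;> simp [hω]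

lemma MemWScriptL.mul (hΦ : MemG ℓ Φ) (k : ℝ) {u : Ω → ℝ≥0∞} (hu : MemWScriptL Φ P u) :
    MemWScriptL Φ P (fun ω => ‖k‖ₑ * u ω) := by
  refine ⟨(wNorm_mul hΦ k hu.wNorm_lt_top).trans_le le_top, fun ε hε => ?_⟩
  have hKne : ENNReal.ofReal (|k| + 1) ≠ 0 := by
    simpa using (by positivity : 0 < |k| + 1)
  obtain ⟨δ, hδ, H⟩ := hu.absCont _ (ENNReal.div_pos hε.ne' (ENNReal.ofReal_ne_top (r := |k| + 1)))
  refine ⟨δ, hδ, fun A hA hPA => ?_⟩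
  have h := wNorm_mul hΦ k (H A hA hPA)
  rw [ENNReal.mul_div_cancel hKne ENNReal.ofReal_ne_top] at h
  convert h using 2
  ext ω
  by_cases hω : ω ∈ A <;> simp [hω]

end helpers

/-! ### Martingales -/

/-- The stochastic basis is regular: for `A ∈ ℱ_n`, `n ≥ 1`, there is `B ∈ ℱ_{n-1}` with `A ⊆ B`
and `P(B) ≤ R P(A)`, where `R` does not depend on `n` and `A`. -/
def IsRegular (P : Measure Ω) (ℱ : Filtration ℕ m) : Prop :=
  ∃ R : ℝ≥0, 0 < R ∧ ∀ (n : ℕ) (A : Set Ω), MeasurableSet[ℱ (n + 1)] A →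
    ∃ B : Set Ω, MeasurableSet[ℱ n] B ∧ A ⊆ B ∧ P B ≤ R * P A

/-- The maximal function `M(f) = sup_n |f_n|`, with values in `[0,∞]`. -/
def maximal (f : ℕ → Ω → ℝ) (ω : Ω) : ℝ≥0∞ := ⨆ n, ‖f n ω‖ₑ

/-- The space `w𝓗_Φ` (script `𝓗`) of all martingales `f = (f_n)_{n ≥ 0}` with `f_0 = 0` such that
`M(f) ∈ wℒ_Φ`. It carries the quasi-norm `‖f‖_{wH_Φ} = ‖M(f)‖_{wL_Φ}`. Martingales are not
identified when they agree almost everywhere: their difference has quasi-norm `0`. -/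
def wScriptH {ℓ : ℝ} {Φ : ℝ → ℝ} (hΦ : MemG ℓ Φ) (P : Measure Ω) [IsProbabilityMeasure P]
    (ℱ : Filtration ℕ m) : Submodule ℝ (ℕ → Ω → ℝ) where
  carrier := {f | Martingale f ℱ P ∧ f 0 =ᵐ[P] 0 ∧ MemWScriptL Φ P (maximal f)}
  zero_mem' := ⟨martingale_zero _ _ _, EventuallyEq.rfl, by
    refine MemWScriptL.zero.mono hΦ fun ω => ?_
    simp [maximal]⟩
  add_mem' := by
    rintro f g ⟨hf, hf0, hfM⟩ ⟨hg, hg0, hgM⟩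
    refine ⟨hf.add hg, by simpa using hf0.add hg0, (hfM.add hΦ hgM).mono hΦ fun ω => ?_⟩
    refine iSup_le fun n => (enorm_add_le _ _).trans (add_le_add ?_ ?_)
    · exact le_iSup (fun n => ‖f n ω‖ₑ) n
    · exact le_iSup (fun n => ‖g n ω‖ₑ) n
  smul_mem' := by
    rintro k f ⟨hf, hf0, hfM⟩
    refine ⟨hf.smul k, ?_, (hfM.mul hΦ k).mono hΦ fun ω => ?_⟩
    · filter_upwards [hf0] with ω hω
      simp [hω]
    · refine iSup_le fun n => ?_
      rw [Pi.smul_apply, Pi.smul_apply, enorm_smul]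
      gcongr
      exact le_iSup (fun n => ‖f n ω‖ₑ) n

/-- The quasi-norm `‖f‖_{wH_Φ} = ‖M(f)‖_{wL_Φ}`. -/
def hNorm (Φ : ℝ → ℝ) (P : Measure Ω) (f : ℕ → Ω → ℝ) : ℝ≥0∞ := wNorm Φ P (maximal f)

section dual

variable {ℓ : ℝ} {Φ : ℝ → ℝ} {hΦ : MemG ℓ Φ} {P : Measure Ω} [IsProbabilityMeasure P]
  {ℱ : Filtration ℕ m}

/-- The linear functional `l` on `w𝓗_Φ` is continuous, that is, bounded: `l ∈ (w𝓗_Φ)^*`. -/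
def IsBoundedFunctional (l : wScriptH hΦ P ℱ →ₗ[ℝ] ℝ) : Prop :=
  ∃ K : ℝ≥0, ∀ f : wScriptH hΦ P ℱ, ‖l f‖ₑ ≤ K * hNorm Φ P f

/-- The norm `‖l‖ = sup {|l(f)| : ‖f‖_{wH_Φ} ≤ 1}` of the dual space. -/
def dualNorm (l : wScriptH hΦ P ℱ →ₗ[ℝ] ℝ) : ℝ≥0∞ :=
  ⨆ (f : wScriptH hΦ P ℱ) (_ : hNorm Φ P f ≤ 1), ‖l f‖ₑ

/-- `l` is represented by `g ∈ L_q`: every `f ∈ L_{q'}` with `E_0 f = 0`, `1/q + 1/q' = 1`, belongs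
to `w𝓗_Φ` (as the martingale `(E_n f)_n`), and `l(f) = E(f g)`. -/
def Represents (q : ℝ) (g : Ω → ℝ) (l : wScriptH hΦ P ℱ →ₗ[ℝ] ℝ) : Prop :=
  ∀ f : Ω → ℝ, MemLp f (ENNReal.ofReal q).conjExponent P → P[f|ℱ 0] =ᵐ[P] 0 →
    ∃ h : (fun n => P[f|ℱ n]) ∈ wScriptH hΦ P ℱ, l ⟨fun n => P[f|ℱ n], h⟩ = ∫ ω, f ω * g ω ∂P

end dual

/-! ### Weak generalized Campanato spaces -/

/-- The (limit of the) martingale `(E_n g)_n` stopped at `ν`: it is `E_n g` on `{ν = n}` and `g` on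
`{ν = ∞}`. -/
def stopped (P : Measure Ω) (ℱ : Filtration ℕ m) (g : Ω → ℝ) (ν : Ω → WithTop ℕ) (ω : Ω) : ℝ :=
  match ν ω with
  | ⊤ => g ω
  | (n : ℕ) => (P[g|ℱ n]) ω

/-- `t_φ^q(x) = φ(x)⁻¹ x^{-1/q} sup {‖g - g^ν‖_q : ν a stopping time, P(ν < ∞) ≤ x}`. -/
def tFun (P : Measure Ω) (ℱ : Filtration ℕ m) (q : ℝ) (φ : ℝ → ℝ) (g : Ω → ℝ) (x : ℝ) : ℝ≥0∞ :=
  ENNReal.ofReal (1 / φ x * x ^ (-1 / q)) *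
    ⨆ (ν : Ω → WithTop ℕ) (_ : IsStoppingTime ℱ ν) (_ : P {ω | ν ω < ⊤} ≤ ENNReal.ofReal x),
      eLpNorm (fun ω => g ω - stopped P ℱ g ν ω) (ENNReal.ofReal q) P

/-- `‖g‖_{wℒ_{q,φ}} = ∫_0^∞ t_φ^q(x) / x dx`. -/
def campanatoNorm (P : Measure Ω) (ℱ : Filtration ℕ m) (q : ℝ) (φ : ℝ → ℝ) (g : Ω → ℝ) : ℝ≥0∞ :=
  ∫⁻ x in Ioi (0 : ℝ), tFun P ℱ q φ g x / ENNReal.ofReal x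

/-- `g ∈ wℒ_{q,φ}`: `g ∈ L_q` with `E_0 g = 0` and `‖g‖_{wℒ_{q,φ}} < ∞`. -/
structure MemCampanato (P : Measure Ω) (ℱ : Filtration ℕ m) (q : ℝ) (φ : ℝ → ℝ) (g : Ω → ℝ) :
    Prop where
  memLp : MemLp g (ENNReal.ofReal q) P
  condExp_zero : P[g|ℱ 0] =ᵐ[P] 0
  norm_lt_top : campanatoNorm P ℱ q φ g < ∞

end WeakOrliczHardy

end

/-!
The duality rests on the fact that both spaces are described by their interaction with bounded
functions. Let `Ψ = Φ⁻¹`. Concavity of `Φ` makes `L_1` embed into the weak Hardy space through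
Doob's weak-type inequality (`hNorm_condExp_le`), so that a continuous functional, restricted to
bounded functions `f` with `E_0 f = 0`, is the pairing with an essentially bounded function `g`
(`exists_integral_mul_eq_apply`, `ae_abs_le_of_integral_mul_le_hNorm`). Conversely, regularity of
the filtration provides stopping times that come strictly before a martingale crosses a given level
(`exists_stoppingTime_of_regular`). Stopping there turns a martingale in the weak Hardy space into a
bounded one, and the absolute continuity of its quasi-norm shows that bounded functions are dense
(`exists_bddMeanZero_hNorm_sub_lt`). Hence functionals are determined by their values on bounded
functions (`functional_ext`), and pairings that are bounded there extend
(`exists_functional_of_integral_mul_le`). What remains is to compare two sizes of `g`.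

*From the Campanato norm to the functional* (`exists_enorm_integral_mul_le_campanatoNorm`). Let `f`
be bounded, and let `ν_j` be the stopping times for the levels `λ_j = L s^j`. The identity
`E(f g) = ∑_j E(f (g^{ν_j} - g^{ν_{j+1}})) + E(f g^{ν_J})` writes the pairing as a sum of terms of
size at most `(λ_j + λ_{j+1}) ‖g - g^σ‖_1`, where `σ = ν_j ∧ ν_{j+1}`. If `‖f‖_{wH_Φ} < c`, then
`P(σ < ∞) ≤ x_j` with `x_j` a constant multiple of `1 / Φ(λ_{j+1} / c)`, so that `λ_j` is comparable
to `c Ψ(1 / x_j)` and the term to `c t_φ^1(x_j)`. The `x_j` grow at least geometrically, and the sum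
is dominated by `c ∫ t_φ^1(x) / x dx`. The exponent `1` suffices because the Campanato norms
increase with the exponent (`campanatoNorm_mono`).

*From the functional to the Campanato norm* (`exists_campanatoNorm_le`). By the same monotonicity
the exponent `q` may be taken larger than `1`, with finite conjugate `p`. For stopping times `ν_k`
with `P(ν_k < ∞) ≤ 2^{-k}` that almost realize the oscillation of `g`, let `u_k` have norm `1` in
`L_p` and be extremal for `g - g^{ν_k}`. The atoms `a_k = u_k - u_k^{ν_k}` satisfy
`E(a_k g) = ‖g - g^{ν_k}‖_q`, and every sum `∑_{k < N} c_k a_k`, where `c_k` is the factor in front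
of the oscillation in `t_φ^q(2^{-k})`, has bounded quasi-norm (`exists_hNorm_sum_atoms_le`). Testing
the functional with it bounds `∑_k t_φ^q(2^{-k})`, which controls the part `x ≤ 1` of the Campanato
norm; the part `x > 1` is controlled by the supremum of `|g|`.

For the convex function `Φ⁻¹`, a finite upper index amounts to the doubling property
`MemG.exists_inv_doubling`, which already follows from the lower type of `Φ`.
-/

namespace WeakOrliczHardy

/-! ### Concave functions of class `𝒢_ℓ` and their inverses -/

section Phi

variable {ℓ : ℝ} {Φ : ℝ → ℝ}

lemma MemG.strictMonoOn (hΦ : MemG ℓ Φ) (hc : ConcaveOn ℝ (Ici 0) Φ) :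
    StrictMonoOn Φ (Ici 0) := by
  intro a ha b hb hab
  obtain ⟨z, hzb, hz⟩ := ((eventually_gt_atTop b).and
    (hΦ.tendsto_atTop.eventually_gt_atTop (Φ a))).exists
  have haz : a < z := hab.trans hzb
  have hza : 0 < z - a := sub_pos.2 haz
  have h1 : 0 ≤ (z - b) / (z - a) := div_nonneg (by linarith) hza.le
  have h2 : 0 ≤ (b - a) / (z - a) := div_nonneg (by linarith) hza.le
  have h := hc.2 ha (mem_Ici.2 ((mem_Ici.1 hb).trans hzb.le)) h1 h2 (by field_simp; ring)
  have e : ((z - b) / (z - a)) • a + ((b - a) / (z - a)) • z = b := by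
    simp only [smul_eq_mul]; field_simp; ring
  rw [e] at h
  simp only [smul_eq_mul] at h
  have e2 : (z - b) / (z - a) * Φ a = Φ a - (b - a) / (z - a) * Φ a := by
    field_simp; ring
  have h3 : 0 < (b - a) / (z - a) := div_pos (by linarith) hza
  nlinarith

lemma MemG.mono (hΦ : MemG ℓ Φ) (hc : ConcaveOn ℝ (Ici 0) Φ) {a b : ℝ} (ha : 0 ≤ a)
    (hab : a ≤ b) : Φ a ≤ Φ b :=
  (hΦ.strictMonoOn hc).monotoneOn (mem_Ici.2 ha) (mem_Ici.2 (ha.trans hab)) hab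

lemma MemG.pos (hΦ : MemG ℓ Φ) (hc : ConcaveOn ℝ (Ici 0) Φ) {r : ℝ} (hr : 0 < r) : 0 < Φ r := by
  have := hΦ.strictMonoOn hc (mem_Ici.2 le_rfl) (mem_Ici.2 hr.le) hr
  rwa [hΦ.map_zero] at this

lemma MemG.mul_le (hΦ : MemG ℓ Φ) (hc : ConcaveOn ℝ (Ici 0) Φ) {s r : ℝ} (hs : 0 ≤ s)
    (hs1 : s ≤ 1) (hr : 0 ≤ r) : s * Φ r ≤ Φ (s * r) := by
  have h := hc.2 (mem_Ici.2 hr) (mem_Ici.2 le_rfl) hs (sub_nonneg.2 hs1) (by ring)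
  simpa [hΦ.map_zero] using h

/-- The lower type of `Φ` in the form in which it is used: dilations by a small enough factor
divide `Φ` by any prescribed amount. -/
lemma MemG.exists_dilation (hΦ : MemG ℓ Φ) {ε : ℝ} (hε : 0 < ε) :
    ∃ s : ℝ, 0 < s ∧ s ≤ 1 ∧ ∀ u, 0 ≤ u → Φ (s * u) ≤ ε * Φ u := by
  obtain ⟨c, hc1, hc⟩ := hΦ.type_le
  have hℓ := hΦ.ell_pos
  have hc0 : 0 < c := by linarith
  refine ⟨min 1 ((ε / c) ^ (1 / ℓ)), by positivity, min_le_left _ _, fun u hu => ?_⟩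
  set s := min 1 ((ε / c) ^ (1 / ℓ)) with hs
  have hs0 : 0 < s := by positivity
  refine (hc s u hs0.le hu).trans (mul_le_mul_of_nonneg_right ?_ (hΦ.nonneg u hu))
  have h1 : s ≤ s ^ ℓ := by
    simpa using Real.rpow_le_rpow_of_exponent_ge hs0 (min_le_left _ _) hΦ.ell_le_one
  rw [max_eq_left h1]
  have h2 : s ^ ℓ ≤ ε / c := by
    calc s ^ ℓ ≤ ((ε / c) ^ (1 / ℓ)) ^ ℓ := Real.rpow_le_rpow hs0.le (min_le_right _ _) hℓ.le
      _ = ε / c := by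
        rw [← Real.rpow_mul (by positivity), one_div_mul_cancel hℓ.ne', Real.rpow_one]
  calc c * s ^ ℓ ≤ c * (ε / c) := by gcongr
    _ = ε := by field_simp

lemma MemG.exists_eq (hΦ : MemG ℓ Φ) (hc : ConcaveOn ℝ (Ici 0) Φ) {y : ℝ} (hy : 0 ≤ y) :
    ∃ x, 0 ≤ x ∧ Φ x = y := by
  rcases hy.eq_or_lt with rfl | hy
  · exact ⟨0, le_rfl, hΦ.map_zero⟩
  have h1 : 0 < Φ 1 := hΦ.pos hc one_pos
  obtain ⟨s, hs0, -, hs⟩ := hΦ.exists_dilation (ε := y / Φ 1) (by positivity)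
  have hsy : Φ s ≤ y := by
    have := hs 1 zero_le_one
    rw [mul_one] at this
    refine this.trans_eq ?_
    field_simp
  obtain ⟨z, hzs, hz⟩ := ((eventually_ge_atTop s).and
    (hΦ.tendsto_atTop.eventually_ge_atTop y)).exists
  have hcont : ContinuousOn Φ (Icc s z) := by
    have := ConcaveOn.continuousOn_interior hc
    rw [interior_Ici] at this
    exact this.mono fun x hx => mem_Ioi.2 (hs0.trans_le hx.1)
  obtain ⟨x, hx, hxy⟩ := intermediate_value_Icc hzs hcont ⟨hsy, hz⟩
  exact ⟨x, hs0.le.trans hx.1, hxy⟩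

lemma MemG.inv_nonneg (hΦ : MemG ℓ Φ) (hc : ConcaveOn ℝ (Ici 0) Φ) {y : ℝ} (hy : 0 ≤ y) :
    0 ≤ inv Φ y := by
  obtain ⟨x, hx, hxy⟩ := hΦ.exists_eq hc hy
  exact Function.invFunOn_mem (s := Ici 0) ⟨x, hx, hxy⟩

lemma MemG.map_inv (hΦ : MemG ℓ Φ) (hc : ConcaveOn ℝ (Ici 0) Φ) {y : ℝ} (hy : 0 ≤ y) :
    Φ (inv Φ y) = y := by
  obtain ⟨x, hx, hxy⟩ := hΦ.exists_eq hc hy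
  exact Function.invFunOn_eq (s := Ici 0) ⟨x, hx, hxy⟩

lemma MemG.le_inv_iff (hΦ : MemG ℓ Φ) (hc : ConcaveOn ℝ (Ici 0) Φ) {u y : ℝ} (hu : 0 ≤ u)
    (hy : 0 ≤ y) : u ≤ inv Φ y ↔ Φ u ≤ y := by
  conv_rhs => rw [← hΦ.map_inv hc hy]
  exact ((hΦ.strictMonoOn hc).le_iff_le (mem_Ici.2 hu) (mem_Ici.2 (hΦ.inv_nonneg hc hy))).symm

lemma MemG.inv_le_iff (hΦ : MemG ℓ Φ) (hc : ConcaveOn ℝ (Ici 0) Φ) {u y : ℝ} (hu : 0 ≤ u)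
    (hy : 0 ≤ y) : inv Φ y ≤ u ↔ y ≤ Φ u := by
  conv_rhs => rw [← hΦ.map_inv hc hy]
  exact ((hΦ.strictMonoOn hc).le_iff_le (mem_Ici.2 (hΦ.inv_nonneg hc hy)) (mem_Ici.2 hu)).symm

lemma MemG.inv_mono (hΦ : MemG ℓ Φ) (hc : ConcaveOn ℝ (Ici 0) Φ) {x y : ℝ} (hx : 0 ≤ x)
    (hxy : x ≤ y) : inv Φ x ≤ inv Φ y := by
  rw [hΦ.le_inv_iff hc (hΦ.inv_nonneg hc hx) (hx.trans hxy), hΦ.map_inv hc hx]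
  exact hxy

lemma MemG.inv_pos (hΦ : MemG ℓ Φ) (hc : ConcaveOn ℝ (Ici 0) Φ) {y : ℝ} (hy : 0 < y) :
    0 < inv Φ y := by
  refine lt_of_le_of_ne (hΦ.inv_nonneg hc hy.le) fun h => ?_
  have := hΦ.map_inv hc hy.le
  rw [← h, hΦ.map_zero] at this
  exact hy.ne this

/-- Convexity of `Φ⁻¹`, together with `Φ⁻¹(0) = 0`. -/
lemma MemG.inv_mul_le (hΦ : MemG ℓ Φ) (hc : ConcaveOn ℝ (Ici 0) Φ) {s y : ℝ} (hs : 0 ≤ s)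
    (hs1 : s ≤ 1) (hy : 0 ≤ y) : inv Φ (s * y) ≤ s * inv Φ y := by
  have h0 := hΦ.inv_nonneg hc hy
  rw [hΦ.inv_le_iff hc (by positivity) (by positivity)]
  refine le_trans ?_ (hΦ.mul_le hc hs hs1 h0)
  rw [hΦ.map_inv hc hy]

/-- `Φ⁻¹` satisfies the doubling condition `Φ⁻¹(2y) ≤ D Φ⁻¹(y)`. -/
lemma MemG.exists_inv_doubling (hΦ : MemG ℓ Φ) (hc : ConcaveOn ℝ (Ici 0) Φ) :
    ∃ D : ℝ, 1 ≤ D ∧ ∀ y, 0 ≤ y → inv Φ (2 * y) ≤ D * inv Φ y := by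
  obtain ⟨s, hs0, hs1, hs⟩ := hΦ.exists_dilation (ε := 1 / 2) (by norm_num)
  refine ⟨1 / s, by rw [le_div_iff₀ hs0]; linarith, fun y hy => ?_⟩
  have h0 := hΦ.inv_nonneg hc (y := 2 * y) (by positivity)
  have h := hs _ h0
  rw [hΦ.map_inv hc (by positivity)] at h
  have := (hΦ.le_inv_iff hc (u := s * inv Φ (2 * y)) (by positivity) hy).2 (by linarith)
  rw [one_div, ← div_eq_inv_mul, le_div_iff₀ hs0]
  linarith

/-- Concave functions with `Φ 0 = 0` grow at most linearly: above `Φ⁻¹(1)`, the function `Φ` lies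
below the chord through the origin. -/
lemma MemG.le_div_inv (hΦ : MemG ℓ Φ) (hc : ConcaveOn ℝ (Ici 0) Φ) {t : ℝ}
    (ht : inv Φ 1 ≤ t) : Φ t ≤ t / inv Φ 1 := by
  have h0 := hΦ.inv_pos hc one_pos
  have ht0 : 0 < t := h0.trans_le ht
  have h := hΦ.mul_le hc (s := inv Φ 1 / t) (by positivity) ((div_le_one ht0).2 ht) ht0.le
  rw [div_mul_cancel₀ _ ht0.ne', hΦ.map_inv hc zero_le_one] at h
  rw [le_div_iff₀ h0]
  rw [div_mul_eq_mul_div, div_le_one ht0] at h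
  linarith

end Phi

/-! ### The weak Orlicz quasi-norm -/

section WeakNorm

variable {Ω : Type*} {m : MeasurableSpace Ω} {P : Measure Ω}
  {ℓ : ℝ} {Φ : ℝ → ℝ} {u v : Ω → ℝ≥0∞}

lemma wNorm_le_of_bound {c : ℝ} (hc : 0 < c)
    (h : ∀ t : ℝ, 0 < t → Φ (t / c) * P.real {ω | ENNReal.ofReal t < u ω} ≤ 1) :
    wNorm Φ P u ≤ ENNReal.ofReal c :=
  iInf₂_le c ⟨hc, h⟩

lemma wNorm_mono_ae [IsFiniteMeasure P] (hΦ : MemG ℓ Φ) (h : ∀ᵐ ω ∂P, u ω ≤ v ω) :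
    wNorm Φ P u ≤ wNorm Φ P v := by
  refine le_of_forall_gt fun ε hε => ?_
  obtain ⟨c, ⟨hc, hct⟩, hcε⟩ := wNorm_lt_iff.1 hε
  refine wNorm_lt_iff.2 ⟨c, ⟨hc, fun t ht => (mul_le_mul_of_nonneg_left ?_
    (hΦ.nonneg _ (by positivity))).trans (hct t ht)⟩, hcε⟩
  refine ENNReal.toReal_mono (measure_ne_top _ _) (measure_mono_ae ?_)
  filter_upwards [h] with ω hω h' using lt_of_lt_of_le h' hω

lemma wNorm_congr_ae [IsFiniteMeasure P] (hΦ : MemG ℓ Φ) (h : ∀ᵐ ω ∂P, u ω = v ω) :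
    wNorm Φ P u = wNorm Φ P v :=
  le_antisymm (wNorm_mono_ae hΦ (h.mono fun _ h => h.le))
    (wNorm_mono_ae hΦ (h.mono fun _ h => h.ge))

lemma wNorm_const_mul_le (k : ℝ) (hk : 0 < k) :
    wNorm Φ P (fun ω => ENNReal.ofReal k * u ω) ≤ ENNReal.ofReal k * wNorm Φ P u := by
  have hk' : ENNReal.ofReal k ≠ 0 := by simpa using hk
  rw [← ENNReal.div_le_iff' hk' ENNReal.ofReal_ne_top]
  refine le_of_forall_gt fun ε hε => ?_
  obtain ⟨c, ⟨hc, hct⟩, hcε⟩ := wNorm_lt_iff.1 hε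
  refine lt_of_le_of_lt ?_ hcε
  rw [ENNReal.div_le_iff' hk' ENNReal.ofReal_ne_top, ← ENNReal.ofReal_mul hk.le]
  refine wNorm_le_of_bound (by positivity) fun t ht => ?_
  have h1 := hct (t / k) (by positivity)
  rw [div_div] at h1
  convert h1 using 3
  ext ω
  simp only [mem_ofPred_eq]
  rw [ENNReal.ofReal_div_of_pos hk, ENNReal.div_lt_iff (Or.inl hk') (Or.inl ENNReal.ofReal_ne_top),
    mul_comm]

/-- The quasi-triangle inequality of the weak Orlicz norm, with a constant that depends only
on `Φ`. -/
lemma exists_wNorm_add [IsProbabilityMeasure P] (hΦ : MemG ℓ Φ) :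
    ∃ K : ℝ≥0, 1 ≤ K ∧ ∀ u v : Ω → ℝ≥0∞,
      wNorm Φ P (fun ω => u ω + v ω) ≤ K * max (wNorm Φ P u) (wNorm Φ P v) := by
  obtain ⟨K, hK0, hK⟩ := wNorm_add (Ω := Ω) (m := m) hΦ
  refine ⟨max 1 K.toNNReal, le_max_left _ _, fun u v => ?_⟩
  refine le_trans ?_ (mul_le_mul_left (ENNReal.coe_le_coe.2 (le_max_right 1 K.toNNReal)) _)
  have hK' : (K.toNNReal : ℝ≥0∞) ≠ 0 := by simpa using hK0
  rw [← ENNReal.div_le_iff' hK' ENNReal.coe_ne_top]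
  refine le_of_forall_gt_imp_ge_of_dense fun ε hε => ?_
  exact ENNReal.div_le_of_le_mul'
    (hK P u v ε ((le_max_left _ _).trans_lt hε) ((le_max_right _ _).trans_lt hε)).le

end WeakNorm

/-! ### Stopped martingales -/

section Stopped

variable {Ω : Type*} {m : MeasurableSpace Ω} {P : Measure Ω}
  {ℱ : Filtration ℕ m} {ν : Ω → WithTop ℕ}

lemma stopped_of_eq_top {g : Ω → ℝ} {ω : Ω} (h : ν ω = ⊤) : stopped P ℱ g ν ω = g ω := by
  simp only [stopped, h]

lemma stopped_of_eq_coe {g : Ω → ℝ} {ω : Ω} {n : ℕ} (h : ν ω = WithTop.some n) :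
    stopped P ℱ g ν ω = (P[g|ℱ n]) ω := by
  simp only [stopped, h]

lemma measurableSet_lt_top (hν : IsStoppingTime ℱ ν) :
    MeasurableSet {ω | ν ω < ⊤} := by
  have : {ω | ν ω < ⊤} = {ω | ν ω = ⊤}ᶜ := by ext ω; simp [lt_top_iff_ne_top]
  rw [this]
  exact hν.measurableSet_eq_top.compl

/-- Regularity produces a stopping time that comes strictly before the first passage of `h` above
the level `M`, at the cost of the factor `R` in the probability that it is finite: the first passage
at time `n + 1` is announced at time `n` by a set of comparable size. -/
lemma exists_stoppingTime_of_regular {R : ℝ≥0}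
    (hR : ∀ (n : ℕ) (A : Set Ω), MeasurableSet[ℱ (n + 1)] A →
      ∃ B : Set Ω, MeasurableSet[ℱ n] B ∧ A ⊆ B ∧ P B ≤ R * P A)
    {h : ℕ → Ω → ℝ} (hadp : StronglyAdapted ℱ h) (h0 : h 0 =ᵐ[P] 0) {M : ℝ} (hM : 0 ≤ M) :
    ∃ ν : Ω → WithTop ℕ, IsStoppingTime ℱ ν ∧
      P {ω | ν ω < ⊤} ≤ R * P {ω | ENNReal.ofReal M < maximal h ω} ∧
      ∀ᵐ ω ∂P, ∀ n : ℕ, WithTop.some n ≤ ν ω → |h n ω| ≤ M := by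
  classical
  -- `A n` is the event that `h` exceeds the level `M` for the first time at time `n + 1`
  set A : ℕ → Set Ω := fun n => {ω | M < |h (n + 1) ω|} ∩ ⋂ i ∈ Finset.range (n + 1),
    {ω | |h i ω| ≤ M} with hA
  have hmeas : ∀ i n, i ≤ n → Measurable[ℱ n] fun ω => |h i ω| := fun i n hin =>
    (((hadp i).mono (ℱ.mono hin)).norm).measurable
  have hAm : ∀ n, MeasurableSet[ℱ (n + 1)] (A n) := fun n => by
    refine MeasurableSet.inter ?_ (Finset.measurableSet_biInter _ fun i hi => ?_)
    · exact hmeas (n + 1) (n + 1) le_rfl measurableSet_Ioi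
    · exact hmeas i (n + 1) (by have := Finset.mem_range.1 hi; omega) measurableSet_Iic
  have hAm' : ∀ n, MeasurableSet (A n) := fun n => ℱ.le _ _ (hAm n)
  choose B hBm hAB hPB using fun n => hR n (A n) (hAm n)
  set ν : Ω → WithTop ℕ := fun ω =>
    if hω : ∃ n, ω ∈ B n then WithTop.some (Nat.find hω) else ⊤ with hν
  have hle : ∀ ω (i : ℕ), ν ω ≤ WithTop.some i ↔ ∃ n ≤ i, ω ∈ B n := fun ω i => by
    simp only [hν]
    split_ifs with hω
    · rw [WithTop.coe_le_coe, Nat.find_le_iff]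
    · simp only [top_le_iff, WithTop.coe_ne_top, false_iff, not_exists, not_and]
      exact fun n _ hn => hω ⟨n, hn⟩
  have hfin : {ω | ν ω < ⊤} = ⋃ n, B n := by
    ext ω
    simp only [hν, mem_ofPred_eq, mem_iUnion]
    split_ifs with hω
    · simpa using hω
    · simpa using hω
  refine ⟨ν, fun i => ?_, ?_, ?_⟩
  · have : {ω | ν ω ≤ WithTop.some i} = ⋃ n ∈ Finset.range (i + 1), B n := by
      ext ω
      simp only [mem_ofPred_eq, hle, mem_iUnion, Finset.mem_range, Order.lt_add_one_iff,
        exists_prop]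
    rw [this]
    exact Finset.measurableSet_biUnion _ fun n hn =>
      ℱ.mono (by have := Finset.mem_range.1 hn; omega) _ (hBm n)
  · have hdisj : Pairwise (Function.onFun Disjoint A) := by
      have key : ∀ i j, i < j → Disjoint (A i) (A j) := fun i j hij => by
        refine disjoint_left.2 fun ω hi hj => ?_
        have h1 : M < |h (i + 1) ω| := hi.1
        have h2 : |h (i + 1) ω| ≤ M :=
          mem_iInter₂.1 hj.2 (i + 1) (Finset.mem_range.2 (by omega))
        linarith
      intro i j hij
      rcases lt_or_gt_of_ne hij with h | h
      · exact key i j h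
      · exact (key j i h).symm
    calc P {ω | ν ω < ⊤} ≤ ∑' n, P (B n) := by rw [hfin]; exact measure_iUnion_le _
      _ ≤ ∑' n, R * P (A n) := ENNReal.tsum_le_tsum hPB
      _ = R * P (⋃ n, A n) := by rw [ENNReal.tsum_mul_left, measure_iUnion hdisj hAm']
      _ ≤ R * P {ω | ENNReal.ofReal M < maximal h ω} := by
        gcongr
        refine iUnion_subset fun n ω hω => ?_
        refine lt_of_lt_of_le ?_ (le_iSup (fun n => ‖h n ω‖ₑ) (n + 1))
        rw [Real.enorm_eq_ofReal_abs]
        exact (ENNReal.ofReal_lt_ofReal_iff (hM.trans_lt hω.1)).2 hω.1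
  -- the first passage is not at time `0`, and if it is at time `k + 1`, then `ν ≤ k`
  · filter_upwards [h0] with ω h0 n hn
    by_contra hcon
    have hex : ∃ n, M < |h n ω| := ⟨n, not_le.1 hcon⟩
    have hk := Nat.find_spec hex
    have hkn : Nat.find hex ≤ n := Nat.find_min' hex (not_le.1 hcon)
    rcases hk0 : Nat.find hex with _ | k
    · rw [hk0, h0] at hk
      simp only [Pi.zero_apply, abs_zero] at hk
      exact absurd hk (not_lt.2 hM)
    · have hωA : ω ∈ A k := by
        refine ⟨by rw [hk0] at hk; exact hk, mem_iInter₂.2 fun i hi => ?_⟩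
        have := Finset.mem_range.1 hi
        exact not_lt.1 (Nat.find_min hex (m := i) (by omega))
      have h2 : ν ω ≤ WithTop.some k := (hle ω k).2 ⟨k, le_rfl, hAB k hωA⟩
      have h3 : n ≤ k := WithTop.coe_le_coe.1 (hn.trans h2)
      omega

variable [IsProbabilityMeasure P]

/-- Stopping at `ν` is conditioning on the `σ`-algebra of the events prior to `ν`. -/
lemma stopped_ae_eq_condExp (hgen : ⨆ n, (ℱ n : MeasurableSpace Ω) = m)
    (hν : IsStoppingTime ℱ ν) {g : Ω → ℝ} (hg : Integrable g P) :
    stopped P ℱ g ν =ᵐ[P] P[g|hν.measurableSpace] := by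
  have htop : MeasurableSet[hν.measurableSpace] {ω | ν ω = ⊤} :=
    (measurableSet_singleton _).preimage hν.measurable
  have h1 : ∀ n : ℕ, ∀ᵐ ω ∂P, ν ω = WithTop.some n →
      (P[g|hν.measurableSpace]) ω = (P[g|ℱ n]) ω := fun n =>
    (ae_restrict_iff' (ℱ.le n _ (hν.measurableSet_eq n))).1
      (condExp_stopping_time_ae_eq_restrict_eq hν n)
  have h2 : ∀ᵐ ω ∂P, ν ω = ⊤ → (P[g|hν.measurableSpace]) ω = (P[g|m]) ω := by
    refine (ae_restrict_iff' (hν.measurableSpace_le _ htop)).1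
      (condExp_ae_eq_restrict_of_measurableSpace_eq_on hν.measurableSpace_le le_rfl htop ?_)
    refine fun t => ⟨fun h => hν.measurableSpace_le _ h, fun h => ⟨by rwa [hgen], fun i => ?_⟩⟩
    convert @MeasurableSet.empty _ (ℱ i) using 1
    ext ω
    simp only [mem_inter_iff, mem_ofPred_eq, mem_empty_iff_false, iff_false, not_and]
    rintro ⟨h, -⟩
    simp [h]
  have h3 : P[g|m] =ᵐ[P] g :=
    condExp_of_aestronglyMeasurable' le_rfl hg.aestronglyMeasurable hg
  filter_upwards [ae_all_iff.2 h1, h2, h3] with ω h1 h2 h3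
  rcases h : ν ω with _ | n
  · rw [stopped_of_eq_top h, h2 h, h3]
  · rw [stopped_of_eq_coe h, h1 n h]

lemma integrable_stopped (hgen : ⨆ n, (ℱ n : MeasurableSpace Ω) = m)
    (hν : IsStoppingTime ℱ ν) {g : Ω → ℝ} (hg : Integrable g P) :
    Integrable (stopped P ℱ g ν) P :=
  integrable_condExp.congr (stopped_ae_eq_condExp hgen hν hg).symm

lemma eLpNorm_stopped_le (hgen : ⨆ n, (ℱ n : MeasurableSpace Ω) = m)
    (hν : IsStoppingTime ℱ ν) {g : Ω → ℝ} (hg : Integrable g P) {p : ℝ≥0∞} (hp : 1 ≤ p) :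
    eLpNorm (stopped P ℱ g ν) p P ≤ eLpNorm g p P := by
  rw [eLpNorm_congr_ae (stopped_ae_eq_condExp hgen hν hg)]
  exact eLpNorm_condExp_le_eLpNorm g hp

/-- Conditional expectations are self-adjoint. -/
lemma integral_condExp_mul_comm {m' : MeasurableSpace Ω} (hm : m' ≤ m) {f h : Ω → ℝ} {L : ℝ}
    (hf : AEStronglyMeasurable[m] f P) (hL : ∀ᵐ ω ∂P, |f ω| ≤ L) (hh : Integrable h P) :
    ∫ ω, (P[f|m']) ω * h ω ∂P = ∫ ω, f ω * (P[h|m']) ω ∂P := by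
  have hfi : Integrable f P := Integrable.of_bound hf L hL
  have hb : ∀ᵐ ω ∂P, |(P[f|m']) ω| ≤ L := ae_bdd_abs_condExp_of_ae_bdd_abs hL
  have i1 : Integrable ((P[f|m']) * h) P :=
    hh.bdd_mul (c := L) integrable_condExp.aestronglyMeasurable hb
  have i2 : Integrable (f * (P[h|m'])) P := integrable_condExp.bdd_mul (c := L) hf hL
  have e1 : P[(P[f|m']) * h|m'] =ᵐ[P] (P[f|m']) * (P[h|m']) :=
    condExp_mul_of_stronglyMeasurable_left stronglyMeasurable_condExp i1 hh
  have e2 : P[f * (P[h|m'])|m'] =ᵐ[P] (P[f|m']) * (P[h|m']) :=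
    condExp_mul_of_stronglyMeasurable_right stronglyMeasurable_condExp i2 hfi
  calc ∫ ω, (P[f|m']) ω * h ω ∂P = ∫ ω, (P[(P[f|m']) * h|m']) ω ∂P := (integral_condExp hm).symm
    _ = ∫ ω, (P[f * (P[h|m'])|m']) ω ∂P := integral_congr_ae (e1.trans e2.symm)
    _ = ∫ ω, f ω * (P[h|m']) ω ∂P := integral_condExp hm

lemma integral_stopped_mul_comm (hgen : ⨆ n, (ℱ n : MeasurableSpace Ω) = m)
    (hν : IsStoppingTime ℱ ν) {f h : Ω → ℝ} {L : ℝ}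
    (hf : AEStronglyMeasurable f P) (hL : ∀ᵐ ω ∂P, |f ω| ≤ L) (hh : Integrable h P) :
    ∫ ω, stopped P ℱ f ν ω * h ω ∂P = ∫ ω, f ω * stopped P ℱ h ν ω ∂P := by
  have e1 : ∫ ω, stopped P ℱ f ν ω * h ω ∂P = ∫ ω, (P[f|hν.measurableSpace]) ω * h ω ∂P :=
    integral_congr_ae ((stopped_ae_eq_condExp hgen hν (Integrable.of_bound hf L hL)).mul
      (ae_eq_refl h))
  have e2 : ∫ ω, f ω * stopped P ℱ h ν ω ∂P = ∫ ω, f ω * (P[h|hν.measurableSpace]) ω ∂P :=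
    integral_congr_ae ((ae_eq_refl f).mul (stopped_ae_eq_condExp hgen hν hh))
  rw [e1, e2]
  exact integral_condExp_mul_comm hν.measurableSpace_le hf hL hh

lemma stopped_stopped (hgen : ⨆ n, (ℱ n : MeasurableSpace Ω) = m) {σ : Ω → WithTop ℕ}
    (hν : IsStoppingTime ℱ ν) (hσ : IsStoppingTime ℱ σ) (hle : σ ≤ ν) {g : Ω → ℝ}
    (hg : Integrable g P) : stopped P ℱ (stopped P ℱ g σ) ν =ᵐ[P] stopped P ℱ g σ := by
  have e := stopped_ae_eq_condExp hgen hσ hg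
  refine (stopped_ae_eq_condExp hgen hν (integrable_stopped hgen hσ hg)).trans ?_
  refine (condExp_congr_ae e).trans (EventuallyEq.trans ?_ e.symm)
  rw [condExp_of_stronglyMeasurable hν.measurableSpace_le
    (stronglyMeasurable_condExp.mono (hσ.measurableSpace_mono hν hle)) integrable_condExp]

lemma stopped_sub (hgen : ⨆ n, (ℱ n : MeasurableSpace Ω) = m)
    (hν : IsStoppingTime ℱ ν) {f g : Ω → ℝ} (hf : Integrable f P) (hg : Integrable g P) :
    stopped P ℱ (fun ω => f ω - g ω) ν =ᵐ[P] fun ω => stopped P ℱ f ν ω - stopped P ℱ g ν ω := by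
  refine (stopped_ae_eq_condExp hgen hν (hf.sub hg)).trans ((condExp_sub hf hg _).trans ?_)
  exact ((stopped_ae_eq_condExp hgen hν hf).sub (stopped_ae_eq_condExp hgen hν hg)).symm

lemma condExp_zero_stopped (hgen : ⨆ n, (ℱ n : MeasurableSpace Ω) = m)
    (hν : IsStoppingTime ℱ ν) {g : Ω → ℝ} (hg : Integrable g P) :
    P[stopped P ℱ g ν|ℱ 0] =ᵐ[P] P[g|ℱ 0] :=
  (condExp_congr_ae (stopped_ae_eq_condExp hgen hν hg)).trans
    (condExp_condExp_of_le (hν.le_measurableSpace_of_const_le fun _ => bot_le)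
      hν.measurableSpace_le)

lemma tendsto_condExp (hgen : ⨆ n, (ℱ n : MeasurableSpace Ω) = m) {g : Ω → ℝ}
    (hg : Integrable g P) :
    ∀ᵐ ω ∂P, Tendsto (fun n => (P[g|ℱ n]) ω) atTop (nhds (g ω)) := by
  have h3 : P[g|m] =ᵐ[P] g :=
    condExp_of_aestronglyMeasurable' le_rfl hg.aestronglyMeasurable hg
  have h := MeasureTheory.tendsto_ae_condExp (μ := P) (ℱ := ℱ) g
  rw [hgen] at h
  filter_upwards [h, h3] with ω h h3
  rwa [← h3]

/-- If `|E_n f| ≤ M` as long as `n ≤ ν`, then the stopped martingale `f^ν` is bounded by `M`. -/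
lemma abs_stopped_le (hgen : ⨆ n, (ℱ n : MeasurableSpace Ω) = m) {f : Ω → ℝ}
    (hf : Integrable f P) {M : ℝ}
    (h : ∀ᵐ ω ∂P, ∀ n : ℕ, WithTop.some n ≤ ν ω → |(P[f|ℱ n]) ω| ≤ M) :
    ∀ᵐ ω ∂P, |stopped P ℱ f ν ω| ≤ M := by
  filter_upwards [h, tendsto_condExp hgen hf] with ω h ht
  rcases hν : ν ω with _ | n
  · rw [stopped_of_eq_top hν]
    exact le_of_tendsto' ht.abs fun n => h n (hν ▸ le_top)
  · rw [stopped_of_eq_coe hν]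
    exact h n hν.ge

end Stopped

/-! ### Maximal functions and the quasi-norm of `w𝓗_Φ` -/

section Maximal

variable {Ω : Type*} {m : MeasurableSpace Ω} {P : Measure Ω} {ℱ : Filtration ℕ m} {ℓ : ℝ}
  {Φ : ℝ → ℝ}

lemma maximal_congr {f g : ℕ → Ω → ℝ} (h : ∀ n, f n =ᵐ[P] g n) :
    ∀ᵐ ω ∂P, maximal f ω = maximal g ω := by
  filter_upwards [ae_all_iff.2 h] with ω h
  simp only [maximal, h]

lemma maximal_add_le (f g : ℕ → Ω → ℝ) (ω : Ω) :
    maximal (f + g) ω ≤ maximal f ω + maximal g ω :=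
  iSup_le fun n => (enorm_add_le _ _).trans (add_le_add (le_iSup (fun n => ‖f n ω‖ₑ) n)
    (le_iSup (fun n => ‖g n ω‖ₑ) n))

lemma maximal_smul (k : ℝ) (f : ℕ → Ω → ℝ) (ω : Ω) :
    maximal (k • f) ω = ENNReal.ofReal |k| * maximal f ω := by
  simp only [maximal, Pi.smul_apply, smul_eq_mul, enorm_mul, Real.enorm_eq_ofReal_abs k,
    ENNReal.mul_iSup]

/-- The weak-type `(p,p)` case of Doob's maximal inequality, `p ≥ 1`. -/
lemma measure_maximal_condExp_le [IsProbabilityMeasure P] {f : Ω → ℝ} {p : ℝ} (hp : 1 ≤ p)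
    {t : ℝ} (ht : 0 < t) :
    P {ω | ENNReal.ofReal t < maximal (fun n => P[f|ℱ n]) ω} ≤
      (eLpNorm f (ENNReal.ofReal p) P / ENNReal.ofReal t) ^ p := by
  have hp0 : 0 < p := by linarith
  have hp1 : 1 ≤ ENNReal.ofReal p := by simpa using hp
  set F : ℕ → Ω → ℝ := fun n => P[f|ℱ n] with hF
  set G : ℕ → Ω → ℝ := F ⊔ -F with hG
  have hM : Martingale F ℱ P := martingale_condExp f ℱ P
  have hGsub : Submartingale G ℱ P := hM.submartingale.sup hM.neg.submartingale
  have hGabs : ∀ n ω, G n ω = |F n ω| := fun n ω => rfl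
  have hG0 : 0 ≤ G := fun n ω => abs_nonneg (F n ω)
  set E : ℕ → Set Ω := fun N =>
    {ω | (t.toNNReal : ℝ) ≤ (Finset.range (N + 1)).sup' Finset.nonempty_range_add_one
      fun k => G k ω} with hE
  have ht' : (t.toNNReal : ℝ) = t := Real.coe_toNNReal t ht.le
  have hmem : ∀ N ω, ω ∈ E N ↔ ∃ k ≤ N, t ≤ |F k ω| := fun N ω => by
    simp only [hE, mem_ofPred_eq, Finset.le_sup'_iff, Finset.mem_range, Order.lt_add_one_iff, ht',
      hGabs]
  have hmono : Monotone E := fun i j hij ω hω => by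
    obtain ⟨k, hk, h⟩ := (hmem i ω).1 hω
    exact (hmem j ω).2 ⟨k, hk.trans hij, h⟩
  have hsub : {ω | ENNReal.ofReal t < maximal F ω} ⊆ ⋃ N, E N := fun ω hω => by
    have hω' : ENNReal.ofReal t < ⨆ n, ‖F n ω‖ₑ := hω
    obtain ⟨k, hk⟩ := lt_iSup_iff.1 hω'
    refine mem_iUnion.2 ⟨k, (hmem k ω).2 ⟨k, le_rfl, ?_⟩⟩
    rw [Real.enorm_eq_ofReal_abs] at hk
    exact (ENNReal.ofReal_le_ofReal_iff (abs_nonneg _)).1 hk.le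
  refine (measure_mono hsub).trans ?_
  rw [hmono.measure_iUnion]
  refine iSup_le fun N => ?_
  set a := P (E N) with ha
  have ha_top : a ≠ ∞ := measure_ne_top _ _
  have h1 : ENNReal.ofReal t * a ≤
      eLpNorm f (ENNReal.ofReal p) P * a ^ (1 - 1 / p) := by
    have h := maximal_ineq hGsub hG0 (ε := t.toNNReal) N
    calc ENNReal.ofReal t * a ≤ ENNReal.ofReal (∫ ω in E N, G N ω ∂P) := h
      _ = eLpNorm (F N) 1 (P.restrict (E N)) := by
        rw [eLpNorm_one_eq_lintegral_enorm, ofReal_integral_eq_lintegral_ofReal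
          (hGsub.integrable N).integrableOn (Eventually.of_forall (hG0 N))]
        simp only [hGabs, Real.enorm_eq_ofReal_abs]
      _ ≤ eLpNorm (F N) (ENNReal.ofReal p) (P.restrict (E N)) *
          (P.restrict (E N)) univ ^ (1 / (1 : ℝ≥0∞).toReal - 1 / (ENNReal.ofReal p).toReal) :=
        eLpNorm_le_eLpNorm_mul_rpow_measure_univ hp1
          (hM.integrable N).aestronglyMeasurable.restrict
      _ ≤ eLpNorm f (ENNReal.ofReal p) P * a ^ (1 - 1 / p) := by
        rw [Measure.restrict_apply_univ, ENNReal.toReal_one, ENNReal.toReal_ofReal hp0.le,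
          div_one]
        gcongr
        exact (eLpNorm_mono_measure _ Measure.restrict_le_self).trans
          (eLpNorm_condExp_le_eLpNorm f hp1)
  rcases eq_or_ne a 0 with h0 | h0
  · rw [h0]; exact zero_le
  have h2 : ENNReal.ofReal t * a ^ (1 / p) ≤ eLpNorm f (ENNReal.ofReal p) P := by
    have e : a = a ^ (1 / p) * a ^ (1 - 1 / p) := by
      rw [← ENNReal.rpow_add _ _ h0 ha_top, add_sub_cancel, ENNReal.rpow_one]
    have hb0 : a ^ (1 - 1 / p) ≠ 0 := (ENNReal.rpow_pos (pos_iff_ne_zero.2 h0) ha_top).ne'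
    have hb1 : a ^ (1 - 1 / p) ≠ ∞ := ENNReal.rpow_ne_top_of_ne_zero h0 ha_top
    refine (ENNReal.mul_le_mul_iff_left hb0 hb1).1 ?_
    rwa [mul_assoc, ← e]
  have ht0 : ENNReal.ofReal t ≠ 0 := by simpa using ht
  calc a = (a ^ (1 / p)) ^ p := by
        rw [← ENNReal.rpow_mul, one_div_mul_cancel hp0.ne', ENNReal.rpow_one]
    _ ≤ (eLpNorm f (ENNReal.ofReal p) P / ENNReal.ofReal t) ^ p := by
        gcongr
        rwa [ENNReal.le_div_iff_mul_le (Or.inl ht0) (Or.inl ENNReal.ofReal_ne_top), mul_comm]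

lemma hNorm_congr [IsProbabilityMeasure P] (hΦ : MemG ℓ Φ) {f g : ℕ → Ω → ℝ}
    (h : ∀ n, f n =ᵐ[P] g n) : hNorm Φ P f = hNorm Φ P g :=
  wNorm_congr_ae hΦ (maximal_congr h)

variable [IsProbabilityMeasure P]

lemma hNorm_zero : hNorm Φ P (0 : ℕ → Ω → ℝ) = 0 := by
  have : maximal (0 : ℕ → Ω → ℝ) = fun _ => 0 := by
    ext ω; simp [maximal]
  rw [hNorm, this, wNorm_zero]

lemma hNorm_smul_le (k : ℝ) (f : ℕ → Ω → ℝ) :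
    hNorm Φ P (k • f) ≤ ENNReal.ofReal |k| * hNorm Φ P f := by
  rcases eq_or_ne k 0 with rfl | hk
  · simp [hNorm_zero]
  · have h := wNorm_const_mul_le (Φ := Φ) (P := P) (u := maximal f) |k| (abs_pos.2 hk)
    rwa [← funext (maximal_smul k f)] at h

lemma exists_hNorm_add (hΦ : MemG ℓ Φ) : ∃ K : ℝ≥0, 1 ≤ K ∧
    ∀ f g : ℕ → Ω → ℝ, hNorm Φ P (f + g) ≤ K * max (hNorm Φ P f) (hNorm Φ P g) := by
  obtain ⟨K, hK1, hK⟩ := exists_wNorm_add (P := P) hΦ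
  exact ⟨K, hK1, fun f g =>
    (wNorm_mono hΦ (maximal_add_le f g)).trans (hK (maximal f) (maximal g))⟩

/-- The space `L_1` embeds into the weak Hardy space, by the weak-type `(1,1)` maximal inequality
and the concavity of `Φ`. -/
lemma hNorm_condExp_le (hΦ : MemG ℓ Φ) (hc : ConcaveOn ℝ (Ici 0) Φ) {f : Ω → ℝ}
    (hf : Integrable f P) :
    hNorm Φ P (fun n => P[f|ℱ n]) ≤ ENNReal.ofReal (1 / inv Φ 1) * eLpNorm f 1 P := by
  have hψ := hΦ.inv_pos hc one_pos
  set N := (eLpNorm f 1 P).toReal with hN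
  have hfin : eLpNorm f 1 P ≠ ∞ := (memLp_one_iff_integrable.2 hf).eLpNorm_ne_top
  have hN' : eLpNorm f 1 P = ENNReal.ofReal N := (ENNReal.ofReal_toReal hfin).symm
  have hN0 : 0 ≤ N := ENNReal.toReal_nonneg
  rw [hN', ← ENNReal.ofReal_mul (by positivity)]
  refine ENNReal.le_of_forall_pos_le_add fun δ hδ _ => ?_
  have hδ' : (0 : ℝ) < δ := hδ
  rw [← ENNReal.ofReal_coe_nnreal (p := δ), ← ENNReal.ofReal_add (by positivity) hδ'.le]
  set c : ℝ := 1 / inv Φ 1 * N + δ with hcdef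
  have hc0 : 0 < c := by positivity
  refine wNorm_le_of_bound hc0 fun t ht => ?_
  rcases le_total (t / c) (inv Φ 1) with h | h
  · calc _ ≤ Φ (inv Φ 1) * 1 := mul_le_mul (hΦ.mono hc (by positivity) h) measureReal_le_one
          measureReal_nonneg (hΦ.nonneg _ hψ.le)
      _ = 1 := by rw [hΦ.map_inv hc zero_le_one, mul_one]
  · have h1 := hΦ.le_div_inv hc h
    have h2 : P.real {ω | ENNReal.ofReal t < maximal (fun n => P[f|ℱ n]) ω} ≤ N / t := by
      refine ENNReal.toReal_le_of_le_ofReal (by positivity) ?_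
      have := measure_maximal_condExp_le (P := P) (ℱ := ℱ) (f := f) le_rfl ht
      rwa [ENNReal.ofReal_one, ENNReal.rpow_one, hN', ← ENNReal.ofReal_div_of_pos ht] at this
    calc _ ≤ t / c / inv Φ 1 * (N / t) := mul_le_mul h1 h2 measureReal_nonneg (by positivity)
      _ = (1 / inv Φ 1 * N) / c := by field_simp
      _ ≤ 1 := by rw [div_le_one hc0]; linarith

end Maximal

/-! ### Bounded functions with vanishing initial expectation -/

section Bounded

variable {Ω : Type*} {m : MeasurableSpace Ω}

/-- Essentially bounded functions `f` with `E_0 f = 0`. They form the dense class on which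
functionals on the weak Hardy space are compared. -/
structure BddMeanZero (P : Measure Ω) (ℱ : Filtration ℕ m) (f : Ω → ℝ) : Prop where
  aesm : AEStronglyMeasurable f P
  bdd : ∃ L : ℝ, ∀ᵐ ω ∂P, |f ω| ≤ L
  condExp_zero : P[f|ℱ 0] =ᵐ[P] 0

variable {P : Measure Ω} {ℱ : Filtration ℕ m} {ℓ : ℝ} {Φ : ℝ → ℝ} {f g : Ω → ℝ}

lemma BddMeanZero.smul (k : ℝ) (hf : BddMeanZero P ℱ f) : BddMeanZero P ℱ (k • f) := by
  obtain ⟨L, hL⟩ := hf.bdd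
  refine ⟨hf.aesm.const_smul k, ⟨|k| * L, ?_⟩, ?_⟩
  · filter_upwards [hL] with ω h
    rw [Pi.smul_apply, smul_eq_mul, abs_mul]
    gcongr
  · refine (condExp_smul k f _).trans ?_
    filter_upwards [hf.condExp_zero] with ω h
    simp [h]

lemma BddMeanZero.zero : BddMeanZero P ℱ (0 : Ω → ℝ) :=
  ⟨aestronglyMeasurable_const, ⟨0, by simp⟩, by simp⟩

lemma maximal_condExp_le {L : ℝ} (hL : ∀ᵐ ω ∂P, |f ω| ≤ L) :
    ∀ᵐ ω ∂P, maximal (fun n => P[f|ℱ n]) ω ≤ ENNReal.ofReal L := by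
  have : ∀ n, ∀ᵐ ω ∂P, |(P[f|ℱ n]) ω| ≤ L := fun n => ae_bdd_abs_condExp_of_ae_bdd_abs hL
  filter_upwards [ae_all_iff.2 this] with ω h
  refine iSup_le fun n => ?_
  rw [Real.enorm_eq_ofReal_abs]
  exact ENNReal.ofReal_le_ofReal (h n)

variable [IsProbabilityMeasure P]

lemma BddMeanZero.integrable (hf : BddMeanZero P ℱ f) : Integrable f P :=
  let ⟨L, hL⟩ := hf.bdd
  Integrable.of_bound hf.aesm L hL

lemma BddMeanZero.memLp (hf : BddMeanZero P ℱ f) (p : ℝ≥0∞) : MemLp f p P :=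
  let ⟨L, hL⟩ := hf.bdd
  MemLp.of_bound hf.aesm L hL

lemma BddMeanZero.add (hf : BddMeanZero P ℱ f) (hg : BddMeanZero P ℱ g) :
    BddMeanZero P ℱ (f + g) := by
  obtain ⟨L, hL⟩ := hf.bdd
  obtain ⟨L', hL'⟩ := hg.bdd
  refine ⟨hf.aesm.add hg.aesm, ⟨L + L', ?_⟩, ?_⟩
  · filter_upwards [hL, hL'] with ω h h' using (abs_add_le _ _).trans (add_le_add h h')
  · refine (condExp_add hf.integrable hg.integrable _).trans ?_
    simpa using hf.condExp_zero.add hg.condExp_zero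

lemma BddMeanZero.sum {ι : Type*} (s : Finset ι) {F : ι → Ω → ℝ}
    (h : ∀ i ∈ s, BddMeanZero P ℱ (F i)) : BddMeanZero P ℱ (∑ i ∈ s, F i) :=
  Finset.sum_induction _ _ (fun _ _ => BddMeanZero.add) BddMeanZero.zero h

/-- Centering a bounded function. -/
lemma bddMeanZero_sub_condExp {L : ℝ} (hf : AEStronglyMeasurable f P)
    (hL : ∀ᵐ ω ∂P, |f ω| ≤ L) : BddMeanZero P ℱ (f - P[f|ℱ 0]) := by
  have hfi : Integrable f P := Integrable.of_bound hf L hL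
  refine ⟨hf.sub integrable_condExp.aestronglyMeasurable, ⟨L + L, ?_⟩, ?_⟩
  · filter_upwards [hL, ae_bdd_abs_condExp_of_ae_bdd_abs (m := ℱ 0) hL] with ω h h'
    exact (abs_sub _ _).trans (add_le_add h h')
  · refine (condExp_sub hfi integrable_condExp _).trans ?_
    rw [condExp_of_stronglyMeasurable (ℱ.le 0) stronglyMeasurable_condExp integrable_condExp,
      sub_self]

lemma exists_bddMeanZero_approx (hf : Integrable f P) (h0 : P[f|ℱ 0] =ᵐ[P] 0) {ε : ℝ≥0∞}
    (hε : ε ≠ 0) : ∃ d, BddMeanZero P ℱ d ∧ eLpNorm (f - d) 1 P < ε := by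
  obtain ⟨u, L, hum, hL, hu⟩ : ∃ (u : Ω → ℝ) (L : ℝ), AEStronglyMeasurable u P ∧
      (∀ ω, |u ω| ≤ L) ∧ eLpNorm (f - u) 1 P < ε / 2 := by
    obtain ⟨s, hs, -⟩ := (memLp_one_iff_integrable.2 hf).exists_simpleFunc_eLpNorm_sub_lt
      ENNReal.one_ne_top (ENNReal.half_pos hε).ne'
    obtain ⟨L, hL⟩ := s.exists_forall_norm_le
    exact ⟨s, L, s.stronglyMeasurable.aestronglyMeasurable, hL, hs⟩
  have hui : Integrable u P := Integrable.of_bound hum L (Eventually.of_forall hL)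
  refine ⟨u - P[u|ℱ 0], bddMeanZero_sub_condExp hum (Eventually.of_forall hL), ?_⟩
  have e : f - (u - P[u|ℱ 0]) =ᵐ[P] (f - u) - P[f - u|ℱ 0] := by
    filter_upwards [condExp_sub hf hui (ℱ 0), h0] with ω h h0
    simp only [Pi.sub_apply, h, h0, Pi.zero_apply]
    ring
  rw [eLpNorm_congr_ae e]
  refine (eLpNorm_sub_le (hf.sub hui).aestronglyMeasurable
    integrable_condExp.aestronglyMeasurable le_rfl).trans_lt ?_
  calc _ ≤ eLpNorm (f - u) 1 P + eLpNorm (f - u) 1 P := by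
        gcongr; exact eLpNorm_condExp_le_eLpNorm _ le_rfl
    _ < ε / 2 + ε / 2 := ENNReal.add_lt_add hu hu
    _ = ε := ENNReal.add_halves ε

/-- Integrable functions with `E_0 f = 0` generate elements of the weak Hardy space. The absolute
continuity of the quasi-norm follows by approximation with bounded functions. -/
lemma condExp_mem_wScriptH (hΦ : MemG ℓ Φ) (hc : ConcaveOn ℝ (Ici 0) Φ) (hf : Integrable f P)
    (h0 : P[f|ℱ 0] =ᵐ[P] 0) : (fun n => P[f|ℱ n]) ∈ wScriptH hΦ P ℱ := by
  refine ⟨martingale_condExp f ℱ P, h0, ?_, fun ε hε => ?_⟩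
  · exact (hNorm_condExp_le hΦ hc hf).trans_lt (ENNReal.mul_lt_top ENNReal.ofReal_lt_top
      (memLp_one_iff_integrable.2 hf).eLpNorm_lt_top)
  have hψ := hΦ.inv_pos hc one_pos
  obtain ⟨K, hK1, hK⟩ := exists_wNorm_add (P := P) hΦ
  have hK0 : (K : ℝ≥0∞) ≠ 0 := by
    simpa using (zero_lt_one.trans_le hK1).ne'
  obtain ⟨c, hc0, hcε⟩ := ENNReal.lt_iff_exists_nnreal_btwn.1
    (ENNReal.div_pos hε.ne' (ENNReal.coe_ne_top (r := K)))
  have hc0' : (0 : ℝ) < c := by exact_mod_cast hc0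
  obtain ⟨d, hd, hfd⟩ := exists_bddMeanZero_approx hf h0
    (ε := c / ENNReal.ofReal (1 / inv Φ 1)) (ENNReal.div_pos hc0.ne' ENNReal.ofReal_ne_top).ne'
  obtain ⟨L, hL⟩ := hd.bdd
  set L' : ℝ := max L 1
  have hL'0 : 0 < L' := lt_max_of_lt_right one_pos
  have hL' := maximal_condExp_le (ℱ := ℱ) (hL.mono fun ω h => h.trans (le_max_left L 1))
  have hΦL : 0 < Φ (L' / c) := hΦ.pos hc (by positivity)
  refine ⟨ENNReal.ofReal (1 / Φ (L' / c)), by simpa using hΦL, fun A hA hPA => ?_⟩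
  have hbound : wNorm Φ P (A.indicator fun _ => ENNReal.ofReal L') ≤ c := by
    rw [← ENNReal.ofReal_coe_nnreal]
    refine wNorm_le_of_bound hc0' fun t ht => ?_
    rcases lt_or_ge t L' with h | h
    · have h1 : P.real {ω | ENNReal.ofReal t < A.indicator (fun _ => ENNReal.ofReal L') ω} ≤
          1 / Φ (L' / c) := by
        refine ENNReal.toReal_le_of_le_ofReal (by positivity) (le_trans (measure_mono ?_) hPA.le)
        intro ω hω
        by_contra hωA
        simp [hωA] at hω
      calc _ ≤ Φ (L' / c) * (1 / Φ (L' / c)) := mul_le_mul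
              (hΦ.mono hc (by positivity) (by gcongr)) h1 measureReal_nonneg hΦL.le
        _ = 1 := by field_simp
    · have : {ω | ENNReal.ofReal t < A.indicator (fun _ => ENNReal.ofReal L') ω} = ∅ := by
        refine eq_empty_of_forall_notMem fun ω hω => ?_
        have hω' : ENNReal.ofReal t < A.indicator (fun _ => ENNReal.ofReal L') ω := hω
        refine absurd hω' (not_lt.2 ?_)
        refine (indicator_le_self _ _ ω).trans (ENNReal.ofReal_le_ofReal h)
      rw [this]; simp
  have hrest : hNorm Φ P (fun n => P[f - d|ℱ n]) ≤ c := by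
    refine (hNorm_condExp_le hΦ hc (hf.sub hd.integrable)).trans ?_
    refine (mul_le_mul_right hfd.le _).trans ENNReal.mul_div_le
  have hle : ∀ᵐ ω ∂P, A.indicator (maximal fun n => P[f|ℱ n]) ω ≤
      A.indicator (fun _ => ENNReal.ofReal L') ω + maximal (fun n => P[f - d|ℱ n]) ω := by
    have h1 : ∀ n, P[f|ℱ n] =ᵐ[P] (P[d|ℱ n] + P[f - d|ℱ n]) := fun n => by
      filter_upwards [condExp_sub hf hd.integrable (ℱ n)] with ω h
      simp [h]
    filter_upwards [maximal_congr h1, hL'] with ω h2 h3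
    by_cases hω : ω ∈ A
    · rw [indicator_of_mem hω, indicator_of_mem hω, h2]
      exact (maximal_add_le (fun n => P[d|ℱ n]) (fun n => P[f - d|ℱ n]) ω).trans (by gcongr)
    · rw [indicator_of_notMem hω]; exact zero_le
  calc _ ≤ K * max (wNorm Φ P (A.indicator fun _ => ENNReal.ofReal L'))
        (hNorm Φ P (fun n => P[f - d|ℱ n])) := (wNorm_mono_ae hΦ hle).trans (hK _ _)
    _ ≤ K * c := by gcongr; exact max_le hbound hrest
    _ < ε := by
      rw [mul_comm]
      exact ENNReal.mul_lt_of_lt_div hcε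

end Bounded

/-! ### Density of bounded functions and extension of functionals -/

section Extension

lemma eq_of_forall_enorm_sub_le {x y : ℝ} {C : ℝ≥0}
    (h : ∀ ε : ℝ≥0, 0 < ε → ‖x - y‖ₑ ≤ C * ε) : x = y := by
  have h1 : ‖x - y‖ₑ ≤ 0 := by
    refine ENNReal.le_of_forall_pos_le_add fun δ hδ _ => ?_
    refine (h (δ / (C + 1)) (by positivity)).trans ?_
    rw [zero_add, ← ENNReal.coe_mul, ENNReal.coe_le_coe, mul_div_assoc',
      div_le_iff₀ (by positivity), mul_comm]
    gcongr
    exact le_self_add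
  exact sub_eq_zero.1 (enorm_eq_zero.1 (le_antisymm h1 zero_le))

/-- A bounded linear functional on a dense subspace of a quasi-normed space extends to the whole
space. The functional is given by its graph `G`. -/
lemma exists_linearMap_of_dense_graph {V : Type*} [AddCommGroup V] [Module ℝ V] {N : V → ℝ≥0∞}
    {K C : ℝ≥0} (hadd : ∀ x y, N (x + y) ≤ K * max (N x) (N y))
    (hsmul : ∀ (k : ℝ) x, N (k • x) ≤ ENNReal.ofReal |k| * N x) (G : Submodule ℝ (V × ℝ))
    (hG : ∀ p ∈ G, ‖p.2‖ₑ ≤ C * N p.1)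
    (hdense : ∀ v, ∀ ε : ℝ≥0, 0 < ε → ∃ p ∈ G, N (v - p.1) ≤ ε) :
    ∃ l : V →ₗ[ℝ] ℝ, (∀ p ∈ G, l p.1 = p.2) ∧ ∀ v, ‖l v‖ₑ ≤ C * K * N v := by
  have hneg : ∀ x, N (-x) ≤ N x := fun x => by simpa using hsmul (-1) x
  have hN0 : N 0 = 0 := le_antisymm (by simpa using hsmul 0 0) zero_le
  have hdiff : ∀ p ∈ G, ∀ p' ∈ G, ∀ v,
      ‖p.2 - p'.2‖ₑ ≤ C * (K * max (N (v - p.1)) (N (v - p'.1))) := fun p hp p' hp' v => by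
    refine (hG (p - p') (G.sub_mem hp hp')).trans ?_
    gcongr
    have e : (p - p').1 = -(v - p.1) + (v - p'.1) := by simp
    rw [e]
    exact (hadd _ _).trans (by gcongr; exact hneg _)
  -- the value at `v` is the limit of the values at points of the subspace that tend to `v`
  have key : ∀ v, ∃ r : ℝ, ∀ p ∈ G, ‖r - p.2‖ₑ ≤ C * K * N (v - p.1) := fun v => by
    choose p hpG hp using fun k : ℕ => hdense v (1 / (k + 1)) (by positivity)
    have hto : Tendsto (fun k : ℕ => ((1 / (k + 1) : ℝ≥0) : ℝ≥0∞)) atTop (nhds 0) := by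
      rw [← ENNReal.coe_zero, ENNReal.tendsto_coe]
      exact tendsto_one_div_add_atTop_nhds_zero_nat
    have hcauchy : CauchySeq fun k => (p k).2 := by
      refine cauchySeq_of_le_tendsto_0 (fun k : ℕ => ((C * (K * (1 / (k + 1))) : ℝ≥0) : ℝ))
        (fun i j k hi hj => ?_) ?_
      · rw [Real.dist_eq, ← Real.norm_eq_abs, ← coe_nnnorm, NNReal.coe_le_coe,
          ← ENNReal.coe_le_coe]
        refine (hdiff _ (hpG i) _ (hpG j) v).trans ?_
        push_cast
        gcongr
        refine max_le ((hp i).trans ?_) ((hp j).trans ?_)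
        · norm_cast
          gcongr
        · norm_cast
          gcongr
      · have : Tendsto (fun k : ℕ => (C * (K * (1 / (k + 1))) : ℝ≥0)) atTop
            (nhds (C * (K * 0))) :=
          (tendsto_one_div_add_atTop_nhds_zero_nat.const_mul K).const_mul C
        have h2 := NNReal.tendsto_coe.2 this
        simpa using h2
    obtain ⟨r, hr⟩ := cauchySeq_tendsto_of_complete hcauchy
    refine ⟨r, fun p' hp' => ?_⟩
    have h1 : Tendsto (fun k => ‖(p k).2 - p'.2‖ₑ) atTop (nhds ‖r - p'.2‖ₑ) :=
      (hr.sub_const _).enorm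
    have h2 : Tendsto (fun k : ℕ => (C : ℝ≥0∞) * (K *
        max ((1 / (k + 1) : ℝ≥0) : ℝ≥0∞) (N (v - p'.1)))) atTop
        (nhds (C * (K * max 0 (N (v - p'.1))))) :=
      ENNReal.Tendsto.const_mul (ENNReal.Tendsto.const_mul (hto.max tendsto_const_nhds)
        (Or.inr ENNReal.coe_ne_top)) (Or.inr ENNReal.coe_ne_top)
    rw [max_eq_right zero_le, ← mul_assoc] at h2
    refine le_of_tendsto_of_tendsto' h1 h2 fun k => (hdiff _ (hpG k) _ hp' v).trans ?_
    gcongr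
    exact hp k
  choose r hr using key
  refine ⟨⟨⟨r, fun v w => ?_⟩, fun k v => ?_⟩, fun p hp => ?_, fun v => ?_⟩
  · refine eq_of_forall_enorm_sub_le (C := C * K * K + C * K + C * K) fun ε hε => ?_
    obtain ⟨p, hpG, hp⟩ := hdense v ε hε
    obtain ⟨p', hpG', hp'⟩ := hdense w ε hε
    have e : r (v + w) - (r v + r w) =
      (r (v + w) - (p + p').2) - (r v - p.2) - (r w - p'.2) := by simp; ring
    have h1 : ‖r (v + w) - (p + p').2‖ₑ ≤ C * K * (K * ε) := by
      refine (hr _ _ (G.add_mem hpG hpG')).trans ?_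
      gcongr
      have e' : v + w - (p + p').1 = (v - p.1) + (w - p'.1) := by simp; abel
      rw [e']
      exact (hadd _ _).trans (by gcongr; exact max_le hp hp')
    have h2 : ‖r v - p.2‖ₑ ≤ C * K * ε := (hr _ _ hpG).trans (by gcongr)
    have h3 : ‖r w - p'.2‖ₑ ≤ C * K * ε := (hr _ _ hpG').trans (by gcongr)
    rw [e]
    refine (enorm_sub_le.trans (add_le_add (enorm_sub_le.trans (add_le_add h1 h2)) h3)).trans
      (le_of_eq ?_)
    push_cast
    ring
  · refine eq_of_forall_enorm_sub_le (C := 2 * (C * K * ‖k‖₊)) fun ε hε => ?_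
    obtain ⟨p, hpG, hp⟩ := hdense v ε hε
    have e : r (k • v) - (RingHom.id ℝ) k • r v =
      (r (k • v) - (k • p).2) - k * (r v - p.2) := by simp; ring
    have h1 : ‖r (k • v) - (k • p).2‖ₑ ≤ C * K * (‖k‖₊ * ε) := by
      refine (hr _ _ (G.smul_mem k hpG)).trans ?_
      gcongr
      have e' : k • v - (k • p).1 = k • (v - p.1) := by simp [smul_sub]
      rw [e']
      refine (hsmul _ _).trans ?_
      rw [← Real.enorm_eq_ofReal_abs, enorm_eq_nnnorm]
      gcongr
    have h2 : ‖k * (r v - p.2)‖ₑ ≤ ‖k‖₊ * (C * K * ε) := by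
      rw [enorm_mul, enorm_eq_nnnorm k]
      gcongr
      exact (hr _ _ hpG).trans (by gcongr)
    change ‖r (k • v) - (RingHom.id ℝ) k • r v‖ₑ ≤ _
    rw [e]
    refine (enorm_sub_le.trans (add_le_add h1 h2)).trans (le_of_eq ?_)
    push_cast
    ring
  · refine eq_of_forall_enorm_sub_le (C := 0) fun ε _ => ?_
    refine (hr p.1 p hp).trans ?_
    simp [hN0]
  · have := hr v 0 G.zero_mem
    simpa using this

end Extension

section Density

variable {Ω : Type*} {m : MeasurableSpace Ω} {P : Measure Ω} [IsProbabilityMeasure P]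
  {ℱ : Filtration ℕ m} {ℓ : ℝ} {Φ : ℝ → ℝ}

lemma exists_measure_lt (hΦ : MemG ℓ Φ) {u : Ω → ℝ≥0∞} (hu : wNorm Φ P u < ∞)
    {δ : ℝ≥0∞} (hδ : 0 < δ) : ∃ M : ℝ, 0 < M ∧ P {ω | ENNReal.ofReal M < u ω} < δ := by
  obtain ⟨c, ⟨hc, hct⟩, -⟩ := wNorm_lt_iff.1 hu
  obtain ⟨δ', hδ'0, hδ'⟩ := ENNReal.lt_iff_exists_nnreal_btwn.1 hδ
  have hδ0 : (0 : ℝ) < δ' := by exact_mod_cast hδ'0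
  have htend := hΦ.tendsto_atTop.comp (tendsto_id.atTop_div_const hc)
  obtain ⟨M, hM, hM0⟩ := ((htend.eventually_gt_atTop (1 / (δ' : ℝ))).and
    (eventually_gt_atTop 0)).exists
  refine ⟨M, hM0, lt_of_le_of_lt ?_ hδ'⟩
  have h := hct M hM0
  have hpos : 0 < Φ (M / c) := lt_trans (by positivity) hM
  have h2 : P.real {ω | ENNReal.ofReal M < u ω} ≤ δ' := by
    have hM' : 1 / (δ' : ℝ) < Φ (M / c) := hM
    rw [div_lt_iff₀ hδ0] at hM'
    by_contra hcon
    rw [not_le] at hcon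
    have := mul_lt_mul_of_pos_left hcon hpos
    linarith
  rw [← ENNReal.ofReal_coe_nnreal, ← ofReal_measureReal]
  exact ENNReal.ofReal_le_ofReal h2

/-- The values of a stopped process are values of the process at times up to `ν`. -/
lemma exists_stoppedProcess_eq (h : ℕ → Ω → ℝ) (ν : Ω → WithTop ℕ) (n : ℕ) (ω : Ω) :
    ∃ k : ℕ, WithTop.some k ≤ ν ω ∧ stoppedProcess h ν n ω = h k ω ∧ (ν ω = ⊤ → k = n) := by
  rcases hν : ν ω with _ | j
  · exact ⟨n, le_top, stoppedProcess_eq_of_le (by rw [hν]; exact le_top), fun _ => rfl⟩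
  · rcases le_total n j with h1 | h1
    · exact ⟨n, WithTop.coe_le_coe.2 h1,
        stoppedProcess_eq_of_le (by rw [hν]; exact WithTop.coe_le_coe.2 h1), fun _ => rfl⟩
    · refine ⟨j, le_rfl, ?_, fun h => absurd h WithTop.coe_ne_top⟩
      rw [stoppedProcess_eq_of_ge (by rw [hν]; exact WithTop.coe_le_coe.2 h1), hν]
      rfl

lemma martingale_stoppedProcess {h : ℕ → Ω → ℝ} (hh : Martingale h ℱ P) {ν : Ω → WithTop ℕ}
    (hν : IsStoppingTime ℱ ν) : Martingale (stoppedProcess h ν) ℱ P := by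
  refine martingale_iff.2 ⟨?_, hh.submartingale.stoppedProcess hν⟩
  have := (hh.neg.submartingale.stoppedProcess hν).neg
  convert this using 1
  ext n ω
  simp [stoppedProcess]

/-- A martingale in the weak Hardy space, stopped before it exceeds a high level, is generated by a
bounded function, and it is close to the original martingale by the absolute continuity of the
quasi-norm. -/
lemma exists_bddMeanZero_hNorm_sub_lt (hgen : ⨆ n, (ℱ n : MeasurableSpace Ω) = m)
    (hreg : IsRegular P ℱ) (hΦ : MemG ℓ Φ) {h : ℕ → Ω → ℝ} (hh : h ∈ wScriptH hΦ P ℱ)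
    {ε : ℝ≥0} (hε : 0 < ε) :
    ∃ d, BddMeanZero P ℱ d ∧ hNorm Φ P (h - fun n => P[d|ℱ n]) ≤ ε := by
  obtain ⟨R, hR0, hR⟩ := hreg
  obtain ⟨hM, h0, hmem⟩ := hh
  obtain ⟨δ, hδ, hA⟩ := hmem.absCont (ε / 2 : ℝ≥0) (by simpa using hε.ne')
  obtain ⟨M, hM0, hPM⟩ := exists_measure_lt hΦ hmem.wNorm_lt_top
    (ENNReal.div_pos hδ.ne' (ENNReal.coe_ne_top (r := R)))
  obtain ⟨ν, hν, hPν, hle⟩ := exists_stoppingTime_of_regular hR hM.stronglyAdapted h0 hM0.le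
  set S := stoppedProcess h ν with hS
  have hSM : Martingale S ℱ P := martingale_stoppedProcess hM hν
  have hSb : ∀ᵐ ω ∂P, ∀ n, |S n ω| ≤ M := by
    filter_upwards [hle] with ω hω n
    obtain ⟨k, hk, hk', -⟩ := exists_stoppedProcess_eq h ν n ω
    rw [hS, hk']
    exact hω k hk
  have hUI : UniformIntegrable S 1 P := by
    refine uniformIntegrable_of le_rfl ENNReal.one_ne_top
      (fun n => (hSM.integrable n).aestronglyMeasurable) fun η hη => ⟨M.toNNReal + 1, fun n => ?_⟩
    have : {ω | M.toNNReal + 1 ≤ ‖S n ω‖₊}.indicator (S n) =ᵐ[P] 0 := by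
      filter_upwards [hSb] with ω hω
      refine indicator_of_notMem (fun hmem => ?_) _
      have h1 : M.toNNReal + 1 ≤ ‖S n ω‖₊ := hmem
      have h2 : (M.toNNReal : ℝ) + 1 ≤ |S n ω| := by exact_mod_cast h1
      have := Real.le_coe_toNNReal M
      have := hω n
      linarith
    rw [eLpNorm_congr_ae this]
    simp
  obtain ⟨d, hSd, hdi⟩ : ∃ d, (∀ n, S n =ᵐ[P] P[d|ℱ n]) ∧ Integrable d P := by
    obtain ⟨C, hC⟩ := hUI.2.2
    exact ⟨_, hSM.ae_eq_condExp_limitProcess hUI,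
      memLp_one_iff_integrable.1 (Filtration.memLp_limitProcess_of_eLpNorm_bdd hUI.1 hC)⟩
  refine ⟨d, ⟨hdi.aestronglyMeasurable, ⟨M, ?_⟩, ?_⟩, ?_⟩
  · filter_upwards [tendsto_condExp hgen hdi, hSb, ae_all_iff.2 hSd] with ω ht hb he
    refine le_of_tendsto' ht.abs fun n => ?_
    rw [← he n]
    exact hb n
  · refine (hSd 0).symm.trans (EventuallyEq.trans ?_ h0)
    refine Eventually.of_forall fun ω => ?_
    exact stoppedProcess_eq_of_le (u := h) (τ := ν) (i := 0) (ω := ω) bot_le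
  have hPset : P {ω | ν ω < ⊤} < δ := by
    refine hPν.trans_lt ?_
    rw [mul_comm]
    exact ENNReal.mul_lt_of_lt_div hPM
  -- the difference of the two martingales vanishes on `{ν = ∞}`
  have hbound : ∀ᵐ ω ∂P, maximal (h - fun n => P[d|ℱ n]) ω ≤
      ENNReal.ofReal 2 * {ω | ν ω < ⊤}.indicator (maximal h) ω := by
    filter_upwards [ae_all_iff.2 hSd] with ω he
    refine iSup_le fun n => ?_
    obtain ⟨k, hk, hk', htop⟩ := exists_stoppedProcess_eq h ν n ω
    have e : (h - fun n => P[d|ℱ n]) n ω = h n ω - h k ω := by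
      rw [← hk', Pi.sub_apply, Pi.sub_apply, ← he n]
    rw [e]
    by_cases hω : ν ω = ⊤
    · rw [htop hω, sub_self, enorm_zero]; exact zero_le
    · have hω' : ω ∈ {ω | ν ω < ⊤} := lt_top_iff_ne_top.2 hω
      rw [indicator_of_mem hω']
      calc ‖h n ω - h k ω‖ₑ ≤ ‖h n ω‖ₑ + ‖h k ω‖ₑ := enorm_sub_le
        _ ≤ maximal h ω + maximal h ω := add_le_add (le_iSup (fun n => ‖h n ω‖ₑ) n)
          (le_iSup (fun n => ‖h n ω‖ₑ) k)
        _ = ENNReal.ofReal 2 * maximal h ω := by rw [← two_mul]; simp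
  calc _ ≤ ENNReal.ofReal 2 * wNorm Φ P ({ω | ν ω < ⊤}.indicator (maximal h)) :=
        (wNorm_mono_ae hΦ hbound).trans (wNorm_const_mul_le 2 two_pos)
    _ ≤ ENNReal.ofReal 2 * (ε / 2 : ℝ≥0) := by
      gcongr
      exact (hA _ (measurableSet_lt_top hν) hPset).le
    _ = ε := by
      rw [← ENNReal.ofReal_coe_nnreal, ← ENNReal.ofReal_mul (by norm_num),
        ← ENNReal.ofReal_coe_nnreal]
      congr 1
      push_cast
      ring

end Density

/-! ### Continuous functionals and bounded representing functions -/

section Functionals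

variable {Ω : Type*} {m : MeasurableSpace Ω} {P : Measure Ω} {ℱ : Filtration ℕ m}

lemma sub_condExp_ae_eq {f g : Ω → ℝ} (hf : Integrable f P) (hg : Integrable g P) (n : ℕ) :
    ((fun n => P[f|ℱ n]) - fun n => P[g|ℱ n]) n =ᵐ[P] P[f - g|ℱ n] :=
  (condExp_sub hf hg _).symm

lemma BddMeanZero.integrable_mul {d g : Ω → ℝ} (hd : BddMeanZero P ℱ d) (hg : Integrable g P) :
    Integrable (fun ω => d ω * g ω) P := by
  obtain ⟨L, hL⟩ := hd.bdd
  exact hg.bdd_mul (c := L) hd.aesm hL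

variable [IsProbabilityMeasure P] {ℓ : ℝ} {Φ : ℝ → ℝ} {hΦ : MemG ℓ Φ}
  {l : wScriptH hΦ P ℱ →ₗ[ℝ] ℝ}

lemma dualNorm_lt_top (hl : IsBoundedFunctional l) : dualNorm l < ∞ := by
  obtain ⟨K, hK⟩ := hl
  refine lt_of_le_of_lt (iSup₂_le fun f hf => ?_) (ENNReal.coe_lt_top (r := K))
  exact (hK f).trans (mul_le_of_le_one_right zero_le hf)

lemma enorm_apply_le (hl : IsBoundedFunctional l) (f : wScriptH hΦ P ℱ) :
    ‖l f‖ₑ ≤ dualNorm l * hNorm Φ P f := by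
  have hfin : hNorm Φ P f ≠ ∞ := f.2.2.2.wNorm_lt_top.ne
  rcases eq_or_ne (hNorm Φ P f) 0 with h0 | h0
  · obtain ⟨K, hK⟩ := hl
    simpa [h0] using hK f
  set N := (hNorm Φ P f).toReal with hN
  have hN0 : 0 < N := ENNReal.toReal_pos h0 hfin
  have hN' : hNorm Φ P f = ENNReal.ofReal N := (ENNReal.ofReal_toReal hfin).symm
  have h1 : hNorm Φ P ((N⁻¹ • f : wScriptH hΦ P ℱ) : ℕ → Ω → ℝ) ≤ 1 := by
    refine (hNorm_smul_le N⁻¹ (f : ℕ → Ω → ℝ)).trans (le_of_eq ?_)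
    rw [abs_of_pos (inv_pos.2 hN0), hN', ← ENNReal.ofReal_mul (inv_pos.2 hN0).le,
      inv_mul_cancel₀ hN0.ne', ENNReal.ofReal_one]
  have h2 : ‖l (N⁻¹ • f)‖ₑ ≤ dualNorm l :=
    le_iSup₂ (f := fun (f : wScriptH hΦ P ℱ) (_ : hNorm Φ P f ≤ 1) => ‖l f‖ₑ) (N⁻¹ • f) h1
  have e : l f = N * l (N⁻¹ • f) := by
    rw [map_smul, smul_eq_mul, mul_inv_cancel_left₀ hN0.ne']
  rw [e, enorm_mul, mul_comm, hN', Real.enorm_of_nonneg hN0.le]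
  gcongr

lemma apply_eq_of_ae_eq (hl : IsBoundedFunctional l) {f g : wScriptH hΦ P ℱ}
    (h : ∀ n, (f : ℕ → Ω → ℝ) n =ᵐ[P] (g : ℕ → Ω → ℝ) n) : l f = l g := by
  have h1 : hNorm Φ P ((f - g : wScriptH hΦ P ℱ) : ℕ → Ω → ℝ) = 0 := by
    rw [hNorm_congr hΦ (g := 0) fun n => ?_, hNorm_zero]
    filter_upwards [h n] with ω hω
    simp [hω]
  have h2 := enorm_apply_le hl (f - g)
  rw [h1, mul_zero, map_sub] at h2
  exact sub_eq_zero.1 (enorm_eq_zero.1 (le_antisymm h2 zero_le))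

lemma integral_mul_sub_condExp {f g : Ω → ℝ} {L : ℝ} (hf : AEStronglyMeasurable f P)
    (hL : ∀ᵐ ω ∂P, |f ω| ≤ L) (hg : Integrable g P) (h0 : P[g|ℱ 0] =ᵐ[P] 0) :
    ∫ ω, (f - P[f|ℱ 0]) ω * g ω ∂P = ∫ ω, f ω * g ω ∂P := by
  have i1 : Integrable (fun ω => f ω * g ω) P := hg.bdd_mul (c := L) hf hL
  have i2 : Integrable (fun ω => (P[f|ℱ 0]) ω * g ω) P :=
    hg.bdd_mul (c := L) integrable_condExp.aestronglyMeasurable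
      (ae_bdd_abs_condExp_of_ae_bdd_abs hL)
  have e : ∫ ω, (P[f|ℱ 0]) ω * g ω ∂P = 0 := by
    rw [integral_condExp_mul_comm (ℱ.le 0) hf hL hg]
    refine integral_eq_zero_of_ae ?_
    filter_upwards [h0] with ω h
    simp [h]
  simp only [Pi.sub_apply, sub_mul]
  rw [integral_sub i1 i2, e, sub_zero]

/-- A function `g` with `E_0 g = 0` that is bounded as a functional in the norm of `L_1` is
essentially bounded. -/
lemma ae_abs_le_of_integral_mul_le {g : Ω → ℝ} (hg : Integrable g P) (h0 : P[g|ℱ 0] =ᵐ[P] 0)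
    {C : ℝ≥0} (h : ∀ d, BddMeanZero P ℱ d → ‖∫ ω, d ω * g ω ∂P‖ₑ ≤ C * eLpNorm d 1 P) :
    ∀ᵐ ω ∂P, |g ω| ≤ 2 * C := by
  have key : ∀ A, MeasurableSet A → |∫ ω in A, g ω ∂P| ≤ 2 * C * P.real A := fun A hA => by
    set f : Ω → ℝ := A.indicator fun _ => 1 with hf
    have hfm : AEStronglyMeasurable f P :=
      (stronglyMeasurable_const.indicator hA).aestronglyMeasurable
    have hf1 : ∀ᵐ ω ∂P, |f ω| ≤ 1 := Eventually.of_forall fun ω => by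
      by_cases hω : ω ∈ A <;> simp [hf, hω]
    have hd := h _ (bddMeanZero_sub_condExp (ℱ := ℱ) hfm hf1)
    rw [integral_mul_sub_condExp hfm hf1 hg h0] at hd
    have e : ∫ ω, f ω * g ω ∂P = ∫ ω in A, g ω ∂P := by
      rw [← integral_indicator hA]
      refine integral_congr_ae (Eventually.of_forall fun ω => ?_)
      by_cases hω : ω ∈ A <;> simp [hf, hω]
    have hn : eLpNorm (f - P[f|ℱ 0]) 1 P ≤ ENNReal.ofReal (2 * P.real A) := by
      refine (eLpNorm_sub_le hfm integrable_condExp.aestronglyMeasurable le_rfl).trans ?_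
      have h1 : eLpNorm f 1 P = ENNReal.ofReal (P.real A) := by
        rw [hf, eLpNorm_indicator_const hA one_ne_zero ENNReal.one_ne_top]
        simp
      calc _ ≤ eLpNorm f 1 P + eLpNorm f 1 P := by
            gcongr; exact eLpNorm_condExp_le_eLpNorm _ le_rfl
        _ = ENNReal.ofReal (2 * P.real A) := by
          rw [h1, ← ENNReal.ofReal_add measureReal_nonneg measureReal_nonneg, two_mul]
    rw [e, Real.enorm_eq_ofReal_abs] at hd
    have h2 := hd.trans (mul_le_mul_right hn _)
    rw [← ENNReal.ofReal_coe_nnreal, ← ENNReal.ofReal_mul C.coe_nonneg,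
      ENNReal.ofReal_le_ofReal_iff (by positivity)] at h2
    linarith
  have hle : g ≤ᵐ[P] fun _ => 2 * (C : ℝ) := by
    refine ae_le_of_forall_setIntegral_le hg (integrable_const _) fun A hA _ => ?_
    rw [setIntegral_const, smul_eq_mul, mul_comm]
    exact (le_abs_self _).trans (key A hA)
  have hge : (fun _ => -(2 * (C : ℝ))) ≤ᵐ[P] g := by
    refine ae_le_of_forall_setIntegral_le (integrable_const _) hg fun A hA _ => ?_
    rw [setIntegral_const, smul_eq_mul, mul_comm]
    linarith [neg_le_of_abs_le (key A hA)]
  filter_upwards [hle, hge] with ω h1 h2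
  exact abs_le.2 ⟨h2, h1⟩

lemma ae_eq_of_integral_mul_eq {g g' : Ω → ℝ} (hg : Integrable g P) (hg' : Integrable g' P)
    (h0 : P[g|ℱ 0] =ᵐ[P] 0) (h0' : P[g'|ℱ 0] =ᵐ[P] 0)
    (h : ∀ d, BddMeanZero P ℱ d → ∫ ω, d ω * g ω ∂P = ∫ ω, d ω * g' ω ∂P) : g =ᵐ[P] g' := by
  have h00 : P[g - g'|ℱ 0] =ᵐ[P] 0 := by
    filter_upwards [condExp_sub hg hg' (ℱ 0), h0, h0'] with ω e e1 e2
    simp [e, e1, e2]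
  have := ae_abs_le_of_integral_mul_le (C := 0) (hg.sub hg') h00 fun d hd => by
    obtain ⟨L, hL⟩ := hd.bdd
    have e : ∫ ω, d ω * (g - g') ω ∂P = 0 := by
      simp only [Pi.sub_apply, mul_sub]
      rw [integral_sub (hg.bdd_mul (c := L) hd.aesm hL) (hg'.bdd_mul (c := L) hd.aesm hL), h d hd,
        sub_self]
    rw [e, enorm_zero]
    exact zero_le
  filter_upwards [this] with ω hω
  simpa [sub_eq_zero] using hω

/-- A functional that is given by a bounded function on bounded functions is given by it on all
integrable functions. -/
lemma apply_condExp_eq_integral (hc : ConcaveOn ℝ (Ici 0) Φ) (hl : IsBoundedFunctional l)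
    {g : Ω → ℝ} {B : ℝ≥0} (hg : AEStronglyMeasurable g P) (hB : ∀ᵐ ω ∂P, |g ω| ≤ B)
    (h : ∀ d, BddMeanZero P ℱ d → ∀ hd : (fun n => P[d|ℱ n]) ∈ wScriptH hΦ P ℱ,
      l ⟨_, hd⟩ = ∫ ω, d ω * g ω ∂P)
    {f : Ω → ℝ} (hf : Integrable f P) (h0 : P[f|ℱ 0] =ᵐ[P] 0)
    (hfm : (fun n => P[f|ℱ n]) ∈ wScriptH hΦ P ℱ) : l ⟨_, hfm⟩ = ∫ ω, f ω * g ω ∂P := by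
  obtain ⟨K, hK⟩ := hl
  refine eq_of_forall_enorm_sub_le (C := K * (1 / inv Φ 1).toNNReal + B) fun ε hε => ?_
  obtain ⟨d, hd, hfd⟩ := exists_bddMeanZero_approx hf h0 (ε := ε) (by simpa using hε.ne')
  have hdm := condExp_mem_wScriptH hΦ hc hd.integrable hd.condExp_zero
  have i1 : Integrable (fun ω => f ω * g ω) P := hf.mul_bdd (c := B) hg hB
  have i2 : Integrable (fun ω => d ω * g ω) P := hd.integrable.mul_bdd (c := B) hg hB
  have e : l ⟨_, hfm⟩ - ∫ ω, f ω * g ω ∂P =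
      l (⟨_, hfm⟩ - ⟨_, hdm⟩) - ∫ ω, (f - d) ω * g ω ∂P := by
    simp only [Pi.sub_apply, sub_mul]
    rw [map_sub, h d hd hdm, integral_sub i1 i2]
    ring
  rw [e]
  have h1 : ‖l (⟨_, hfm⟩ - ⟨_, hdm⟩)‖ₑ ≤ K * ((1 / inv Φ 1).toNNReal * ε) := by
    refine (hK _).trans ?_
    gcongr
    have e2 : hNorm Φ P ((fun n => P[f|ℱ n]) - fun n => P[d|ℱ n]) =
        hNorm Φ P (fun n => P[f - d|ℱ n]) :=
      hNorm_congr hΦ (sub_condExp_ae_eq hf hd.integrable)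
    change hNorm Φ P ((fun n => P[f|ℱ n]) - fun n => P[d|ℱ n]) ≤ _
    rw [e2]
    refine (hNorm_condExp_le hΦ hc (hf.sub hd.integrable)).trans ?_
    exact mul_le_mul_right hfd.le _
  have h2 : ‖∫ ω, (f - d) ω * g ω ∂P‖ₑ ≤ B * ε := by
    calc _ ≤ ∫⁻ ω, ‖(f - d) ω * g ω‖ₑ ∂P := enorm_integral_le_lintegral_enorm _
      _ ≤ ∫⁻ ω, B * ‖(f - d) ω‖ₑ ∂P := by
        refine lintegral_mono_ae ?_
        filter_upwards [hB] with ω hω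
        rw [enorm_mul, mul_comm]
        gcongr
        rw [Real.enorm_eq_ofReal_abs, ← ENNReal.ofReal_coe_nnreal]
        exact ENNReal.ofReal_le_ofReal hω
      _ = B * eLpNorm (f - d) 1 P := by
        rw [lintegral_const_mul' _ _ ENNReal.coe_ne_top, eLpNorm_one_eq_lintegral_enorm]
      _ ≤ B * ε := by gcongr
  refine (enorm_sub_le.trans (add_le_add h1 h2)).trans (le_of_eq ?_)
  push_cast
  ring

/-- Continuous functionals are determined by their values at bounded functions. -/
lemma functional_ext (hgen : ⨆ n, (ℱ n : MeasurableSpace Ω) = m) (hreg : IsRegular P ℱ)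
    (hc : ConcaveOn ℝ (Ici 0) Φ)
    {l' : wScriptH hΦ P ℱ →ₗ[ℝ] ℝ} (hl : IsBoundedFunctional l) (hl' : IsBoundedFunctional l')
    (h : ∀ d, BddMeanZero P ℱ d → ∀ hd : (fun n => P[d|ℱ n]) ∈ wScriptH hΦ P ℱ,
      l ⟨_, hd⟩ = l' ⟨_, hd⟩) : l = l' := by
  obtain ⟨K, hK⟩ := hl
  obtain ⟨K', hK'⟩ := hl'
  refine LinearMap.ext fun f => ?_
  refine eq_of_forall_enorm_sub_le (C := K + K') fun ε hε => ?_
  obtain ⟨d, hd, hfd⟩ := exists_bddMeanZero_hNorm_sub_lt hgen hreg hΦ f.2 hε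
  have hdm := condExp_mem_wScriptH hΦ hc hd.integrable hd.condExp_zero
  have e : l f - l' f = l (f - ⟨_, hdm⟩) - l' (f - ⟨_, hdm⟩) := by
    rw [map_sub, map_sub, h d hd hdm]
    ring
  rw [e]
  have h1 : ‖l (f - ⟨_, hdm⟩)‖ₑ ≤ K * ε := (hK _).trans (mul_le_mul_right hfd _)
  have h2 : ‖l' (f - ⟨_, hdm⟩)‖ₑ ≤ K' * ε := (hK' _).trans (mul_le_mul_right hfd _)
  refine (enorm_sub_le.trans (add_le_add h1 h2)).trans (le_of_eq ?_)
  push_cast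
  ring

/-- The graph of the pairing `d ↦ E(d g)`, where `d` runs over the bounded functions with
`E_0 d = 0`, as a subspace of `w𝓗_Φ × ℝ`. -/
def pairingGraph (hΦ : MemG ℓ Φ) (ℱ : Filtration ℕ m) {g : Ω → ℝ} (hg : Integrable g P) :
    Submodule ℝ (wScriptH hΦ P ℱ × ℝ) where
  carrier := {p | ∃ d, BddMeanZero P ℱ d ∧
    (∀ n, (p.1 : ℕ → Ω → ℝ) n =ᵐ[P] P[d|ℱ n]) ∧ p.2 = ∫ ω, d ω * g ω ∂P}
  zero_mem' := ⟨0, BddMeanZero.zero, fun n => by simp, by simp⟩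
  add_mem' := by
    rintro p p' ⟨d, hd, hp, hp2⟩ ⟨d', hd', hp', hp2'⟩
    refine ⟨d + d', hd.add hd', fun n => ?_, ?_⟩
    · exact ((hp n).add (hp' n)).trans (condExp_add hd.integrable hd'.integrable _).symm
    · simp only [Pi.add_apply, add_mul, Prod.snd_add]
      rw [integral_add (hd.integrable_mul hg) (hd'.integrable_mul hg), hp2, hp2']
  smul_mem' := by
    rintro k p ⟨d, hd, hp, hp2⟩
    refine ⟨k • d, hd.smul k, fun n => ?_, ?_⟩
    · exact ((hp n).const_smul k).trans (condExp_smul k d _).symm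
    · simp only [Pi.smul_apply, smul_eq_mul, mul_assoc]
      rw [integral_const_mul, ← hp2]
      rfl

lemma mem_pairingGraph {g : Ω → ℝ} (hg : Integrable g P) {p : wScriptH hΦ P ℱ × ℝ} :
    p ∈ pairingGraph hΦ ℱ hg ↔ ∃ d, BddMeanZero P ℱ d ∧
      (∀ n, (p.1 : ℕ → Ω → ℝ) n =ᵐ[P] P[d|ℱ n]) ∧ p.2 = ∫ ω, d ω * g ω ∂P :=
  Iff.rfl

/-- If pairing with `g` is bounded in the quasi-norm of the weak Hardy space on bounded functions,
it extends to a continuous functional. -/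
lemma exists_functional_of_integral_mul_le (hgen : ⨆ n, (ℱ n : MeasurableSpace Ω) = m)
    (hreg : IsRegular P ℱ) (hΦ : MemG ℓ Φ) (hc : ConcaveOn ℝ (Ici 0) Φ) {K : ℝ≥0}
    (hK : ∀ f g : ℕ → Ω → ℝ, hNorm Φ P (f + g) ≤ K * max (hNorm Φ P f) (hNorm Φ P g))
    {g : Ω → ℝ} (hg : Integrable g P) {C : ℝ≥0}
    (h : ∀ d, BddMeanZero P ℱ d →
      ‖∫ ω, d ω * g ω ∂P‖ₑ ≤ C * hNorm Φ P (fun n => P[d|ℱ n])) :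
    ∃ l : wScriptH hΦ P ℱ →ₗ[ℝ] ℝ, (∀ f, ‖l f‖ₑ ≤ C * K * hNorm Φ P f) ∧
      ∀ d, BddMeanZero P ℱ d → ∀ hd : (fun n => P[d|ℱ n]) ∈ wScriptH hΦ P ℱ,
        l ⟨_, hd⟩ = ∫ ω, d ω * g ω ∂P := by
  have hgraph : ∀ d, BddMeanZero P ℱ d → ∀ hd : (fun n => P[d|ℱ n]) ∈ wScriptH hΦ P ℱ,
      ((⟨_, hd⟩, ∫ ω, d ω * g ω ∂P) : wScriptH hΦ P ℱ × ℝ) ∈ pairingGraph hΦ ℱ hg :=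
    fun d hd hdm => (mem_pairingGraph hg).2 ⟨d, hd, fun n => EventuallyEq.rfl, rfl⟩
  have hadd : ∀ f f' : wScriptH hΦ P ℱ, hNorm Φ P ((f + f' : wScriptH hΦ P ℱ) : ℕ → Ω → ℝ) ≤
      K * max (hNorm Φ P f) (hNorm Φ P f') := fun f f' => hK f f'
  have hsmul : ∀ (k : ℝ) (f : wScriptH hΦ P ℱ),
      hNorm Φ P ((k • f : wScriptH hΦ P ℱ) : ℕ → Ω → ℝ) ≤ ENNReal.ofReal |k| * hNorm Φ P f :=
    fun k f => hNorm_smul_le k (f : ℕ → Ω → ℝ)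
  have hG : ∀ p ∈ pairingGraph hΦ ℱ hg, ‖p.2‖ₑ ≤ C * hNorm Φ P p.1 := fun p hp => by
    obtain ⟨d, hd, hp, hp2⟩ := (mem_pairingGraph hg).1 hp
    rw [hp2, hNorm_congr hΦ hp]
    exact h d hd
  have hdense : ∀ f : wScriptH hΦ P ℱ, ∀ ε : ℝ≥0, 0 < ε → ∃ p ∈ pairingGraph hΦ ℱ hg,
      hNorm Φ P ((f - p.1 : wScriptH hΦ P ℱ) : ℕ → Ω → ℝ) ≤ ε := fun f ε hε => by
    obtain ⟨d, hd, hfd⟩ := exists_bddMeanZero_hNorm_sub_lt hgen hreg hΦ f.2 hε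
    exact ⟨_, hgraph d hd (condExp_mem_wScriptH hΦ hc hd.integrable hd.condExp_zero), hfd⟩
  obtain ⟨l, hlG, hl⟩ := exists_linearMap_of_dense_graph
    (N := fun f : wScriptH hΦ P ℱ => hNorm Φ P f) hadd hsmul _ hG hdense
  exact ⟨l, hl, fun d hd hdm => hlG _ (hgraph d hd hdm)⟩

/-- Continuous functionals on the weak Hardy space restrict to continuous functionals on `L_2`, and
are therefore given there by a function `g`. -/
lemma exists_integral_mul_eq_apply (hc : ConcaveOn ℝ (Ici 0) Φ) (hl : IsBoundedFunctional l) :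
    ∃ g : Ω → ℝ, Integrable g P ∧ P[g|ℱ 0] =ᵐ[P] 0 ∧ ∀ d, BddMeanZero P ℱ d →
      ∀ hd : (fun n => P[d|ℱ n]) ∈ wScriptH hΦ P ℱ, l ⟨_, hd⟩ = ∫ ω, d ω * g ω ∂P := by
  have hi : ∀ f : Lp ℝ 2 P, Integrable f P := fun f => (Lp.memLp f).integrable (by norm_num)
  have hi' : ∀ f : Lp ℝ 2 P, Integrable (⇑f - P[f|ℱ 0]) P := fun f =>
    (hi f).sub integrable_condExp
  have hz : ∀ f : Lp ℝ 2 P, P[⇑f - P[f|ℱ 0]|ℱ 0] =ᵐ[P] 0 := fun f => by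
    refine (condExp_sub (hi f) integrable_condExp _).trans ?_
    rw [condExp_of_stronglyMeasurable (ℱ.le 0) stronglyMeasurable_condExp integrable_condExp,
      sub_self]
  have hmem : ∀ f : Lp ℝ 2 P, (fun n => P[⇑f - P[f|ℱ 0]|ℱ n]) ∈ wScriptH hΦ P ℱ := fun f =>
    condExp_mem_wScriptH hΦ hc (hi' f) (hz f)
  -- centering `f` makes the functional defined on all of `L_2`
  let T₀ : Lp ℝ 2 P →ₗ[ℝ] ℝ :=
    { toFun := fun f => l ⟨_, hmem f⟩
      map_add' := fun f f' => by
        rw [← map_add]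
        refine apply_eq_of_ae_eq hl fun n => ?_
        have e : (⇑(f + f') - P[⇑(f + f')|ℱ 0]) =ᵐ[P]
            (⇑f - P[f|ℱ 0]) + (⇑f' - P[f'|ℱ 0]) := by
          filter_upwards [Lp.coeFn_add f f', condExp_congr_ae (m := ℱ 0) (Lp.coeFn_add f f'),
            condExp_add (hi f) (hi f') (ℱ 0)] with ω h1 h2 h3
          simp only [Pi.sub_apply, Pi.add_apply, h1, h2, h3]
          ring
        exact (condExp_congr_ae e).trans (condExp_add (hi' f) (hi' f') _)
      map_smul' := fun k f => by
        rw [← map_smul]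
        refine apply_eq_of_ae_eq hl fun n => ?_
        have e : (⇑(k • f) - P[⇑(k • f)|ℱ 0]) =ᵐ[P] k • (⇑f - P[f|ℱ 0]) := by
          filter_upwards [Lp.coeFn_smul k f, condExp_congr_ae (m := ℱ 0) (Lp.coeFn_smul k f),
            condExp_smul k (f : Ω → ℝ) (ℱ 0)] with ω h1 h2 h3
          simp only [Pi.sub_apply, Pi.smul_apply, h1, h2, h3, smul_eq_mul]
          ring
        exact (condExp_congr_ae e).trans (condExp_smul k _ _) }
  obtain ⟨K, hK⟩ := hl
  have hT : ∀ f, ‖T₀ f‖ ≤ (K * ((1 / inv Φ 1).toNNReal * 2) : ℝ≥0) * ‖f‖ := fun f => by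
    have h1 : ‖T₀ f‖ₑ ≤ K * ((1 / inv Φ 1).toNNReal * (2 * eLpNorm f 2 P)) := by
      refine (hK ⟨_, hmem f⟩).trans ?_
      gcongr
      refine (hNorm_condExp_le hΦ hc (hi' f)).trans ?_
      refine mul_le_mul_right ?_ _
      refine (eLpNorm_sub_le (hi f).aestronglyMeasurable
        integrable_condExp.aestronglyMeasurable le_rfl).trans ?_
      rw [two_mul]
      refine add_le_add ?_ ((eLpNorm_condExp_le_eLpNorm _ le_rfl).trans ?_) <;>
      exact eLpNorm_le_eLpNorm_of_exponent_le (by norm_num) (hi f).aestronglyMeasurable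
    have h2 : eLpNorm f 2 P = ‖f‖ₑ := (Lp.enorm_def f).symm
    rw [h2, enorm_eq_nnnorm, enorm_eq_nnnorm] at h1
    have h3 : ‖T₀ f‖₊ ≤ (K * ((1 / inv Φ 1).toNNReal * 2) : ℝ≥0) * ‖f‖₊ := by
      rw [← ENNReal.coe_le_coe]
      refine h1.trans (le_of_eq ?_)
      push_cast
      ring
    exact_mod_cast h3
  let T : Lp ℝ 2 P →L[ℝ] ℝ := T₀.mkContinuous _ hT
  set g₀ : Lp ℝ 2 P := (InnerProductSpace.toDual ℝ (Lp ℝ 2 P)).symm T with hg₀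
  refine ⟨⇑g₀ - P[g₀|ℱ 0], hi' g₀, hz g₀, fun d hd hdm => ?_⟩
  obtain ⟨L, hL⟩ := hd.bdd
  set f : Lp ℝ 2 P := (hd.memLp 2).toLp d with hf
  have hfd : f =ᵐ[P] d := (hd.memLp 2).coeFn_toLp
  have e1 : T f = l ⟨_, hdm⟩ := by
    refine apply_eq_of_ae_eq ⟨K, hK⟩ fun n => condExp_congr_ae ?_
    filter_upwards [hfd, (condExp_congr_ae hfd).trans hd.condExp_zero] with ω h1 h2
    simp [h1, h2]
  have e2 : T f = ∫ ω, d ω * g₀ ω ∂P := by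
    rw [← InnerProductSpace.toDual_symm_apply (𝕜 := ℝ) (y := T) (x := f), L2.inner_def]
    refine integral_congr_ae ?_
    filter_upwards [hfd] with ω h1
    simp [h1, hg₀]
  have e3 : ∫ ω, d ω * (P[g₀|ℱ 0]) ω ∂P = 0 := by
    rw [← integral_condExp_mul_comm (ℱ.le 0) hd.aesm hL (hi g₀)]
    refine integral_eq_zero_of_ae ?_
    filter_upwards [hd.condExp_zero] with ω h
    simp [h]
  rw [← e1, e2]
  simp only [Pi.sub_apply, mul_sub]
  rw [integral_sub ((hi g₀).bdd_mul (c := L) hd.aesm hL)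
    (integrable_condExp.bdd_mul (c := L) hd.aesm hL), e3, sub_zero]

end Functionals

/-! ### Oscillations over stopping times -/

section Oscillation

variable {Ω : Type*} {m : MeasurableSpace Ω}

/-- The oscillation `sup {‖g - g^ν‖_q : ν a stopping time, P(ν < ∞) ≤ x}`. -/
noncomputable def osc (P : Measure Ω) (ℱ : Filtration ℕ m) (q : ℝ) (g : Ω → ℝ) (x : ℝ) : ℝ≥0∞ :=
  ⨆ (ν : Ω → WithTop ℕ) (_ : IsStoppingTime ℱ ν) (_ : P {ω | ν ω < ⊤} ≤ ENNReal.ofReal x),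
    eLpNorm (fun ω => g ω - stopped P ℱ g ν ω) (ENNReal.ofReal q) P

variable {P : Measure Ω} {ℱ : Filtration ℕ m} {g : Ω → ℝ} {q : ℝ}

lemma osc_mono {x y : ℝ} (h : x ≤ y) : osc P ℱ q g x ≤ osc P ℱ q g y :=
  iSup_mono fun _ => iSup_mono fun _ => iSup_mono' fun hx =>
    ⟨hx.trans (ENNReal.ofReal_le_ofReal h), le_rfl⟩

lemma le_osc {ν : Ω → WithTop ℕ} (hν : IsStoppingTime ℱ ν) {x : ℝ}
    (h : P {ω | ν ω < ⊤} ≤ ENNReal.ofReal x) :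
    eLpNorm (fun ω => g ω - stopped P ℱ g ν ω) (ENNReal.ofReal q) P ≤ osc P ℱ q g x :=
  le_iSup_of_le ν (le_iSup_of_le hν (le_iSup_of_le h le_rfl))

lemma tFun_eq {Φ φ : ℝ → ℝ} (hφ : ∀ r : ℝ, 0 < r → φ r = 1 / (r * inv Φ (1 / r))) {x : ℝ}
    (hx : 0 < x) :
    tFun P ℱ q φ g x = ENNReal.ofReal (x * inv Φ (1 / x) * x ^ (-1 / q)) * osc P ℱ q g x := by
  rw [tFun, hφ x hx, one_div_one_div]
  rfl

lemma tFun_one_eq {Φ φ : ℝ → ℝ} (hφ : ∀ r : ℝ, 0 < r → φ r = 1 / (r * inv Φ (1 / r))) {x : ℝ}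
    (hx : 0 < x) :
    tFun P ℱ 1 φ g x = ENNReal.ofReal (inv Φ (1 / x)) * osc P ℱ 1 g x := by
  rw [tFun_eq hφ hx, div_one, Real.rpow_neg_one]
  congr 2
  field_simp

lemma sub_stopped_eq_indicator (ν : Ω → WithTop ℕ) :
    (fun ω => g ω - stopped P ℱ g ν ω) =
      {ω | ν ω < ⊤}.indicator fun ω => g ω - stopped P ℱ g ν ω := by
  ext ω
  by_cases h : ν ω = ⊤
  · rw [indicator_of_notMem (by simp [h]), stopped_of_eq_top h, sub_self]
  · rw [indicator_of_mem (show ω ∈ {ω | ν ω < ⊤} from lt_top_iff_ne_top.2 h)]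

variable [IsProbabilityMeasure P]

/-- Hölder's inequality on the set where the stopping time is finite. -/
lemma eLpNorm_sub_stopped_le (hgen : ⨆ n, (ℱ n : MeasurableSpace Ω) = m) {q' : ℝ}
    (hq : 1 ≤ q) (hqq' : q ≤ q') (hg : Integrable g P) {ν : Ω → WithTop ℕ}
    (hν : IsStoppingTime ℱ ν) :
    eLpNorm (fun ω => g ω - stopped P ℱ g ν ω) (ENNReal.ofReal q) P ≤
      eLpNorm (fun ω => g ω - stopped P ℱ g ν ω) (ENNReal.ofReal q') P *
        P {ω | ν ω < ⊤} ^ (1 / q - 1 / q') := by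
  have hm := measurableSet_lt_top hν
  have hae : AEStronglyMeasurable (fun ω => g ω - stopped P ℱ g ν ω) P :=
    hg.aestronglyMeasurable.sub (integrable_stopped hgen hν hg).aestronglyMeasurable
  rw [sub_stopped_eq_indicator ν, eLpNorm_indicator_eq_eLpNorm_restrict hm,
    eLpNorm_indicator_eq_eLpNorm_restrict hm]
  have h := eLpNorm_le_eLpNorm_mul_rpow_measure_univ (ENNReal.ofReal_le_ofReal hqq')
    (hae.restrict (s := {ω | ν ω < ⊤}))
  rwa [Measure.restrict_apply_univ, ENNReal.toReal_ofReal (by linarith),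
    ENNReal.toReal_ofReal (by linarith)] at h

/-- The scale of Campanato norms increases with `q`. -/
lemma campanatoNorm_mono (hgen : ⨆ n, (ℱ n : MeasurableSpace Ω) = m) {Φ φ : ℝ → ℝ} {ℓ : ℝ}
    (hΦ : MemG ℓ Φ) (hc : ConcaveOn ℝ (Ici 0) Φ)
    (hφ : ∀ r : ℝ, 0 < r → φ r = 1 / (r * inv Φ (1 / r))) {q' : ℝ}
    (hq : 1 ≤ q) (hqq' : q ≤ q') (hg : Integrable g P) :
    campanatoNorm P ℱ q φ g ≤ campanatoNorm P ℱ q' φ g := by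
  refine setLIntegral_mono' measurableSet_Ioi fun x hx => ENNReal.div_le_div_right ?_ _
  have hx : 0 < x := hx
  have hψ := hΦ.inv_pos hc (y := 1 / x) (by positivity)
  have hxψ : 0 ≤ x * inv Φ (1 / x) := by positivity
  rw [tFun_eq hφ hx, tFun_eq hφ hx, ENNReal.ofReal_mul hxψ, ENNReal.ofReal_mul hxψ, mul_assoc,
    mul_assoc]
  refine mul_le_mul' le_rfl ?_
  have e : ENNReal.ofReal (x ^ (-1 / q)) * ENNReal.ofReal x ^ (1 / q - 1 / q') =
      ENNReal.ofReal (x ^ (-1 / q')) := by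
    rw [ENNReal.ofReal_rpow_of_pos hx, ← ENNReal.ofReal_mul (by positivity), ← Real.rpow_add hx]
    congr 2
    ring
  rw [← e, mul_assoc]
  refine mul_le_mul' le_rfl ?_
  refine iSup_le fun ν => iSup_le fun hν => iSup_le fun hP => ?_
  refine (eLpNorm_sub_stopped_le hgen hq hqq' hg hν).trans ?_
  rw [mul_comm]
  have : 0 ≤ 1 / q - 1 / q' := sub_nonneg.2 (one_div_le_one_div_of_le (by linarith) hqq')
  gcongr
  exact le_osc hν hP

end Oscillation

/-! ### Functions of Campanato class define functionals -/

section Pairing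

variable {Ω : Type*} {m : MeasurableSpace Ω} {P : Measure Ω}
  {ℱ : Filtration ℕ m} {g : Ω → ℝ} {Φ φ : ℝ → ℝ} {ℓ : ℝ}

lemma enorm_integral_mul_le {f h : Ω → ℝ} {L : ℝ} (hL : ∀ᵐ ω ∂P, |f ω| ≤ L) :
    ‖∫ ω, f ω * h ω ∂P‖ₑ ≤ ENNReal.ofReal L * eLpNorm h 1 P := by
  calc _ ≤ ∫⁻ ω, ‖f ω * h ω‖ₑ ∂P := enorm_integral_le_lintegral_enorm _
    _ ≤ ∫⁻ ω, ENNReal.ofReal L * ‖h ω‖ₑ ∂P := by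
      refine lintegral_mono_ae ?_
      filter_upwards [hL] with ω hω
      rw [enorm_mul, Real.enorm_eq_ofReal_abs (f ω)]
      gcongr
    _ = ENNReal.ofReal L * eLpNorm h 1 P := by
      rw [lintegral_const_mul' _ _ ENNReal.ofReal_ne_top, eLpNorm_one_eq_lintegral_enorm]

/-- The integrand in the Campanato norm does not decrease too fast, so that its value at a point
is controlled by its integral over a dyadic interval. -/
lemma tFun_one_le_setLIntegral (hΦ : MemG ℓ Φ) (hc : ConcaveOn ℝ (Ici 0) Φ)
    (hφ : ∀ r : ℝ, 0 < r → φ r = 1 / (r * inv Φ (1 / r))) {D : ℝ} (hD1 : 1 ≤ D)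
    (hD : ∀ y, 0 ≤ y → inv Φ (2 * y) ≤ D * inv Φ y) {x y : ℝ} (hx : 0 < x) (hxy : 2 * x ≤ y) :
    tFun P ℱ 1 φ g x ≤
      ENNReal.ofReal (2 * D) * ∫⁻ z in Ioc x y, tFun P ℱ 1 φ g z / ENNReal.ofReal z := by
  have hD0 : 0 < D := by linarith
  have hlow : ∀ z ∈ Ioc x (2 * x), tFun P ℱ 1 φ g x * ENNReal.ofReal (1 / (2 * D * x)) ≤
      tFun P ℱ 1 φ g z / ENNReal.ofReal z := fun z hz => by
    have hz0 : 0 < z := hx.trans hz.1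
    have hψ := hΦ.inv_pos hc (y := 1 / x) (by positivity)
    have ediv : ∀ a : ℝ≥0∞, a / ENNReal.ofReal z = a * ENNReal.ofReal z⁻¹ := fun a => by
      rw [ENNReal.ofReal_inv_of_pos hz0]
      rfl
    rw [tFun_one_eq hφ hx, tFun_one_eq hφ hz0, ediv, mul_right_comm,
      mul_right_comm _ (osc P ℱ 1 g z), ← ENNReal.ofReal_mul (hΦ.inv_nonneg hc (by positivity)),
      ← ENNReal.ofReal_mul (hΦ.inv_nonneg hc (by positivity))]
    refine mul_le_mul' (ENNReal.ofReal_le_ofReal ?_) (osc_mono hz.1.le)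
    have h1 : inv Φ (1 / x) ≤ D * inv Φ (1 / z) := by
      refine (hΦ.inv_mono hc (by positivity) ?_).trans (hD _ (by positivity))
      rw [mul_one_div, div_le_div_iff₀ hx hz0]
      linarith [hz.2]
    have h2 : 1 / (2 * x) ≤ z⁻¹ := by
      rw [← one_div]
      exact one_div_le_one_div_of_le hz0 hz.2
    calc inv Φ (1 / x) * (1 / (2 * D * x)) = inv Φ (1 / x) / D * (1 / (2 * x)) := by field_simp
      _ ≤ inv Φ (1 / z) * z⁻¹ := by
        refine mul_le_mul ((div_le_iff₀' hD0).2 h1) h2 (by positivity)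
          (hΦ.inv_nonneg hc (by positivity))
  have h1 : tFun P ℱ 1 φ g x * ENNReal.ofReal (1 / (2 * D * x)) * ENNReal.ofReal x ≤
      ∫⁻ z in Ioc x y, tFun P ℱ 1 φ g z / ENNReal.ofReal z := by
    calc _ = ∫⁻ _ in Ioc x (2 * x), tFun P ℱ 1 φ g x * ENNReal.ofReal (1 / (2 * D * x)) := by
          rw [setLIntegral_const, Real.volume_Ioc]
          congr 2
          ring
      _ ≤ ∫⁻ z in Ioc x (2 * x), tFun P ℱ 1 φ g z / ENNReal.ofReal z :=
        setLIntegral_mono' measurableSet_Ioc hlow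
      _ ≤ _ := lintegral_mono_set (Ioc_subset_Ioc_right hxy)
  calc tFun P ℱ 1 φ g x = ENNReal.ofReal (2 * D) *
        (tFun P ℱ 1 φ g x * ENNReal.ofReal (1 / (2 * D * x)) * ENNReal.ofReal x) := by
        rw [mul_assoc, ← ENNReal.ofReal_mul (by positivity), mul_left_comm,
          ← ENNReal.ofReal_mul (by positivity)]
        have : 2 * D * (1 / (2 * D * x) * x) = 1 := by field_simp
        rw [this, ENNReal.ofReal_one, mul_one]
    _ ≤ _ := by gcongr

lemma sum_setLIntegral_Ioc_le {x : ℕ → ℝ} (hx0 : ∀ j, 0 < x j) (hx : Monotone x) (F : ℝ → ℝ≥0∞)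
    (J : ℕ) : ∑ j ∈ Finset.range J, ∫⁻ z in Ioc (x j) (x (j + 1)), F z ≤ ∫⁻ z in Ioi 0, F z := by
  calc _ ≤ ∑' j, ∫⁻ z in Ioc (x j) (x (j + 1)), F z := ENNReal.sum_le_tsum _
    _ = ∫⁻ z in ⋃ j, Ioc (x j) (x (j + 1)), F z :=
      (lintegral_iUnion (fun _ => measurableSet_Ioc) hx.pairwise_disjoint_on_Ioc_succ _).symm
    _ ≤ _ := lintegral_mono_set (iUnion_subset fun j z hz => (hx0 j).trans hz.1)

variable [IsProbabilityMeasure P]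

lemma enorm_integral_mul_stopped_sub_le (hgen : ⨆ n, (ℱ n : MeasurableSpace Ω) = m)
    {f : Ω → ℝ} (hf : BddMeanZero P ℱ f) (hg : Integrable g P) {ν σ : Ω → WithTop ℕ}
    (hν : IsStoppingTime ℱ ν) (hσ : IsStoppingTime ℱ σ) (hle : σ ≤ ν) {L : ℝ}
    (hL : ∀ᵐ ω ∂P, |stopped P ℱ f ν ω| ≤ L) :
    ‖∫ ω, f ω * (stopped P ℱ g ν ω - stopped P ℱ g σ ω) ∂P‖ₑ ≤
      ENNReal.ofReal L * eLpNorm (fun ω => g ω - stopped P ℱ g σ ω) 1 P := by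
  obtain ⟨B, hB⟩ := hf.bdd
  have hgσ := integrable_stopped hgen hσ hg
  have e : ∫ ω, f ω * (stopped P ℱ g ν ω - stopped P ℱ g σ ω) ∂P =
      ∫ ω, stopped P ℱ f ν ω * (g ω - stopped P ℱ g σ ω) ∂P := by
    have hi : Integrable (fun ω => g ω - stopped P ℱ g σ ω) P := hg.sub hgσ
    rw [integral_stopped_mul_comm hgen hν hf.aesm hB hi]
    refine integral_congr_ae ?_
    filter_upwards [stopped_sub hgen hν hg hgσ, stopped_stopped hgen hν hσ hle hg] with ω h1 h2
    rw [h1, h2]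
  rw [e]
  exact enorm_integral_mul_le hL

lemma enorm_integral_mul_stopped_sub_stopped_le (hgen : ⨆ n, (ℱ n : MeasurableSpace Ω) = m)
    {f : Ω → ℝ} (hf : BddMeanZero P ℱ f) (hg : Integrable g P) {ν ν' : Ω → WithTop ℕ}
    (hν : IsStoppingTime ℱ ν) (hν' : IsStoppingTime ℱ ν') {L L' : ℝ} (hL0 : 0 ≤ L)
    (hL0' : 0 ≤ L') (hL : ∀ᵐ ω ∂P, |stopped P ℱ f ν ω| ≤ L)
    (hL' : ∀ᵐ ω ∂P, |stopped P ℱ f ν' ω| ≤ L') :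
    ‖∫ ω, f ω * stopped P ℱ g ν ω ∂P - ∫ ω, f ω * stopped P ℱ g ν' ω ∂P‖ₑ ≤
      ENNReal.ofReal (L + L') *
        eLpNorm (fun ω => g ω - stopped P ℱ g (fun ω => min (ν ω) (ν' ω)) ω) 1 P := by
  have hσ := hν.min hν'
  set σ : Ω → WithTop ℕ := fun ω => min (ν ω) (ν' ω)
  have h1 := enorm_integral_mul_stopped_sub_le hgen hf hg hν hσ (fun ω => min_le_left _ _) hL
  have h2 := enorm_integral_mul_stopped_sub_le hgen hf hg hν' hσ (fun ω => min_le_right _ _) hL'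
  have i : ∀ {τ}, IsStoppingTime ℱ τ → Integrable (fun ω => f ω * stopped P ℱ g τ ω) P :=
    fun hτ => hf.integrable_mul (integrable_stopped hgen hτ hg)
  have e : ∫ ω, f ω * stopped P ℱ g ν ω ∂P - ∫ ω, f ω * stopped P ℱ g ν' ω ∂P =
      ∫ ω, f ω * (stopped P ℱ g ν ω - stopped P ℱ g σ ω) ∂P -
        ∫ ω, f ω * (stopped P ℱ g ν' ω - stopped P ℱ g σ ω) ∂P := by
    simp only [mul_sub]
    rw [integral_sub (i hν) (i hσ), integral_sub (i hν') (i hσ)]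
    ring
  rw [e, ENNReal.ofReal_add hL0 hL0', add_mul]
  exact enorm_sub_le.trans (add_le_add h1 h2)

/-- The pairing of a bounded function `f` with `g` is bounded by the product of the Campanato norm
of `g` and the quasi-norm of `f`. The martingale of `f` is stopped just before it exceeds the levels
`λ_j = L s^j`, which splits `E(f g)` into pieces that are bounded by oscillations of `g`; at a level
`λ` the relevant probability is `x = 2R / Φ(λ / c)`, for which `λ` is comparable to
`c Φ⁻¹(1 / x)`. -/
lemma exists_enorm_integral_mul_le_campanatoNorm (hgen : ⨆ n, (ℱ n : MeasurableSpace Ω) = m)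
    (hreg : IsRegular P ℱ) (hΦ : MemG ℓ Φ) (hc : ConcaveOn ℝ (Ici 0) Φ)
    (hφ : ∀ r : ℝ, 0 < r → φ r = 1 / (r * inv Φ (1 / r))) :
    ∃ C : ℝ≥0, 0 < C ∧ ∀ g : Ω → ℝ, Integrable g P → campanatoNorm P ℱ 1 φ g < ∞ →
      ∀ f, BddMeanZero P ℱ f → ‖∫ ω, f ω * g ω ∂P‖ₑ ≤
        C * campanatoNorm P ℱ 1 φ g * hNorm Φ P (fun n => P[f|ℱ n]) := by
  obtain ⟨R, hR0, hR⟩ := hreg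
  have hR0' : (0 : ℝ) < R := hR0
  obtain ⟨D, hD1, hD⟩ := hΦ.exists_inv_doubling hc
  obtain ⟨s, hs0, hs1, hs⟩ := hΦ.exists_dilation (ε := 1 / 2) (by norm_num)
  obtain ⟨s', hs'0, -, hs'⟩ := hΦ.exists_dilation (ε := 1 / (2 * R)) (by positivity)
  have hD0 : 0 < D := by linarith
  have hs_lt : s < 1 := by
    refine lt_of_le_of_ne hs1 fun h => ?_
    have h1 := hs 1 zero_le_one
    have h2 := hΦ.pos hc one_pos
    rw [h, mul_one] at h1
    linarith
  set C₀ : ℝ := 2 / s * (1 / s') * (2 * D) with hC₀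
  have hC₀0 : 0 < C₀ := by positivity
  refine ⟨C₀.toNNReal, by simpa using hC₀0, fun g hg hgfin f hf => ?_⟩
  have key : ∀ c : ℝ, 0 < c → (∀ t : ℝ, 0 < t → Φ (t / c) *
      P.real {ω | ENNReal.ofReal t < maximal (fun n => P[f|ℱ n]) ω} ≤ 1) →
      ‖∫ ω, f ω * g ω ∂P‖ₑ ≤ ENNReal.ofReal (C₀ * c) * campanatoNorm P ℱ 1 φ g := by
    intro c hc0 hct
    obtain ⟨L', hL'⟩ := hf.bdd
    set L := max L' 1
    have hL0 : 0 < L := lt_max_of_lt_right one_pos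
    have hL : ∀ᵐ ω ∂P, |f ω| ≤ L := hL'.mono fun ω h => h.trans (le_max_left _ _)
    set lev : ℕ → ℝ := fun j => L * s ^ j with hlev
    have hlev0 : ∀ j, 0 < lev j := fun j => by positivity
    have hlev_succ : ∀ j, lev (j + 1) = s * lev j := fun j => by simp only [hlev]; ring
    have hlev_le : ∀ j, lev (j + 1) ≤ lev j := fun j => by
      rw [hlev_succ]
      exact mul_le_of_le_one_left (hlev0 j).le hs1
    have hΦlev : ∀ j, 0 < Φ (lev j / c) := fun j => hΦ.pos hc (div_pos (hlev0 j) hc0)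
    choose ν hν hPν hle using fun j => exists_stoppingTime_of_regular hR
      (martingale_condExp f ℱ P).stronglyAdapted hf.condExp_zero (hlev0 j).le
    have hst : ∀ j, ∀ᵐ ω ∂P, |stopped P ℱ f (ν j) ω| ≤ lev j := fun j =>
      abs_stopped_le hgen hf.integrable (hle j)
    set x : ℕ → ℝ := fun j => 2 * R / Φ (lev j / c) with hx
    have hx0 : ∀ j, 0 < x j := fun j => div_pos (by positivity) (hΦlev j)
    have hPν' : ∀ j, P {ω | ν j ω < ⊤} ≤ ENNReal.ofReal (x j / 2) := fun j => by
      refine (hPν j).trans ?_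
      have h1 : P.real {ω | ENNReal.ofReal (lev j) < maximal (fun n => P[f|ℱ n]) ω} ≤
          1 / Φ (lev j / c) := by
        rw [le_div_iff₀' (hΦlev j)]
        exact hct _ (hlev0 j)
      rw [← ofReal_measureReal, ← ENNReal.ofReal_coe_nnreal, ← ENNReal.ofReal_mul hR0'.le]
      refine ENNReal.ofReal_le_ofReal ((mul_le_mul_of_nonneg_left h1 hR0'.le).trans (le_of_eq ?_))
      simp only [hx]
      ring
    have hx2 : ∀ j, 2 * x j ≤ x (j + 1) := fun j => by
      have h1 : Φ (lev (j + 1) / c) ≤ 1 / 2 * Φ (lev j / c) := by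
        rw [hlev_succ, mul_div_assoc]
        exact hs _ (div_pos (hlev0 j) hc0).le
      simp only [hx]
      rw [mul_div_assoc', div_le_div_iff₀ (hΦlev j) (hΦlev (j + 1))]
      nlinarith
    have hxmono : Monotone x := monotone_nat_of_le_succ fun j => by linarith [hx2 j, hx0 j]
    have hosc : ∀ j, eLpNorm (fun ω => g ω -
        stopped P ℱ g (fun ω => min (ν j ω) (ν (j + 1) ω)) ω) 1 P ≤ osc P ℱ 1 g (x (j + 1)) := by
      intro j
      rw [← ENNReal.ofReal_one]
      refine le_osc ((hν j).min (hν (j + 1))) ?_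
      calc P {ω | min (ν j ω) (ν (j + 1) ω) < ⊤}
          ≤ P {ω | ν j ω < ⊤} + P {ω | ν (j + 1) ω < ⊤} := by
            refine (measure_mono fun ω hω => ?_).trans (measure_union_le _ _)
            have hω' : min (ν j ω) (ν (j + 1) ω) < ⊤ := hω
            exact min_lt_iff.1 hω'
        _ ≤ ENNReal.ofReal (x j / 2) + ENNReal.ofReal (x (j + 1) / 2) :=
          add_le_add (hPν' j) (hPν' (j + 1))
        _ ≤ ENNReal.ofReal (x (j + 1)) := by
          rw [← ENNReal.ofReal_add (by linarith [hx0 j]) (by linarith [hx0 (j + 1)])]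
          exact ENNReal.ofReal_le_ofReal (by linarith [hx2 j, hx0 j])
    have hstep : ∀ j, ‖∫ ω, f ω * stopped P ℱ g (ν j) ω ∂P -
        ∫ ω, f ω * stopped P ℱ g (ν (j + 1)) ω ∂P‖ₑ ≤ ENNReal.ofReal (C₀ * c) *
          ∫⁻ z in Ioc (x (j + 1)) (x (j + 1 + 1)), tFun P ℱ 1 φ g z / ENNReal.ofReal z := by
      intro j
      have hψ : lev j + lev (j + 1) ≤ 2 / s * (1 / s') * c * inv Φ (1 / x (j + 1)) := by
        have h1 : s' * (lev (j + 1) / c) ≤ inv Φ (1 / x (j + 1)) := by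
          have hl := hlev0 (j + 1)
          rw [hΦ.le_inv_iff hc (by positivity) (one_div_pos.2 (hx0 _)).le]
          refine (hs' _ (by positivity)).trans (le_of_eq ?_)
          simp only [hx]
          rw [one_div_div, one_div_mul_eq_div]
        calc lev j + lev (j + 1) ≤ 2 * lev j := by linarith [hlev_le j]
          _ = 2 / s * (1 / s') * c * (s' * (lev (j + 1) / c)) := by
            rw [hlev_succ]; field_simp
          _ ≤ _ := mul_le_mul_of_nonneg_left h1 (by positivity)
      calc _ ≤ ENNReal.ofReal (lev j + lev (j + 1)) * osc P ℱ 1 g (x (j + 1)) :=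
            (enorm_integral_mul_stopped_sub_stopped_le hgen hf hg (hν j) (hν (j + 1)) (hlev0 j).le
              (hlev0 (j + 1)).le (hst j) (hst (j + 1))).trans (mul_le_mul_right (hosc j) _)
        _ ≤ ENNReal.ofReal (2 / s * (1 / s') * c * inv Φ (1 / x (j + 1))) *
            osc P ℱ 1 g (x (j + 1)) := by gcongr
        _ = ENNReal.ofReal (2 / s * (1 / s') * c) * tFun P ℱ 1 φ g (x (j + 1)) := by
          rw [tFun_one_eq hφ (hx0 _), ENNReal.ofReal_mul (by positivity), mul_assoc]
        _ ≤ ENNReal.ofReal (2 / s * (1 / s') * c) * (ENNReal.ofReal (2 * D) *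
            ∫⁻ z in Ioc (x (j + 1)) (x (j + 1 + 1)), tFun P ℱ 1 φ g z / ENNReal.ofReal z) := by
          gcongr
          exact tFun_one_le_setLIntegral hΦ hc hφ hD1 hD (hx0 _) (hx2 _)
        _ = _ := by
          rw [← mul_assoc, ← ENNReal.ofReal_mul (by positivity)]
          congr 2
          simp only [hC₀]
          ring
    -- the top level exceeds `f`, so that the first stopping time is almost surely infinite
    have htop : ∫ ω, f ω * g ω ∂P = ∫ ω, f ω * stopped P ℱ g (ν 0) ω ∂P := by
      have h0 : P {ω | ν 0 ω < ⊤} = 0 := by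
        refine le_antisymm ((hPν 0).trans ?_) zero_le
        have h1 : P {ω | ENNReal.ofReal (lev 0) < maximal (fun n => P[f|ℱ n]) ω} = 0 := by
          rw [← nonpos_iff_eq_zero, ← measure_empty (μ := P)]
          refine measure_mono_ae ?_
          filter_upwards [maximal_condExp_le (ℱ := ℱ) hL] with ω hω hω'
          have h2 : ENNReal.ofReal (lev 0) < maximal (fun n => P[f|ℱ n]) ω := hω'
          simp only [hlev, pow_zero, mul_one] at h2
          exact absurd hω (not_le.2 h2)
        rw [h1, mul_zero]
      refine integral_congr_ae ?_
      have h1 : ∀ᵐ ω ∂P, ¬ ν 0 ω < ⊤ := measure_eq_zero_iff_ae_notMem.1 h0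
      filter_upwards [h1] with ω hω
      rw [stopped_of_eq_top (not_lt_top_iff.1 hω)]
    have hbot : ∀ J, ‖∫ ω, f ω * stopped P ℱ g (ν J) ω ∂P‖ₑ ≤
        ENNReal.ofReal (lev J) * eLpNorm g 1 P := fun J => by
      rw [← integral_stopped_mul_comm hgen (hν J) hf.aesm hL hg]
      exact enorm_integral_mul_le (hst J)
    have hJ : ∀ J, ‖∫ ω, f ω * g ω ∂P‖ₑ ≤
        ENNReal.ofReal (C₀ * c) * campanatoNorm P ℱ 1 φ g +
          ENNReal.ofReal (lev J) * eLpNorm g 1 P := fun J => by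
      have e : ∫ ω, f ω * g ω ∂P = ∑ j ∈ Finset.range J, (∫ ω, f ω * stopped P ℱ g (ν j) ω ∂P -
          ∫ ω, f ω * stopped P ℱ g (ν (j + 1)) ω ∂P) + ∫ ω, f ω * stopped P ℱ g (ν J) ω ∂P := by
        rw [Finset.sum_range_sub', htop]
        ring
      rw [e]
      refine (enorm_add_le _ _).trans (add_le_add ?_ (hbot J))
      refine (enorm_sum_le _ _).trans ((Finset.sum_le_sum fun j _ => hstep j).trans ?_)
      rw [← Finset.mul_sum]
      refine mul_le_mul_right ?_ _
      exact sum_setLIntegral_Ioc_le (x := fun j => x (j + 1)) (fun j => hx0 _)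
        (fun i j hij => hxmono (by omega)) _ J
    have hlim : Tendsto (fun J => ENNReal.ofReal (C₀ * c) * campanatoNorm P ℱ 1 φ g +
        ENNReal.ofReal (lev J) * eLpNorm g 1 P) atTop
        (nhds (ENNReal.ofReal (C₀ * c) * campanatoNorm P ℱ 1 φ g + 0 * eLpNorm g 1 P)) := by
      refine tendsto_const_nhds.add (ENNReal.Tendsto.mul_const ?_
        (Or.inr (memLp_one_iff_integrable.2 hg).eLpNorm_ne_top))
      rw [← ENNReal.ofReal_zero]
      refine (ENNReal.continuous_ofReal.tendsto 0).comp ?_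
      simpa using (tendsto_pow_atTop_nhds_zero_of_lt_one hs0.le hs_lt).const_mul L
    have := ge_of_tendsto' hlim hJ
    rwa [zero_mul, add_zero] at this
  have hB : (C₀.toNNReal : ℝ≥0∞) * campanatoNorm P ℱ 1 φ g ≠ ∞ :=
    ENNReal.mul_ne_top ENNReal.coe_ne_top hgfin.ne
  rcases eq_or_ne ((C₀.toNNReal : ℝ≥0∞) * campanatoNorm P ℱ 1 φ g) 0 with hB0 | hB0
  · rw [hB0, zero_mul]
    obtain ⟨c, ⟨hc0, hct⟩, -⟩ := wNorm_lt_iff.1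
      (condExp_mem_wScriptH hΦ hc hf.integrable hf.condExp_zero).2.2.wNorm_lt_top
    refine (key c hc0 hct).trans (le_of_eq ?_)
    rw [ENNReal.ofReal_mul hC₀0.le, mul_right_comm]
    exact mul_eq_zero_of_left hB0 _
  · rw [← ENNReal.div_le_iff' hB0 hB]
    refine le_of_forall_gt_imp_ge_of_dense fun ε hε => ?_
    obtain ⟨c, ⟨hc0, hct⟩, hcε⟩ := wNorm_lt_iff.1 hε
    rw [ENNReal.div_le_iff' hB0 hB]
    refine (key c hc0 hct).trans ?_
    rw [ENNReal.ofReal_mul hC₀0.le, mul_right_comm]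
    exact mul_le_mul_right hcε.le _

end Pairing

/-! ### Superpositions of atoms -/

section Atoms

variable {Ω : Type*} {m : MeasurableSpace Ω} {P : Measure Ω} [IsProbabilityMeasure P]
  {ℱ : Filtration ℕ m} {Φ φ : ℝ → ℝ} {ℓ : ℝ}

/-- The martingale of `u - u^ν` vanishes up to the time `ν`. -/
lemma condExp_sub_stopped_eq_zero (hgen : ⨆ n, (ℱ n : MeasurableSpace Ω) = m)
    {ν : Ω → WithTop ℕ} (hν : IsStoppingTime ℱ ν) {u : Ω → ℝ} (hu : Integrable u P) (n : ℕ) :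
    ∀ᵐ ω ∂P, WithTop.some n ≤ ν ω → (P[u - stopped P ℱ u ν|ℱ n]) ω = 0 := by
  have hs := integrable_stopped hgen hν hu
  have h0 : P[u - stopped P ℱ u ν|hν.measurableSpace] =ᵐ[P] 0 := by
    have e := stopped_ae_eq_condExp hgen hν hu
    have e2 := condExp_congr_ae (m := hν.measurableSpace) e
    rw [condExp_of_stronglyMeasurable hν.measurableSpace_le stronglyMeasurable_condExp
      integrable_condExp] at e2
    filter_upwards [condExp_sub hu hs hν.measurableSpace, e2] with ω h1 h2
    simp [h1, h2]
  have hconst := isStoppingTime_const ℱ n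
  have hmin := hconst.min hν
  have hle : hmin.measurableSpace ≤ hν.measurableSpace :=
    hmin.measurableSpace_mono hν fun ω => min_le_right _ _
  have h1 : P[u - stopped P ℱ u ν|hmin.measurableSpace] =ᵐ[P] 0 := by
    refine (condExp_condExp_of_le hle hν.measurableSpace_le).symm.trans ?_
    refine (condExp_congr_ae h0).trans ?_
    rw [condExp_zero]
  have h2 := condExp_min_stopping_time_ae_eq_restrict_le (μ := P)
    (f := u - stopped P ℱ u ν) hconst hν
  rw [IsStoppingTime.measurableSpace_const] at h2
  have h3 := (ae_restrict_iff' (hν.measurableSpace_le _ (hν.measurableSet_ge' n))).1 h2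
  filter_upwards [h1, h3] with ω h1 h3 hω
  rw [← h3 hω, h1, Pi.zero_apply]

/-- The extremal function in the duality of `L_q` and `L_p`. -/
lemma exists_dual_function {h : Ω → ℝ} (hh : AEStronglyMeasurable h P) {L : ℝ}
    (hL : ∀ᵐ ω ∂P, |h ω| ≤ L) {q p : ℝ} (hqp : q.HolderConjugate p) :
    ∃ u : Ω → ℝ, AEStronglyMeasurable u P ∧ (∃ L' : ℝ, ∀ᵐ ω ∂P, |u ω| ≤ L') ∧
      eLpNorm u (ENNReal.ofReal p) P ≤ 1 ∧ 0 ≤ ∫ ω, u ω * h ω ∂P ∧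
      ENNReal.ofReal (∫ ω, u ω * h ω ∂P) = eLpNorm h (ENNReal.ofReal q) P := by
  have hq0 := hqp.pos
  have hp0 := hqp.symm.pos
  have hq1 := hqp.lt
  have hqp' : (q - 1) * p = q := hqp.sub_one_mul_conj
  have hfin : eLpNorm h (ENNReal.ofReal q) P ≠ ∞ := (MemLp.of_bound hh L hL).eLpNorm_ne_top
  set η := (eLpNorm h (ENNReal.ofReal q) P).toReal with hη
  have hη' : eLpNorm h (ENNReal.ofReal q) P = ENNReal.ofReal η := (ENNReal.ofReal_toReal hfin).symm
  have hη0 : 0 ≤ η := ENNReal.toReal_nonneg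
  rcases hη0.eq_or_lt with h0 | hηpos
  · exact ⟨0, aestronglyMeasurable_const, ⟨0, by simp⟩, by simp, by simp,
      by rw [hη', ← h0]; simp⟩
  set w : Ω → ℝ := fun ω => h ω * |h ω| ^ (q - 2) with hw
  have hwm : AEStronglyMeasurable w P :=
    (hh.aemeasurable.mul (hh.norm.aemeasurable.pow_const _)).aestronglyMeasurable
  have hwabs : ∀ ω, |w ω| = |h ω| ^ (q - 1) := fun ω => by
    rcases eq_or_ne (h ω) 0 with h1 | h1
    · simp only [hw, h1, zero_mul, abs_zero]
      rw [Real.zero_rpow (by linarith)]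
    · have h2 : 0 < |h ω| := abs_pos.2 h1
      simp only [hw]
      rw [abs_mul, abs_of_nonneg (Real.rpow_nonneg h2.le _),
        show q - 1 = 1 + (q - 2) by ring, Real.rpow_add h2, Real.rpow_one]
  have hwh : ∀ ω, w ω * h ω = |h ω| ^ q := fun ω => by
    have e1 : w ω * h ω = |w ω| * |h ω| := by
      simp only [hw]
      rw [abs_mul, abs_of_nonneg (Real.rpow_nonneg (abs_nonneg _) _)]
      have := abs_mul_abs_self (h ω)
      linear_combination (-|h ω| ^ (q - 2)) * this
    rw [e1, hwabs]
    rcases eq_or_ne (h ω) 0 with h1 | h1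
    · rw [h1, abs_zero, mul_zero, Real.zero_rpow hq0.ne']
    · have h2 : 0 < |h ω| := abs_pos.2 h1
      nth_rewrite 2 [← Real.rpow_one |h ω|]
      rw [← Real.rpow_add h2]
      congr 1
      ring
  have hI : ∫⁻ ω, ‖h ω‖ₑ ^ q ∂P = ENNReal.ofReal η ^ q := by
    rw [← hη', eLpNorm_eq_lintegral_rpow_enorm_toReal (by simpa using hq0) ENNReal.ofReal_ne_top,
      ENNReal.toReal_ofReal hq0.le, ← ENNReal.rpow_mul, one_div_mul_cancel hq0.ne',
      ENNReal.rpow_one]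
  have hwnorm : eLpNorm w (ENNReal.ofReal p) P = ENNReal.ofReal η ^ (q - 1) := by
    rw [eLpNorm_eq_lintegral_rpow_enorm_toReal (by simpa using hp0) ENNReal.ofReal_ne_top,
      ENNReal.toReal_ofReal hp0.le]
    have : ∀ ω, ‖w ω‖ₑ ^ p = ‖h ω‖ₑ ^ q := fun ω => by
      rw [Real.enorm_eq_ofReal_abs, Real.enorm_eq_ofReal_abs, hwabs,
        ENNReal.ofReal_rpow_of_nonneg (Real.rpow_nonneg (abs_nonneg _) _) hp0.le,
        ENNReal.ofReal_rpow_of_nonneg (abs_nonneg _) hq0.le, ← Real.rpow_mul (abs_nonneg _), hqp']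
    simp_rw [this]
    rw [hI, ← ENNReal.rpow_mul]
    congr 1
    field_simp
    linarith
  have hint : ENNReal.ofReal (∫ ω, w ω * h ω ∂P) = ENNReal.ofReal η ^ q := by
    simp_rw [hwh]
    rw [ofReal_integral_eq_lintegral_ofReal, ← hI]
    · refine lintegral_congr fun ω => ?_
      rw [Real.enorm_eq_ofReal_abs, ENNReal.ofReal_rpow_of_nonneg (abs_nonneg _) hq0.le]
    · refine Integrable.of_bound (C := L ^ q)
        (hh.norm.aemeasurable.pow_const q).aestronglyMeasurable ?_
      filter_upwards [hL] with ω hω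
      rw [Real.norm_of_nonneg (Real.rpow_nonneg (abs_nonneg _) _)]
      exact Real.rpow_le_rpow (abs_nonneg _) hω hq0.le
    · exact Eventually.of_forall fun ω => Real.rpow_nonneg (abs_nonneg _) _
  have hηofReal : ENNReal.ofReal η ≠ 0 := by simpa using hηpos
  have hηinv : ENNReal.ofReal (η ^ (-(q - 1))) = ENNReal.ofReal η ^ (-(q - 1)) :=
    (ENNReal.ofReal_rpow_of_pos hηpos).symm
  refine ⟨η ^ (-(q - 1)) • w, hwm.const_smul _, ⟨η ^ (-(q - 1)) * L ^ (q - 1), ?_⟩, ?_,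
    integral_nonneg fun ω => ?_, ?_⟩
  · filter_upwards [hL] with ω hω
    rw [Pi.smul_apply, smul_eq_mul, abs_mul, hwabs,
      abs_of_nonneg (Real.rpow_nonneg hη0 _)]
    gcongr
  · rw [eLpNorm_const_smul, hwnorm, Real.enorm_of_nonneg (Real.rpow_nonneg hη0 _), hηinv,
      ← ENNReal.rpow_add _ _ hηofReal ENNReal.ofReal_ne_top, neg_add_cancel, ENNReal.rpow_zero]
  · rw [Pi.smul_apply, smul_eq_mul, mul_assoc, hwh]
    positivity
  · have e : ∀ ω, (η ^ (-(q - 1)) • w) ω * h ω = η ^ (-(q - 1)) * (w ω * h ω) := fun ω => by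
      rw [Pi.smul_apply, smul_eq_mul, mul_assoc]
    simp_rw [e]
    rw [integral_const_mul, ENNReal.ofReal_mul (Real.rpow_nonneg hη0 _), hint, hηinv,
      ← ENNReal.rpow_add _ _ hηofReal ENNReal.ofReal_ne_top, hη']
    simp

/-- The coefficient `φ(x)⁻¹ x^{-1/q}` at the dyadic point `x = 2^{-k}`. -/
noncomputable def dyadicCoeff (Φ : ℝ → ℝ) (q : ℝ) (k : ℕ) : ℝ :=
  (1 / 2) ^ k * inv Φ (1 / (1 / 2) ^ k) * ((1 / 2 : ℝ) ^ k) ^ (-1 / q)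

lemma dyadicCoeff_nonneg (hΦ : MemG ℓ Φ) (hc : ConcaveOn ℝ (Ici 0) Φ) (q : ℝ) (k : ℕ) :
    0 ≤ dyadicCoeff Φ q k := by
  have := hΦ.inv_nonneg hc (y := 1 / (1 / 2) ^ k) (by positivity)
  unfold dyadicCoeff
  positivity

/-- The dyadic coefficients grow geometrically, so that their partial sums are dominated by the last
term. -/
lemma exists_sum_dyadicCoeff_le (hΦ : MemG ℓ Φ) (hc : ConcaveOn ℝ (Ici 0) Φ) {q p : ℝ}
    (hqp : q.HolderConjugate p) : ∃ G : ℝ, 0 < G ∧ ∀ k₀,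
      ∑ k ∈ Finset.range (k₀ + 1), dyadicCoeff Φ q k ≤
        G * ((1 / 2 : ℝ) ^ k₀) ^ (1 / p) * inv Φ (1 / (1 / 2) ^ k₀) := by
  set r : ℝ := 2 ^ (1 / q) with hr
  have hq0 := hqp.pos
  have hr1 : 1 < r := Real.one_lt_rpow (by norm_num) (by positivity)
  have hr0 : 0 < r := by linarith
  refine ⟨r / (r - 1), div_pos hr0 (by linarith), fun k₀ => ?_⟩
  have hψ0 : ∀ k : ℕ, 0 ≤ inv Φ (1 / (1 / 2) ^ k) := fun k => hΦ.inv_nonneg hc (by positivity)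
  have hpow : ∀ k : ℕ, ((1 / 2 : ℝ) ^ k) ^ (-1 / q) = r ^ k := fun k => by
    rw [hr, ← Real.rpow_natCast, ← Real.rpow_natCast, ← Real.rpow_mul (by norm_num),
      ← Real.rpow_mul (by norm_num), one_div, Real.inv_rpow (by norm_num),
      ← Real.rpow_neg (by norm_num)]
    congr 1
    ring
  have hterm : ∀ k ∈ Finset.range (k₀ + 1), dyadicCoeff Φ q k ≤
      (1 / 2) ^ k₀ * inv Φ (1 / (1 / 2) ^ k₀) * r ^ k := fun k hk => by
    have hk' : k ≤ k₀ := by have := Finset.mem_range.1 hk; omega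
    unfold dyadicCoeff
    rw [hpow]
    refine mul_le_mul_of_nonneg_right ?_ (by positivity)
    have h1 := hΦ.inv_mul_le hc (s := (1 / 2 : ℝ) ^ (k₀ - k)) (y := 1 / (1 / 2) ^ k₀)
      (by positivity) (pow_le_one₀ (by norm_num) (by norm_num)) (by positivity)
    have e1 : (1 / 2 : ℝ) ^ (k₀ - k) * (1 / (1 / 2) ^ k₀) = 1 / (1 / 2) ^ k := by
      rw [mul_one_div, div_eq_div_iff (by positivity) (by positivity), one_mul, ← pow_add]
      congr 1
      omega
    rw [e1] at h1
    calc (1 / 2 : ℝ) ^ k * inv Φ (1 / (1 / 2) ^ k)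
        ≤ (1 / 2 : ℝ) ^ k * ((1 / 2) ^ (k₀ - k) * inv Φ (1 / (1 / 2) ^ k₀)) := by gcongr
      _ = (1 / 2) ^ k₀ * inv Φ (1 / (1 / 2) ^ k₀) := by
        rw [← mul_assoc, ← pow_add]
        congr 3
        omega
  refine (Finset.sum_le_sum hterm).trans ?_
  rw [← Finset.mul_sum]
  have hgeom : ∑ k ∈ Finset.range (k₀ + 1), r ^ k ≤ r / (r - 1) * r ^ k₀ := by
    rw [geom_sum_eq hr1.ne', div_mul_eq_mul_div]
    refine div_le_div_of_nonneg_right ?_ (by linarith)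
    rw [pow_succ]
    linarith
  have e : (1 / 2 : ℝ) ^ k₀ * r ^ k₀ = ((1 / 2 : ℝ) ^ k₀) ^ (1 / p) := by
    have hpos : (0 : ℝ) < (1 / 2) ^ k₀ := by positivity
    rw [← hpow]
    nth_rewrite 1 [← Real.rpow_one ((1 / 2 : ℝ) ^ k₀)]
    rw [← Real.rpow_add hpos]
    congr 1
    have := hqp.inv_add_inv_eq_one
    rw [neg_div, one_div, one_div]
    linarith
  calc _ ≤ (1 / 2 : ℝ) ^ k₀ * inv Φ (1 / (1 / 2) ^ k₀) * (r / (r - 1) * r ^ k₀) :=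
        mul_le_mul_of_nonneg_left hgeom (mul_nonneg (by positivity) (hψ0 k₀))
    _ = r / (r - 1) * ((1 / 2 : ℝ) ^ k₀ * r ^ k₀) * inv Φ (1 / (1 / 2) ^ k₀) := by ring
    _ = _ := by rw [e]

/-- Superpositions of atoms `a_k` that live on `{ν_k < ∞}`, `P(ν_k < ∞) ≤ 2^{-k}`, and are bounded
in `L_p`. For a given level `t`, the atoms with `2^k > Φ(t)` are discarded together with their
supports, and the weak-type `(p,p)` inequality is applied to the sum of the others. -/
lemma exists_hNorm_sum_atoms_le (hΦ : MemG ℓ Φ) (hc : ConcaveOn ℝ (Ici 0) Φ) {q p : ℝ}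
    (hqp : q.HolderConjugate p) : ∃ C : ℝ, 0 < C ∧ ∀ (a : ℕ → Ω → ℝ) (ν : ℕ → Ω → WithTop ℕ),
      (∀ k, Integrable (a k) P) → (∀ k, eLpNorm (a k) (ENNReal.ofReal p) P ≤ 2) →
      (∀ k, P {ω | ν k ω < ⊤} ≤ ENNReal.ofReal ((1 / 2) ^ k)) →
      (∀ k n, ∀ᵐ ω ∂P, ν k ω = ⊤ → (P[a k|ℱ n]) ω = 0) → ∀ N,
      hNorm Φ P (fun n => P[∑ k ∈ Finset.range N, dyadicCoeff Φ q k • a k|ℱ n]) ≤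
        ENNReal.ofReal C := by
  obtain ⟨G, hG0, hG⟩ := exists_sum_dyadicCoeff_le hΦ hc hqp
  have hp0 := hqp.symm.pos
  have hp1 := hqp.symm.lt
  set A : ℝ := 2 * ((2 * G) ^ p + 1) with hA
  have hA0 : 0 < A := by positivity
  obtain ⟨s, hs0, -, hs⟩ := hΦ.exists_dilation (ε := 1 / A) (by positivity)
  refine ⟨1 / s, by positivity, fun a ν hai hap hPν hvan N => ?_⟩
  set f := ∑ k ∈ Finset.range N, dyadicCoeff Φ q k • a k with hf
  have hci : ∀ k, Integrable (dyadicCoeff Φ q k • a k) P := fun k => (hai k).smul _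
  suffices H : ∀ t : ℝ, 0 < t → P.real {ω | ENNReal.ofReal t < maximal (fun n => P[f|ℱ n]) ω} ≤
      A / Φ t by
    refine wNorm_le_of_bound (by positivity) fun t ht => ?_
    have hΦt := hΦ.pos hc ht
    calc _ ≤ 1 / A * Φ t * (A / Φ t) := by
          refine mul_le_mul ?_ (H t ht) measureReal_nonneg (by positivity)
          rw [div_div_eq_mul_div, div_one, mul_comm]
          exact hs t ht.le
      _ = 1 := by field_simp
  intro t ht
  have hΦt := hΦ.pos hc ht
  rcases lt_or_ge (Φ t) 1 with hlt | hge
  · refine measureReal_le_one.trans ?_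
    rw [le_div_iff₀ hΦt, one_mul]
    have : 0 < (2 * G) ^ p := by positivity
    linarith
  -- the index `k₀` is the integer part of `log₂ Φ(t)`
  obtain ⟨k₀, hk1, hk2⟩ := exists_nat_pow_near hge (one_lt_two (α := ℝ))
  have hψt : inv Φ (1 / (1 / 2) ^ k₀) ≤ t := by
    rw [hΦ.inv_le_iff hc ht.le (by positivity)]
    refine le_trans (le_of_eq ?_) hk1
    rw [one_div_pow, one_div_one_div]
  set s₁ := (Finset.range N).filter (· ≤ k₀) with hs₁
  set s₂ := (Finset.range N).filter (fun k => ¬ k ≤ k₀) with hs₂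
  set f₁ := ∑ k ∈ s₁, dyadicCoeff Φ q k • a k with hf₁
  set f₂ := ∑ k ∈ s₂, dyadicCoeff Φ q k • a k with hf₂
  have hff : f = f₁ + f₂ := (Finset.sum_filter_add_sum_filter_not _ _ _).symm
  have hi₁ : Integrable f₁ P := integrable_finsetSum' _ fun k _ => hci k
  have hi₂ : Integrable f₂ P := integrable_finsetSum' _ fun k _ => hci k
  have hvan₂ : ∀ᵐ ω ∂P, (∀ k ∈ s₂, ν k ω = ⊤) → ∀ n, (P[f₂|ℱ n]) ω = 0 := by
    have h1 : ∀ n, P[f₂|ℱ n] =ᵐ[P] ∑ k ∈ s₂, P[dyadicCoeff Φ q k • a k|ℱ n] := fun n =>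
      condExp_finsetSum (fun k _ => hci k) _
    have h2 : ∀ n k, P[dyadicCoeff Φ q k • a k|ℱ n] =ᵐ[P] dyadicCoeff Φ q k • P[a k|ℱ n] :=
      fun n k => condExp_smul _ _ _
    filter_upwards [ae_all_iff.2 h1, ae_all_iff.2 fun n => ae_all_iff.2 (h2 n),
      ae_all_iff.2 fun k => ae_all_iff.2 (hvan k)] with ω h1 h2 h3 hν n
    rw [h1 n, Finset.sum_apply]
    refine Finset.sum_eq_zero fun k hk => ?_
    rw [h2 n k, Pi.smul_apply, h3 k n (hν k hk), smul_zero]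
  have hsplit : P {ω | ENNReal.ofReal t < maximal (fun n => P[f|ℱ n]) ω} ≤
      P {ω | ENNReal.ofReal t < maximal (fun n => P[f₁|ℱ n]) ω} +
        ∑ k ∈ s₂, P {ω | ν k ω < ⊤} := by
    refine le_trans (measure_mono_ae ?_) ((measure_union_le _ _).trans
      (add_le_add le_rfl (measure_biUnion_finset_le s₂ _)))
    have h1 : ∀ n, P[f|ℱ n] =ᵐ[P] P[f₁|ℱ n] + P[f₂|ℱ n] := fun n => by
      rw [hff]; exact condExp_add hi₁ hi₂ _
    filter_upwards [ae_all_iff.2 h1, hvan₂] with ω h1 h2 hω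
    by_cases hν : ∀ k ∈ s₂, ν k ω = ⊤
    · left
      have h3 : maximal (fun n => P[f|ℱ n]) ω = maximal (fun n => P[f₁|ℱ n]) ω := by
        simp only [maximal]
        refine iSup_congr fun n => ?_
        rw [h1 n, Pi.add_apply, h2 hν n, add_zero]
      have hω' : ENNReal.ofReal t < maximal (fun n => P[f|ℱ n]) ω := hω
      rw [h3] at hω'
      exact hω'
    · right
      push Not at hν
      obtain ⟨k, hk, hkν⟩ := hν
      exact mem_biUnion (by exact hk) (show ω ∈ {ω | ν k ω < ⊤} from lt_top_iff_ne_top.2 hkν)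
  have htail : ∑ k ∈ s₂, P {ω | ν k ω < ⊤} ≤ ENNReal.ofReal ((1 / 2) ^ k₀) := by
    have h1 : ∑ k ∈ s₂, (1 / 2 : ℝ) ^ k ≤ (1 / 2) ^ k₀ := by
      have hsum : Summable fun i : ℕ => (1 / 2 : ℝ) ^ (i + (k₀ + 1)) := by
        simp_rw [pow_add]
        exact summable_geometric_two.mul_right _
      have h2 : ∑ k ∈ s₂, (1 / 2 : ℝ) ^ k ≤
          ∑ k ∈ Finset.Ico (k₀ + 1) (k₀ + 1 + N), (1 / 2 : ℝ) ^ k := by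
        refine Finset.sum_le_sum_of_subset_of_nonneg (fun k hk => ?_) fun _ _ _ => by positivity
        simp only [hs₂, Finset.mem_filter, Finset.mem_range] at hk
        simp only [Finset.mem_Ico]
        omega
      refine h2.trans ?_
      rw [Finset.sum_Ico_eq_sum_range]
      have h3 : ∀ i : ℕ, (1 / 2 : ℝ) ^ (k₀ + 1 + i) = (1 / 2) ^ (k₀ + 1) * (1 / 2) ^ i :=
        fun i => pow_add _ _ _
      simp_rw [h3]
      rw [← Finset.mul_sum]
      have h4 := sum_geometric_two_le (k₀ + 1 + N - (k₀ + 1))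
      calc _ ≤ (1 / 2 : ℝ) ^ (k₀ + 1) * 2 := by gcongr
        _ = (1 / 2) ^ k₀ := by rw [pow_succ]; ring
    calc _ ≤ ∑ k ∈ s₂, ENNReal.ofReal ((1 / 2) ^ k) := Finset.sum_le_sum fun k _ => hPν k
      _ = ENNReal.ofReal (∑ k ∈ s₂, (1 / 2) ^ k) :=
        (ENNReal.ofReal_sum_of_nonneg fun k _ => by positivity).symm
      _ ≤ _ := ENNReal.ofReal_le_ofReal h1
  have hhead : P {ω | ENNReal.ofReal t < maximal (fun n => P[f₁|ℱ n]) ω} ≤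
      ENNReal.ofReal ((2 * G) ^ p * (1 / 2) ^ k₀) := by
    have hco := dyadicCoeff_nonneg hΦ hc q
    have hn : eLpNorm f₁ (ENNReal.ofReal p) P ≤
        ENNReal.ofReal (2 * G * ((1 / 2 : ℝ) ^ k₀) ^ (1 / p) * t) := by
      calc eLpNorm f₁ (ENNReal.ofReal p) P
          ≤ ∑ k ∈ s₁, eLpNorm (dyadicCoeff Φ q k • a k) (ENNReal.ofReal p) P :=
            eLpNorm_sum_le (fun k _ => (hci k).aestronglyMeasurable) (by simpa using hp1.le)
        _ ≤ ∑ k ∈ s₁, ENNReal.ofReal (dyadicCoeff Φ q k * 2) := by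
            refine Finset.sum_le_sum fun k _ => ?_
            rw [eLpNorm_const_smul, Real.enorm_of_nonneg (hco k), ENNReal.ofReal_mul (hco k)]
            gcongr
            simpa using hap k
        _ = ENNReal.ofReal (∑ k ∈ s₁, dyadicCoeff Φ q k * 2) :=
            (ENNReal.ofReal_sum_of_nonneg fun k _ => mul_nonneg (hco k) (by norm_num)).symm
        _ ≤ _ := by
            refine ENNReal.ofReal_le_ofReal ?_
            rw [← Finset.sum_mul]
            have h1 : ∑ k ∈ s₁, dyadicCoeff Φ q k ≤
                ∑ k ∈ Finset.range (k₀ + 1), dyadicCoeff Φ q k := by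
              refine Finset.sum_le_sum_of_subset_of_nonneg (fun k hk => ?_) fun k _ _ => hco k
              simp only [hs₁, Finset.mem_filter, Finset.mem_range] at hk ⊢
              omega
            have h2 : G * ((1 / 2 : ℝ) ^ k₀) ^ (1 / p) * inv Φ (1 / (1 / 2) ^ k₀) ≤
                G * ((1 / 2 : ℝ) ^ k₀) ^ (1 / p) * t := by gcongr
            linarith [hG k₀]
    refine (measure_maximal_condExp_le hp1.le ht).trans ?_
    have hpos : (0 : ℝ) < ((1 / 2 : ℝ) ^ k₀) ^ (1 / p) := by positivity
    have h1 : eLpNorm f₁ (ENNReal.ofReal p) P / ENNReal.ofReal t ≤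
        ENNReal.ofReal (2 * G * ((1 / 2 : ℝ) ^ k₀) ^ (1 / p)) := by
      refine ENNReal.div_le_of_le_mul ?_
      rwa [← ENNReal.ofReal_mul (by positivity)]
    calc _ ≤ ENNReal.ofReal (2 * G * ((1 / 2 : ℝ) ^ k₀) ^ (1 / p)) ^ p := by gcongr
      _ = _ := by
        rw [ENNReal.ofReal_rpow_of_pos (by positivity), Real.mul_rpow (by positivity) hpos.le,
          ← Real.rpow_mul (by positivity), one_div_mul_cancel hp0.ne', Real.rpow_one]
  have hfinal : P.real {ω | ENNReal.ofReal t < maximal (fun n => P[f|ℱ n]) ω} ≤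
      (2 * G) ^ p * (1 / 2) ^ k₀ + (1 / 2) ^ k₀ := by
    refine ENNReal.toReal_le_of_le_ofReal (by positivity) (hsplit.trans ?_)
    rw [ENNReal.ofReal_add (by positivity) (by positivity)]
    exact add_le_add hhead htail
  refine hfinal.trans ?_
  rw [le_div_iff₀ hΦt, hA]
  have h1 : (1 / 2 : ℝ) ^ k₀ * Φ t ≤ 2 := by
    rw [one_div_pow, one_div_mul_eq_div, div_le_iff₀ (by positivity), ← pow_succ']
    exact hk2.le
  have h2 : 0 < (2 * G) ^ p + 1 := by positivity
  calc ((2 * G) ^ p * (1 / 2) ^ k₀ + (1 / 2) ^ k₀) * Φ t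
      = ((2 * G) ^ p + 1) * ((1 / 2 : ℝ) ^ k₀ * Φ t) := by ring
    _ ≤ ((2 * G) ^ p + 1) * 2 := by gcongr
    _ = _ := by ring

end Atoms

/-! ### The Campanato norm of a representing function -/

section Representing

variable {Ω : Type*} {m : MeasurableSpace Ω} {P : Measure Ω} {ℱ : Filtration ℕ m} {Φ φ : ℝ → ℝ}
  {ℓ : ℝ} {g : Ω → ℝ} {q : ℝ}

lemma setLIntegral_tFun_div_Ioc_le (hΦ : MemG ℓ Φ) (hc : ConcaveOn ℝ (Ici 0) Φ)
    (hφ : ∀ r : ℝ, 0 < r → φ r = 1 / (r * inv Φ (1 / r))) (hq : 1 ≤ q) {D : ℝ} (hD1 : 1 ≤ D)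
    (hD : ∀ y, 0 ≤ y → inv Φ (2 * y) ≤ D * inv Φ y) {y : ℝ} (hy : 0 < y) :
    ∫⁻ x in Ioc (y / 2) y, tFun P ℱ q φ g x / ENNReal.ofReal x ≤
      ENNReal.ofReal D * tFun P ℱ q φ g y := by
  have hD0 : 0 < D := by linarith
  have hψy := hΦ.inv_pos hc (y := 1 / y) (by positivity)
  have hbound : ∀ x ∈ Ioc (y / 2) y, tFun P ℱ q φ g x / ENNReal.ofReal x ≤
      ENNReal.ofReal (2 / y) * (ENNReal.ofReal D * tFun P ℱ q φ g y) := fun x hx => by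
    have hx0 : 0 < x := (half_pos hy).trans hx.1
    have hψ := hΦ.inv_pos hc (y := 1 / x) (by positivity)
    rw [tFun_eq hφ hx0, tFun_eq hφ hy, div_eq_mul_inv, ← ENNReal.ofReal_inv_of_pos hx0,
      mul_right_comm, ← ENNReal.ofReal_mul (by positivity), ← mul_assoc, ← mul_assoc,
      ← ENNReal.ofReal_mul (by positivity), ← ENNReal.ofReal_mul (by positivity)]
    refine mul_le_mul' (ENNReal.ofReal_le_ofReal ?_) (osc_mono hx.2)
    have h1 : inv Φ (1 / x) ≤ D * inv Φ (1 / y) := by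
      refine (hΦ.inv_mono hc (by positivity) ?_).trans (hD _ (by positivity))
      rw [mul_one_div, div_le_div_iff₀ hx0 hy]
      linarith [hx.1]
    have h2 : x⁻¹ ≤ 2 / y := by
      rw [← one_div, div_le_div_iff₀ hx0 hy]
      linarith [hx.1]
    have hpow : ∀ z : ℝ, 0 < z → z * z ^ (-1 / q) = z ^ (1 - 1 / q) := fun z hz => by
      nth_rewrite 1 [← Real.rpow_one z]
      rw [← Real.rpow_add hz]
      congr 1
      ring
    have h3 : x * x ^ (-1 / q) ≤ y * y ^ (-1 / q) := by
      rw [hpow x hx0, hpow y hy]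
      refine Real.rpow_le_rpow hx0.le hx.2 (sub_nonneg.2 ?_)
      rw [div_le_one (by linarith)]
      exact hq
    calc x * inv Φ (1 / x) * x ^ (-1 / q) * x⁻¹
        = x⁻¹ * (inv Φ (1 / x) * (x * x ^ (-1 / q))) := by ring
      _ ≤ 2 / y * (D * inv Φ (1 / y) * (y * y ^ (-1 / q))) := by gcongr
      _ = 2 / y * D * (y * inv Φ (1 / y) * y ^ (-1 / q)) := by ring
  refine (setLIntegral_mono' measurableSet_Ioc hbound).trans (le_of_eq ?_)
  rw [setLIntegral_const, Real.volume_Ioc, mul_right_comm, ← ENNReal.ofReal_mul (by positivity)]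
  have : 2 / y * (y - y / 2) = 1 := by field_simp; ring
  rw [this, ENNReal.ofReal_one, one_mul]

/-- The part `x ≤ 1` of the integral in the Campanato norm is controlled by the values at dyadic
points. -/
lemma exists_setLIntegral_tFun_div_Ioc_zero_one_le (hΦ : MemG ℓ Φ) (hc : ConcaveOn ℝ (Ici 0) Φ)
    (hφ : ∀ r : ℝ, 0 < r → φ r = 1 / (r * inv Φ (1 / r))) (hq : 1 ≤ q) :
    ∃ D : ℝ≥0, ∀ (P : Measure Ω) (ℱ : Filtration ℕ m) (g : Ω → ℝ),
      ∫⁻ x in Ioc 0 1, tFun P ℱ q φ g x / ENNReal.ofReal x ≤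
        D * ∑' k : ℕ, tFun P ℱ q φ g ((1 / 2) ^ k) := by
  obtain ⟨D, hD1, hD⟩ := hΦ.exists_inv_doubling hc
  refine ⟨D.toNNReal, fun P ℱ g => ?_⟩
  have hcover : Ioc (0 : ℝ) 1 ⊆ ⋃ k : ℕ, Ioc ((1 / 2 : ℝ) ^ k / 2) ((1 / 2) ^ k) := fun x hx => by
    obtain ⟨k, hk1, hk2⟩ := exists_nat_pow_near_of_lt_one hx.1 hx.2
      (by norm_num : (0 : ℝ) < 1 / 2) (by norm_num)
    refine mem_iUnion.2 ⟨k, lt_of_eq_of_lt ?_ hk1, hk2⟩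
    rw [pow_succ]
    ring
  calc _ ≤ ∫⁻ x in ⋃ k : ℕ, Ioc ((1 / 2 : ℝ) ^ k / 2) ((1 / 2) ^ k),
        tFun P ℱ q φ g x / ENNReal.ofReal x := lintegral_mono_set hcover
    _ ≤ ∑' k : ℕ, ∫⁻ x in Ioc ((1 / 2 : ℝ) ^ k / 2) ((1 / 2) ^ k),
        tFun P ℱ q φ g x / ENNReal.ofReal x := lintegral_iUnion_le _ _
    _ ≤ ∑' k : ℕ, ENNReal.ofReal D * tFun P ℱ q φ g ((1 / 2) ^ k) :=
      ENNReal.tsum_le_tsum fun k => setLIntegral_tFun_div_Ioc_le hΦ hc hφ hq hD1 hD (by positivity)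
    _ = _ := ENNReal.tsum_mul_left

variable [IsProbabilityMeasure P]

lemma osc_le (hgen : ⨆ n, (ℱ n : MeasurableSpace Ω) = m) (hg : Integrable g P) (hq : 1 ≤ q)
    (x : ℝ) : osc P ℱ q g x ≤ 2 * eLpNorm g (ENNReal.ofReal q) P := by
  have hq1 : 1 ≤ ENNReal.ofReal q := by simpa using hq
  refine iSup_le fun ν => iSup_le fun hν => iSup_le fun _ => ?_
  refine (eLpNorm_sub_le hg.aestronglyMeasurable
    (integrable_stopped hgen hν hg).aestronglyMeasurable hq1).trans ?_
  rw [two_mul]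
  exact add_le_add le_rfl (eLpNorm_stopped_le hgen hν hg hq1)

/-- The part `x > 1` of the integral in the Campanato norm is controlled by the norm in `L_q`. -/
lemma exists_setLIntegral_tFun_div_Ioi_one_le (hΦ : MemG ℓ Φ) (hc : ConcaveOn ℝ (Ici 0) Φ)
    (hφ : ∀ r : ℝ, 0 < r → φ r = 1 / (r * inv Φ (1 / r))) (hq : 1 ≤ q)
    (hgen : ⨆ n, (ℱ n : MeasurableSpace Ω) = m) :
    ∃ E : ℝ≥0, ∀ g : Ω → ℝ, Integrable g P →
      ∫⁻ x in Ioi 1, tFun P ℱ q φ g x / ENNReal.ofReal x ≤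
        E * eLpNorm g (ENNReal.ofReal q) P := by
  have hψ := hΦ.inv_pos hc one_pos
  have hint : IntegrableOn (fun x : ℝ => inv Φ 1 * x ^ (-1 / q - 1)) (Ioi 1) := by
    refine (integrableOn_Ioi_rpow_of_lt ?_ one_pos).const_mul _
    have : -1 / q < 0 := div_neg_of_neg_of_pos (by norm_num) (by linarith)
    linarith
  set E := ∫⁻ x in Ioi (1 : ℝ), ENNReal.ofReal (inv Φ 1 * x ^ (-1 / q - 1)) with hE
  have hEfin : E ≠ ∞ := (hint.ofReal).lintegral_lt_top.ne
  refine ⟨E.toNNReal * 2, fun g hg => ?_⟩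
  rw [ENNReal.coe_mul, ENNReal.coe_toNNReal hEfin, mul_assoc]
  have hfin : ∀ x ∈ Ioi (1 : ℝ), tFun P ℱ q φ g x / ENNReal.ofReal x ≤
      ENNReal.ofReal (inv Φ 1 * x ^ (-1 / q - 1)) * (2 * eLpNorm g (ENNReal.ofReal q) P) := by
    intro x hx
    have hx1 : 1 < x := hx
    have hx0 : 0 < x := by linarith
    have hψx := hΦ.inv_pos hc (y := 1 / x) (by positivity)
    rw [tFun_eq hφ hx0, div_eq_mul_inv, ← ENNReal.ofReal_inv_of_pos hx0,
      mul_right_comm, ← ENNReal.ofReal_mul (by positivity)]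
    refine mul_le_mul' (ENNReal.ofReal_le_ofReal ?_) (osc_le hgen hg hq x)
    have h1 : inv Φ (1 / x) ≤ 1 / x * inv Φ 1 := by
      have := hΦ.inv_mul_le hc (s := 1 / x) (y := 1) (by positivity)
        ((div_le_one hx0).2 hx1.le) zero_le_one
      rwa [mul_one] at this
    calc x * inv Φ (1 / x) * x ^ (-1 / q) * x⁻¹
        ≤ x * (1 / x * inv Φ 1) * x ^ (-1 / q) * x⁻¹ := by gcongr
      _ = inv Φ 1 * x ^ (-1 / q - 1) := by
        rw [Real.rpow_sub_one hx0.ne']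
        field_simp
  refine (setLIntegral_mono' measurableSet_Ioi hfin).trans ?_
  exact (lintegral_mul_const'' _ hint.aestronglyMeasurable.aemeasurable.ennreal_ofReal).le

lemma exists_stoppingTime_osc_le (hgen : ⨆ n, (ℱ n : MeasurableSpace Ω) = m)
    (hg : MemLp g (ENNReal.ofReal q) P) (hq : 1 ≤ q) (x : ℝ) :
    ∃ ν : Ω → WithTop ℕ, IsStoppingTime ℱ ν ∧ P {ω | ν ω < ⊤} ≤ ENNReal.ofReal x ∧
      osc P ℱ q g x ≤
        2 * eLpNorm (fun ω => g ω - stopped P ℱ g ν ω) (ENNReal.ofReal q) P := by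
  rcases eq_or_ne (osc P ℱ q g x) 0 with h0 | h0
  · refine ⟨fun _ => ⊤, fun i => ?_, by simp, by simp [h0]⟩
    simp
  have hfin : osc P ℱ q g x ≠ ∞ := ne_top_of_le_ne_top
    (ENNReal.mul_ne_top ENNReal.ofNat_ne_top hg.eLpNorm_ne_top)
    (osc_le hgen (hg.integrable (by simpa using hq)) hq x)
  have hlt := ENNReal.half_lt_self h0 hfin
  nth_rewrite 2 [osc] at hlt
  simp only [lt_iSup_iff, exists_prop] at hlt
  obtain ⟨ν, hν, hP, hlt⟩ := hlt
  refine ⟨ν, hν, hP, ?_⟩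
  rw [mul_comm]
  exact (ENNReal.div_le_iff_le_mul (by simp) (by simp)).1 hlt.le

/-- The atom that detects the oscillation of `g` after the time `ν`. -/
lemma exists_atom (hgen : ⨆ n, (ℱ n : MeasurableSpace Ω) = m) (hg : AEStronglyMeasurable g P)
    {B : ℝ} (hB : ∀ᵐ ω ∂P, |g ω| ≤ B) {p : ℝ} (hqp : q.HolderConjugate p) {ν : Ω → WithTop ℕ}
    (hν : IsStoppingTime ℱ ν) :
    ∃ a, BddMeanZero P ℱ a ∧ eLpNorm a (ENNReal.ofReal p) P ≤ 2 ∧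
      (∀ n, ∀ᵐ ω ∂P, ν ω = ⊤ → (P[a|ℱ n]) ω = 0) ∧ 0 ≤ ∫ ω, a ω * g ω ∂P ∧
      ENNReal.ofReal (∫ ω, a ω * g ω ∂P) =
        eLpNorm (fun ω => g ω - stopped P ℱ g ν ω) (ENNReal.ofReal q) P := by
  have hbdd : ∀ {u : Ω → ℝ} {L : ℝ}, AEStronglyMeasurable u P → (∀ᵐ ω ∂P, |u ω| ≤ L) →
      ∀ᵐ ω ∂P, |u ω - stopped P ℱ u ν ω| ≤ L + L := fun {u L} hu hL => by
    filter_upwards [hL, abs_stopped_le (ν := ν) hgen (Integrable.of_bound hu L hL)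
      ((ae_all_iff.2 fun n => ae_bdd_abs_condExp_of_ae_bdd_abs (m := ℱ n) hL).mono
        fun ω h n _ => h n)] with ω h1 h2
    exact (abs_sub _ _).trans (add_le_add h1 h2)
  have hgi : Integrable g P := Integrable.of_bound hg B hB
  have hgν := integrable_stopped hgen hν hgi
  obtain ⟨u, hu, ⟨L, hL⟩, hu1, hug0, hug⟩ := exists_dual_function
    (hg.sub hgν.aestronglyMeasurable) (hbdd hg hB) hqp
  have hui : Integrable u P := Integrable.of_bound hu L hL
  have huν := integrable_stopped hgen hν hui
  have hp1 : 1 ≤ ENNReal.ofReal p := by simpa using hqp.symm.lt.le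
  have e : ∫ ω, (u - stopped P ℱ u ν) ω * g ω ∂P =
      ∫ ω, u ω * (g - stopped P ℱ g ν) ω ∂P := by
    simp only [Pi.sub_apply, sub_mul, mul_sub]
    rw [integral_sub (hgi.bdd_mul (c := L) hu hL) (huν.mul_bdd (c := B) hg hB),
      integral_sub (hgi.bdd_mul (c := L) hu hL) (hgν.bdd_mul (c := L) hu hL),
      integral_stopped_mul_comm hgen hν hu hL hgi]
  refine ⟨u - stopped P ℱ u ν, ⟨hu.sub huν.aestronglyMeasurable, ⟨L + L, hbdd hu hL⟩, ?_⟩, ?_,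
    fun n => ?_, e ▸ hug0, e ▸ hug⟩
  · filter_upwards [condExp_sub hui huν (ℱ 0), condExp_zero_stopped hgen hν hui] with ω h1 h2
    rw [h1, Pi.sub_apply, h2, sub_self, Pi.zero_apply]
  · refine (eLpNorm_sub_le hu huν.aestronglyMeasurable hp1).trans ?_
    rw [← one_add_one_eq_two]
    exact add_le_add hu1 ((eLpNorm_stopped_le hgen hν hui hp1).trans hu1)
  · filter_upwards [condExp_sub_stopped_eq_zero hgen hν hui n] with ω h hω
    exact h (hω ▸ le_top)

/-- The values of `t_φ^q` at the dyadic points are summable: testing `g` with the superposition of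
the atoms that detect its oscillations gives their partial sums. -/
lemma exists_tsum_tFun_le (hgen : ⨆ n, (ℱ n : MeasurableSpace Ω) = m) (hΦ : MemG ℓ Φ)
    (hc : ConcaveOn ℝ (Ici 0) Φ) (hφ : ∀ r : ℝ, 0 < r → φ r = 1 / (r * inv Φ (1 / r)))
    (hq : 1 < q) : ∃ C : ℝ≥0, ∀ (g : Ω → ℝ) (B : ℝ) (Λ : ℝ≥0∞), AEStronglyMeasurable g P →
      (∀ᵐ ω ∂P, |g ω| ≤ B) → (∀ d, BddMeanZero P ℱ d →
        ‖∫ ω, d ω * g ω ∂P‖ₑ ≤ Λ * hNorm Φ P (fun n => P[d|ℱ n])) →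
      ∑' k : ℕ, tFun P ℱ q φ g ((1 / 2) ^ k) ≤ C * Λ := by
  have hqp := Real.HolderConjugate.conjExponent hq
  obtain ⟨C, hC0, hC⟩ := exists_hNorm_sum_atoms_le (P := P) (ℱ := ℱ) hΦ hc hqp
  refine ⟨2 * C.toNNReal, fun g B Λ hg hB h => ENNReal.tsum_le_of_sum_range_le fun N => ?_⟩
  choose ν hν hPν hosc using fun k : ℕ => exists_stoppingTime_osc_le hgen
    (MemLp.of_bound hg B hB) hq.le ((1 / 2) ^ k)
  choose a ha ha2 hav hag0 hag using fun k => exists_atom hgen hg hB hqp (hν k)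
  have hco := dyadicCoeff_nonneg hΦ hc q
  have hf : BddMeanZero P ℱ (∑ k ∈ Finset.range N, dyadicCoeff Φ q k • a k) :=
    BddMeanZero.sum _ fun k _ => (ha k).smul _
  have hgi : Integrable g P := Integrable.of_bound hg B hB
  have hint : ∫ ω, (∑ k ∈ Finset.range N, dyadicCoeff Φ q k • a k) ω * g ω ∂P =
      ∑ k ∈ Finset.range N, dyadicCoeff Φ q k * ∫ ω, a k ω * g ω ∂P := by
    simp only [Finset.sum_apply, Pi.smul_apply, smul_eq_mul, Finset.sum_mul, mul_assoc]
    rw [integral_finsetSum _ fun k _ => ((ha k).integrable_mul hgi).const_mul _]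
    simp only [integral_const_mul]
  have hterm : ∀ k, tFun P ℱ q φ g ((1 / 2) ^ k) ≤
      2 * ENNReal.ofReal (dyadicCoeff Φ q k * ∫ ω, a k ω * g ω ∂P) := fun k => by
    rw [tFun_eq hφ (by positivity), ENNReal.ofReal_mul (hco k), hag, mul_left_comm]
    exact mul_le_mul' le_rfl (hosc k)
  calc _ ≤ ∑ k ∈ Finset.range N,
        2 * ENNReal.ofReal (dyadicCoeff Φ q k * ∫ ω, a k ω * g ω ∂P) :=
        Finset.sum_le_sum fun k _ => hterm k
    _ = 2 * ENNReal.ofReal (∫ ω, (∑ k ∈ Finset.range N, dyadicCoeff Φ q k • a k) ω * g ω ∂P) := by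
      rw [← Finset.mul_sum, hint,
        ENNReal.ofReal_sum_of_nonneg fun k _ => mul_nonneg (hco k) (hag0 k)]
    _ ≤ 2 * (Λ * ENNReal.ofReal C) := by
      refine mul_le_mul' le_rfl ((Real.ofReal_le_enorm _).trans ((h _ hf).trans ?_))
      exact mul_le_mul' le_rfl
        (hC a ν (fun k => (ha k).integrable) ha2 hPν (fun k n => hav k n) N)
    _ = _ := by
      rw [ENNReal.coe_mul, ENNReal.coe_ofNat, mul_assoc, mul_comm Λ]
      rfl

lemma ae_abs_le_of_integral_mul_le_hNorm (hΦ : MemG ℓ Φ) (hc : ConcaveOn ℝ (Ici 0) Φ)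
    (hg : Integrable g P) (h0 : P[g|ℱ 0] =ᵐ[P] 0) {Λ : ℝ≥0}
    (h : ∀ d, BddMeanZero P ℱ d →
      ‖∫ ω, d ω * g ω ∂P‖ₑ ≤ Λ * hNorm Φ P (fun n => P[d|ℱ n])) :
    ∀ᵐ ω ∂P, |g ω| ≤ (2 * (Λ * (1 / inv Φ 1).toNNReal) : ℝ≥0) := by
  have := ae_abs_le_of_integral_mul_le (C := Λ * (1 / inv Φ 1).toNNReal) hg h0 fun d hd => by
    refine (h d hd).trans ?_
    rw [ENNReal.coe_mul, mul_assoc]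
    exact mul_le_mul_right (hNorm_condExp_le hΦ hc hd.integrable) _
  simpa only [NNReal.coe_mul, NNReal.coe_ofNat] using this

/-- If the pairing with `g` is bounded by `Λ` in the quasi-norm of the weak Hardy space, then `g`
has Campanato norm at most a constant multiple of `Λ`. -/
lemma exists_campanatoNorm_le (hgen : ⨆ n, (ℱ n : MeasurableSpace Ω) = m) (hΦ : MemG ℓ Φ)
    (hc : ConcaveOn ℝ (Ici 0) Φ) (hφ : ∀ r : ℝ, 0 < r → φ r = 1 / (r * inv Φ (1 / r)))
    (hq : 1 ≤ q) : ∃ C : ℝ≥0, ∀ (g : Ω → ℝ) (Λ : ℝ≥0), Integrable g P → P[g|ℱ 0] =ᵐ[P] 0 →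
      (∀ d, BddMeanZero P ℱ d →
        ‖∫ ω, d ω * g ω ∂P‖ₑ ≤ Λ * hNorm Φ P (fun n => P[d|ℱ n])) →
      campanatoNorm P ℱ q φ g ≤ C * Λ := by
  -- the exponent `q + 1` has a finite conjugate exponent even if `q = 1`
  have hq1 : 1 < q + 1 := by linarith
  obtain ⟨C, hC⟩ := exists_tsum_tFun_le (P := P) hgen hΦ hc hφ hq1
  obtain ⟨D, hD⟩ := exists_setLIntegral_tFun_div_Ioc_zero_one_le (m := m) hΦ hc hφ hq1.le
  obtain ⟨E, hE⟩ := exists_setLIntegral_tFun_div_Ioi_one_le (P := P) hΦ hc hφ hq1.le hgen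
  refine ⟨D * C + E * (2 * (1 / inv Φ 1).toNNReal), fun g Λ hg h0 h => ?_⟩
  have hB := ae_abs_le_of_integral_mul_le_hNorm hΦ hc hg h0 h
  set B : ℝ≥0 := 2 * (Λ * (1 / inv Φ 1).toNNReal) with hBdef
  have hnorm : eLpNorm g (ENNReal.ofReal (q + 1)) P ≤ B := by
    refine (eLpNorm_le_of_ae_bound hB).trans ?_
    simp
  refine (campanatoNorm_mono hgen hΦ hc hφ hq (by linarith : q ≤ q + 1) hg).trans ?_
  calc campanatoNorm P ℱ (q + 1) φ g
      ≤ (∫⁻ x in Ioc 0 1, tFun P ℱ (q + 1) φ g x / ENNReal.ofReal x) +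
        ∫⁻ x in Ioi 1, tFun P ℱ (q + 1) φ g x / ENNReal.ofReal x := by
        rw [campanatoNorm, ← Ioc_union_Ioi_eq_Ioi zero_le_one]
        exact lintegral_union_le _ _ _
    _ ≤ D * (C * Λ) + E * B :=
      add_le_add ((hD P ℱ g).trans (mul_le_mul_right (hC g B Λ hg.aestronglyMeasurable hB h) _))
        ((hE g hg).trans (mul_le_mul_right hnorm _))
    _ = _ := by
      rw [hBdef]
      push_cast
      ring

end Representing

/-! ### Duality -/

section Duality

variable {Ω : Type*} {m : MeasurableSpace Ω} {P : Measure Ω} [IsProbabilityMeasure P]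
  {ℱ : Filtration ℕ m} {Φ φ : ℝ → ℝ} {ℓ q : ℝ} {hΦ : MemG ℓ Φ} {l : wScriptH hΦ P ℱ →ₗ[ℝ] ℝ}
  {g : Ω → ℝ}

lemma Represents.apply_eq (h : Represents q g l) {d : Ω → ℝ} (hd : BddMeanZero P ℱ d)
    (hdm : (fun n => P[d|ℱ n]) ∈ wScriptH hΦ P ℱ) : l ⟨_, hdm⟩ = ∫ ω, d ω * g ω ∂P :=
  (h d (hd.memLp _) hd.condExp_zero).2

lemma represents_of_bddMeanZero (hc : ConcaveOn ℝ (Ici 0) Φ) (hl : IsBoundedFunctional l)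
    (q : ℝ) {B : ℝ≥0} (hg : AEStronglyMeasurable g P) (hB : ∀ᵐ ω ∂P, |g ω| ≤ B)
    (h : ∀ d, BddMeanZero P ℱ d → ∀ hd : (fun n => P[d|ℱ n]) ∈ wScriptH hΦ P ℱ,
      l ⟨_, hd⟩ = ∫ ω, d ω * g ω ∂P) : Represents q g l := fun f hf h0 => by
  have hfi : Integrable f P := hf.integrable le_self_add
  have hfm := condExp_mem_wScriptH hΦ hc hfi h0
  exact ⟨hfm, apply_condExp_eq_integral hc hl hg hB h hfi h0 hfm⟩

lemma MemCampanato.integrable (hg : MemCampanato P ℱ q φ g) (hq : 1 ≤ q) : Integrable g P :=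
  hg.memLp.integrable (by simpa using hq)

/-- Every function of Campanato class represents a functional whose bound is controlled by its
Campanato norm. -/
lemma exists_functional_of_memCampanato (hgen : ⨆ n, (ℱ n : MeasurableSpace Ω) = m)
    (hreg : IsRegular P ℱ) (hΦ : MemG ℓ Φ) (hc : ConcaveOn ℝ (Ici 0) Φ)
    (hφ : ∀ r : ℝ, 0 < r → φ r = 1 / (r * inv Φ (1 / r))) (hq : 1 ≤ q) :
    ∃ C : ℝ≥0, ∀ g, MemCampanato P ℱ q φ g → ∃ l : wScriptH hΦ P ℱ →ₗ[ℝ] ℝ,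
      (∀ f, ‖l f‖ₑ ≤ C * campanatoNorm P ℱ q φ g * hNorm Φ P f) ∧ IsBoundedFunctional l ∧
      Represents q g l := by
  obtain ⟨C, -, hC⟩ := exists_enorm_integral_mul_le_campanatoNorm hgen hreg hΦ hc hφ
  obtain ⟨K, -, hK⟩ := exists_hNorm_add (P := P) hΦ
  refine ⟨C * K, fun g hg => ?_⟩
  have hgi := hg.integrable hq
  have hmono := campanatoNorm_mono hgen hΦ hc hφ le_rfl hq hgi
  set Λ : ℝ≥0 := C * (campanatoNorm P ℱ q φ g).toNNReal with hΛ
  have hΛ' : (Λ : ℝ≥0∞) = C * campanatoNorm P ℱ q φ g := by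
    rw [hΛ, ENNReal.coe_mul, ENNReal.coe_toNNReal hg.norm_lt_top.ne]
  have hpair : ∀ d, BddMeanZero P ℱ d →
      ‖∫ ω, d ω * g ω ∂P‖ₑ ≤ Λ * hNorm Φ P (fun n => P[d|ℱ n]) := fun d hd => by
    refine (hC g hgi (hmono.trans_lt hg.norm_lt_top) d hd).trans ?_
    rw [hΛ']
    gcongr
  obtain ⟨l, hl, hlg⟩ := exists_functional_of_integral_mul_le hgen hreg hΦ hc hK hgi hpair
  have hlb : IsBoundedFunctional l := ⟨Λ * K, by simpa only [ENNReal.coe_mul] using hl⟩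
  refine ⟨l, fun f => (hl f).trans (le_of_eq ?_), hlb, represents_of_bddMeanZero hc hlb q
    hgi.aestronglyMeasurable
    (ae_abs_le_of_integral_mul_le_hNorm hΦ hc hgi hg.condExp_zero hpair) hlg⟩
  rw [hΛ']
  push_cast
  ring

lemma dualNorm_le {C : ℝ≥0∞} (h : ∀ f, ‖l f‖ₑ ≤ C * hNorm Φ P f) : dualNorm l ≤ C :=
  iSup₂_le fun f hf => (h f).trans (mul_le_of_le_one_right zero_le hf)

lemma enorm_integral_mul_le_dualNorm (hc : ConcaveOn ℝ (Ici 0) Φ) (hl : IsBoundedFunctional l)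
    (h : ∀ d, BddMeanZero P ℱ d → ∀ hd : (fun n => P[d|ℱ n]) ∈ wScriptH hΦ P ℱ,
      l ⟨_, hd⟩ = ∫ ω, d ω * g ω ∂P) {d : Ω → ℝ} (hd : BddMeanZero P ℱ d) :
    ‖∫ ω, d ω * g ω ∂P‖ₑ ≤ (dualNorm l).toNNReal * hNorm Φ P (fun n => P[d|ℱ n]) := by
  rw [← h d hd (condExp_mem_wScriptH hΦ hc hd.integrable hd.condExp_zero),
    ENNReal.coe_toNNReal (dualNorm_lt_top hl).ne]
  exact enorm_apply_le hl _

end Duality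

end WeakOrliczHardy

open WeakOrliczHardy in
theorem lemma5p3 {Ω : Type*} {m : MeasurableSpace Ω} (P : Measure Ω) [IsProbabilityMeasure P]
    (ℱ : Filtration ℕ m) (hgen : ⨆ n, (ℱ n : MeasurableSpace Ω) = m)
    (hreg : WeakOrliczHardy.IsRegular P ℱ)
    {ℓ : ℝ} {Φ : ℝ → ℝ} (hΦ : WeakOrliczHardy.MemG ℓ Φ) (hconc : ConcaveOn ℝ (Ici 0) Φ)
    (hindex : WeakOrliczHardy.upperIndex (WeakOrliczHardy.inv Φ) < ⊤)
    (φ : ℝ → ℝ) (hφ : ∀ r : ℝ, 0 < r → φ r = 1 / (r * WeakOrliczHardy.inv Φ (1 / r)))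
    (q : ℝ) (hq : 1 ≤ q) :
    -- every `g` in the Campanato space defines exactly one continuous functional
    (∀ g : Ω → ℝ, WeakOrliczHardy.MemCampanato P ℱ q φ g →
      ∃! l : WeakOrliczHardy.wScriptH hΦ P ℱ →ₗ[ℝ] ℝ,
        WeakOrliczHardy.IsBoundedFunctional l ∧ WeakOrliczHardy.Represents q g l) ∧
    -- every continuous functional comes from exactly one (up to a.e. equality) such `g`
    (∀ l : WeakOrliczHardy.wScriptH hΦ P ℱ →ₗ[ℝ] ℝ, WeakOrliczHardy.IsBoundedFunctional l →
      ∃ g : Ω → ℝ, WeakOrliczHardy.MemCampanato P ℱ q φ g ∧ WeakOrliczHardy.Represents q g l ∧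
        ∀ g' : Ω → ℝ, WeakOrliczHardy.MemCampanato P ℱ q φ g' →
          WeakOrliczHardy.Represents q g' l → g' =ᵐ[P] g) ∧
    -- the norms are equivalent
    (∃ C : ℝ≥0, 0 < C ∧ ∀ (g : Ω → ℝ) (l : WeakOrliczHardy.wScriptH hΦ P ℱ →ₗ[ℝ] ℝ),
      WeakOrliczHardy.MemCampanato P ℱ q φ g → WeakOrliczHardy.IsBoundedFunctional l →
      WeakOrliczHardy.Represents q g l →
        WeakOrliczHardy.dualNorm l ≤ C * WeakOrliczHardy.campanatoNorm P ℱ q φ g ∧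
        WeakOrliczHardy.campanatoNorm P ℱ q φ g ≤ C * WeakOrliczHardy.dualNorm l) := by
  obtain ⟨C₁, hC₁⟩ := exists_functional_of_memCampanato hgen hreg hΦ hconc hφ hq
  obtain ⟨C₂, hC₂⟩ := exists_campanatoNorm_le (P := P) hgen hΦ hconc hφ hq
  have huniq : ∀ {g : Ω → ℝ} {l l' : wScriptH hΦ P ℱ →ₗ[ℝ] ℝ}, IsBoundedFunctional l →
      IsBoundedFunctional l' → Represents q g l → Represents q g l' → l = l' :=
    fun hl hl' h h' => functional_ext hgen hreg hconc hl hl' fun d hd hdm => by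
      rw [h.apply_eq hd, h'.apply_eq hd]
  refine ⟨fun g hg => ?_, fun l hl => ?_, max 1 (max C₁ C₂), by positivity,
    fun g l hg hl hlg => ⟨?_, ?_⟩⟩
  · obtain ⟨l, -, hl, hlg⟩ := hC₁ g hg
    exact ⟨l, ⟨hl, hlg⟩, fun l' hl' => huniq hl'.1 hl hl'.2 hlg⟩
  · obtain ⟨g, hg, h0, hlg⟩ := exists_integral_mul_eq_apply hconc hl
    have hpair := fun d (hd : BddMeanZero P ℱ d) => enorm_integral_mul_le_dualNorm hconc hl hlg hd
    have hB := ae_abs_le_of_integral_mul_le_hNorm hΦ hconc hg h0 hpair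
    have hrep := represents_of_bddMeanZero hconc hl q hg.aestronglyMeasurable hB hlg
    refine ⟨g, ⟨MemLp.of_bound hg.aestronglyMeasurable _ hB, h0, ?_⟩, hrep, fun g' hg' hrep' => ?_⟩
    · exact (hC₂ g _ hg h0 hpair).trans_lt (ENNReal.mul_lt_top ENNReal.coe_lt_top
        ENNReal.coe_lt_top)
    · refine ae_eq_of_integral_mul_eq (hg'.integrable hq) hg hg'.condExp_zero h0 fun d hd => ?_
      have hdm := condExp_mem_wScriptH hΦ hconc hd.integrable hd.condExp_zero
      rw [← hrep'.apply_eq hd hdm, hlg d hd hdm]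
  · obtain ⟨l', hl', hlb', hlg'⟩ := hC₁ g hg
    rw [huniq hl hlb' hlg hlg']
    refine (dualNorm_le hl').trans (mul_le_mul_left (ENNReal.coe_le_coe.2 ?_) _)
    exact (le_max_left _ _).trans (le_max_right _ _)
  · have hpair := fun d (hd : BddMeanZero P ℱ d) =>
      enorm_integral_mul_le_dualNorm hconc hl (fun d hd hdm => hlg.apply_eq hd hdm) hd
    refine (hC₂ g _ (hg.integrable hq) hg.condExp_zero hpair).trans ?_
    rw [ENNReal.coe_toNNReal (dualNorm_lt_top hl).ne]
    refine mul_le_mul_left (ENNReal.coe_le_coe.2 ?_) _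
    exact (le_max_right _ _).trans (le_max_right _ _)
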